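/- Fix \(d,\lambda_1,\lambda_2,\delta>0\) and a non-integer \(s>1\). Write \(\Omega=\{x\in\mathbb R^3:-d<x_3<0\}\), \(\Lambda=\lambda_1\mathbb Z\times\lambda_2\mathbb Z\), let \(R_j\) be the reflection of the \(j\)th coordinate, and let \(\boldsymbol e_1,\boldsymbol e_2,\boldsymbol e_3\) be the standard basis of \(\mathbb R^3\). For an open set \(U\), an integer \(k\ge 0\) and \(r\in(0,1)\), \(C^{k+r}(\overline U)\) is the space of functions on \(\overline U\) that are \(k\) times continuously differentiable in \(U\), whose derivatives of order at most \(k\) are bounded and extend continuously to \(\overline U\), and whose \(k\)th derivative is \(r\)-Hölder in \(U\); its norm is \[\|f\|_{k+r}=\sup_{j\le k,\;x\in U}\|D^jf(x)\|+\sup_{x\ne y\in U}\frac{\|D^kf(x)-D^kf(y)\|}{|x-y|^r}.\] \(C^{s}_{\mathrm{loc}}(\overline\Omega)\) consists of the functions that belong to \(C^s(\overline U)\) for every bounded open \(U\subset\Omega\). Norms without further indication are over \(\Omega\), and \(\|\cdot\|_{s|r}\) is the norm over \(\Omega\cap B_r(0)\). A function on \(\overline\Omega\) is \(\Lambda\)-periodic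 if it is invariant under horizontal translations by \(\Lambda\). A scalar field \(\varphi\) is \((\pm)\)-symmetric if \(\varphi(R_jx)=(\pm1)^j\varphi(x)\), and a vector field \(\boldsymbol f\) is \((\pm)\)-symmetric if \(\boldsymbol f(R_jx)=\pm(-1)^jR_j\boldsymbol f(x)\), in both cases for \(j=1,2\) and all \(x\in\overline\Omega\). For non-integer \(t>0\), let \(X^t_\pm\) be the space of \(\Lambda\)-periodic, \((\pm)\)-symmetric fields \(\boldsymbol f\in C^t(\overline\Omega;\mathbb R^3)\) with \(\nabla\cdot\boldsymbol f=0\) in \(\Omega\) (in the sense of distributions, which for \(t>1\) is the classical condition), and let \(Y^t_+\) be the space of \(\Lambda\)-periodic, \((+)\)-symmetric \(\varphi\in C^t(\overline\Omega)\). Let \(\mathcal U^s_\delta\) be the set of \(\boldsymbol u\in X^s_+\) with \(u_3=0\) on \(\partial\Omega\) and \(u_1>\delta\) on \(\overline\Omega\). **Proposition.** Let \(\boldsymbol u\in\mathcal U_\delta^s\). For each \(f\in C^s_{\mathrm{loc}}(\overline\Omega)\), the problem \[\boldsymbol u\cdot\nabla g=f\ \text{ in }\Omega,\qquad g|_{x_1=0}=0\]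 has a unique solution \(g\in C^s_{\mathrm{loc}}(\overline\Omega)\). Moreover, for all \(M\ge 0\) and \(r_0>0\) there are constants \(C\) and \(R\), which depend only on \(M\), \(r_0\) and the fixed \(d,\lambda_1,\lambda_2,\delta,s\), such that \[\|g\|_{s|r_0}\le C\,\|f\|_{s|r}\qquad\text{for all } r\ge R\] whenever \(\boldsymbol u\in\mathcal U_\delta^s\), \(\|\boldsymbol u\|_s\le M\) and \(f\in C^s_{\mathrm{loc}}(\overline\Omega)\). If in addition \(f\in Y^s_+\), and \(G:=g(\cdot+\lambda_1\boldsymbol e_1)-g\), then 1. \(g(\cdot+\lambda_2\boldsymbol e_2)=g\), 2. \(g\) is \((-)\)-symmetric, 3. \(G\in Y^s_+\), and 4. \(\nabla G\times\nabla g\in X^{s-1}_-\). Finally, for every \(M\ge 0\) there is a constant \(C\), which depends only on \(M\) and the fixed \(d,\lambda_1,\lambda_2,\delta,s\), such that \[\|G\|_s\le C\|f\|_s\qquad\text{and}\qquad\|\nabla G\times\nabla g\|_{s-1}\le C\|f\|_s^2\] whenever \(\boldsymbol u\in\mathcal U_\delta^s\), \(\|\boldsymbol u\|_s\le M\) and \(f\in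 Y^s_+\). -/

import Mathlib

open Set Metric MeasureTheory
open scoped ENNReal NNReal ContDiff

noncomputable section

namespace SteadyTransport

/-- Three-dimensional Euclidean space; the coordinates `x₁, x₂, x₃` are `x 0, x 1, x 2`. -/
abbrev E3 : Type := EuclideanSpace ℝ (Fin 3)

/-! ### Hölder spaces of non-integer order -/

section Holder

variable {F : Type*} [NormedAddCommGroup F] [NormedSpace ℝ F]

/-- The norm `‖f‖_s` of `C^s` over the open set `U`, with values in `[0, ∞]`, for `s = k + r` with
`k = ⌊s⌋` and `r = s - k ∈ (0, 1)`: the supremum over `U` of the operator norms of all derivatives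
of order at most `k`, plus the `r`-Hölder seminorm over `U` of the derivative of order `k`. -/
def holderNorm (s : ℝ) (U : Set E3) (f : E3 → F) : ℝ≥0∞ :=
  (⨆ (j : ℕ) (_ : j ≤ ⌊s⌋₊) (x : E3) (_ : x ∈ U), ‖iteratedFDeriv ℝ j f x‖ₑ) +
    ⨆ (x : E3) (_ : x ∈ U) (y : E3) (_ : y ∈ U) (_ : x ≠ y),
      ‖iteratedFDeriv ℝ ⌊s⌋₊ f x - iteratedFDeriv ℝ ⌊s⌋₊ f y‖ₑ / edist x y ^ Int.fract s

/-- `f ∈ C^s(closure U; F)` for an open set `U` and a non-integer `s > 0`. Only the values of `f` on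
the closure of `U` matter: `f` is continuous there, it is `⌊s⌋` times continuously differentiable
in `U`, its derivatives of order at most `⌊s⌋` extend continuously to the closure of `U`, they are
bounded in `U`, and the last one is Hölder continuous in `U` with exponent `s - ⌊s⌋`. -/
structure MemHolder (s : ℝ) (U : Set E3) (f : E3 → F) : Prop where
  continuousOn : ContinuousOn f (closure U)
  contDiffOn : ContDiffOn ℝ ⌊s⌋₊ f U
  extends_closure : ∀ j : ℕ, j ≤ ⌊s⌋₊ →
    ∃ D : E3 → ContinuousMultilinearMap ℝ (fun _ : Fin j => E3) F,
      ContinuousOn D (closure U) ∧ EqOn D (iteratedFDeriv ℝ j f) U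
  norm_lt_top : holderNorm s U f < ⊤

/-- `f ∈ C^s_loc(closure Ω; F)`: `f ∈ C^s(closure U; F)` for every bounded open `U ⊆ Ω`. -/
def MemHolderLoc (s : ℝ) (Ω : Set E3) (f : E3 → F) : Prop :=
  ∀ U : Set E3, IsOpen U → Bornology.IsBounded U → U ⊆ Ω → MemHolder s U f

end Holder

/-! ### The domain, periodicity and symmetry -/

/-- The flat fluid domain `Ω⁰ = {x : -d < x₃ < 0}`. -/
def slab (d : ℝ) : Set E3 := {x | -d < x 2 ∧ x 2 < 0}

/-- The set `{x ∈ Ω⁰ : |x| < r}`, whose closure (for `r > 0`) is the closed ball of radius `r` about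
the origin in the closure of `Ω⁰`. -/
def slabBall (d r : ℝ) : Set E3 := slab d ∩ ball 0 r

/-- `R_j`, the reflection of the `j`th coordinate. -/
def reflect (j : Fin 3) (x : E3) : E3 := WithLp.toLp 2 (fun i => if i = j then -x i else x i)

/-- The point `x + (a, b, 0)`. -/
def shift (a b : ℝ) (x : E3) : E3 := x + EuclideanSpace.single 0 a + EuclideanSpace.single 1 b

/-- Horizontal periodicity, on the closure of `Ω⁰`, with respect to the lattice `l₁ ℤ × l₂ ℤ`. -/
def IsPeriodic {F : Type*} (d l₁ l₂ : ℝ) (f : E3 → F) : Prop :=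
  ∀ m n : ℤ, ∀ x ∈ closure (slab d), f (shift (m * l₁) (n * l₂) x) = f x

/-- The `(ε)`-symmetry of a scalar field on the closure of `Ω⁰`, for a sign `ε = ±1`:
`φ(R_j x) = ε^j φ(x)` for `j = 1, 2`. (The index `j : Fin 2` is `0` or `1`, so that it stands for
the coordinate number `j + 1`.) -/
def IsSymmScalar (d ε : ℝ) (φ : E3 → ℝ) : Prop :=
  ∀ j : Fin 2, ∀ x ∈ closure (slab d),
    φ (reflect j.castSucc x) = ε ^ ((j : ℕ) + 1) * φ x

/-- The `(ε)`-symmetry of a vector field on the closure of `Ω⁰`, for a sign `ε = ±1`: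
`f(R_j x) = ε (-1)^j R_j f(x)` for `j = 1, 2`. -/
def IsSymmVector (d ε : ℝ) (f : E3 → E3) : Prop :=
  ∀ j : Fin 2, ∀ x ∈ closure (slab d),
    f (reflect j.castSucc x) = (ε * (-1) ^ ((j : ℕ) + 1)) • reflect j.castSucc (f x)

/-- `∇ · f = 0` in `Ω⁰` in the sense of distributions. This is the classical condition when `f` is
continuously differentiable in `Ω⁰`, and it also makes sense for fields that are only continuous. -/
def IsDivFree (d : ℝ) (f : E3 → E3) : Prop :=
  ∀ φ : E3 → ℝ, ContDiff ℝ ∞ φ → HasCompactSupport φ → tsupport φ ⊆ slab d →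
    ∫ x in slab d, inner ℝ (f x) (gradient φ x) = 0

/-! ### Function spaces -/

/-- `X^s_ε`: periodic, `(ε)`-symmetric, divergence-free `C^s` vector fields on the closure of
`Ω⁰`. -/
def spaceX (d l₁ l₂ ε s : ℝ) : Set (E3 → E3) :=
  {f | MemHolder s (slab d) f ∧ IsPeriodic d l₁ l₂ f ∧ IsSymmVector d ε f ∧ IsDivFree d f}

/-- `Y^s_ε`: periodic, `(ε)`-symmetric `C^s` scalar fields on the closure of `Ω⁰`. -/
def spaceY (d l₁ l₂ ε s : ℝ) : Set (E3 → ℝ) :=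
  {φ | MemHolder s (slab d) φ ∧ IsPeriodic d l₁ l₂ φ ∧ IsSymmScalar d ε φ}

/-- `U_δ^s`: those `u ∈ X^s_+` that are tangential to the boundary, `u₃ = 0` on `∂Ω⁰`, and satisfy
`u₁ > δ`. -/
def setU (d l₁ l₂ δ s : ℝ) : Set (E3 → E3) :=
  {u | u ∈ spaceX d l₁ l₂ 1 s ∧ (∀ x ∈ frontier (slab d), u x 2 = 0) ∧
    ∀ x ∈ closure (slab d), δ < u x 0}

/-! ### The transport problem -/

/-- `g` solves the transport problem `u · ∇g = f` in `Ω⁰`, `g = 0` on `{x₁ = 0}`. -/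
def Solves (d : ℝ) (u : E3 → E3) (f g : E3 → ℝ) : Prop :=
  (∀ x ∈ slab d, inner ℝ (u x) (gradient g x) = f x) ∧
    ∀ x ∈ closure (slab d), x 0 = 0 → g x = 0

/-- The period difference `G = g(· + l₁ e₁) - g`. -/
def periodDiff (l₁ : ℝ) (g : E3 → ℝ) (x : E3) : ℝ := g (shift l₁ 0 x) - g x

/-- The field `∇φ × ∇ψ` on the closure of `Ω⁰`. At boundary points the gradients are taken within
the closure of `Ω⁰`; they are the continuous extensions of the gradients in `Ω⁰`. -/
def gradCross (d : ℝ) (φ ψ : E3 → ℝ) (x : E3) : E3 :=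
  WithLp.toLp 2 (crossProduct (gradientWithin φ (closure (slab d)) x).ofLp
    (gradientWithin ψ (closure (slab d)) x).ofLp)

end SteadyTransport

end

open SteadyTransport

noncomputable section

namespace SteadyTransport

/-! ### Quantitative Hölder bounds -/

section HolderBound

/-! Since `u₁ > δ`, the equation may be divided by `u₁`: with `v = u / u₁` it reads `v · ∇g = f /
u₁`, and `x₁` is time along the trajectories of `v`. Because `u₃ = 0` on the boundary, the flow of
`v` preserves the open slab (`exists_flow`), and every trajectory crosses `{x₁ = 0}` exactly once.
So `g` is obtained by integrating `f / u₁` from that plane, and it is unique because the difference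
of two solutions is constant along trajectories.

Regularity is the main work. It is proved for the wider class of linear systems `v · ∇w + A w = F`,
`w = w₀` on the plane, because this class is closed under differentiation: formally `W = Dw` solves
a system of the same kind, with values in `E3 →L[ℝ] E` and coefficients that involve `Dv`, `DA`,
`DF`, `Dw₀` and `w`. Grönwall's inequality along two neighbouring trajectories gives the Hölder
bound of order zero (`exists_holderBound_zero`). For higher order, the differentiated system is
solved first, and a second Grönwall argument for the Taylor remainder shows that its solution `W`
really is the derivative of `w` (`IsTransport.norm_taylor_le`, `IsTransport.hasFDerivAt`). Induction
on the order gives `transportRegularity`. All estimates live on half-open scales of balls: a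
trajectory of duration at most `ρ` moves by at most `Bρ`, so bounds on a ball need data only on a
larger ball. Everything is done in the open slab; Hölder continuity then extends the functions and
their derivatives to the closure.

The symmetries come from uniqueness: a translate or signed reflection of `g` solves the same problem
as `g`. The period difference `G` is constant along trajectories and `G ∘ R₁ - G` vanishes on `{x₁ =
0}`, so `G` is even in `x₁`; since `g` is odd in `x₁`, this evenness forces `G` to be periodic.
Hence local bounds on a period cell become global. Although `g` is not periodic, `∇g(x + l₁e₁) =
∇g(x) + ∇G(x)`, so `∇G × ∇g` is periodic. It is divergence free in the weak sense because `∫ ∇G ·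
(∇g × ∇ψ) = 0` for test functions `ψ`; this holds for merely `C¹` functions by cutting off and
mollifying. -/

theorem continuousOn_of_holder {F : Type*} [NormedAddCommGroup F] {α C : ℝ} {U : Set E3} {f : E3 → F}
    (hα : 0 < α)
    (h : ∀ x ∈ U, ∀ y ∈ U, ‖f x - f y‖ ≤ C * ‖x - y‖ ^ α) : ContinuousOn f U := by
  intro x hx
  have h0 : Filter.Tendsto (fun y => C * ‖y - x‖ ^ α) (nhdsWithin x U) (nhds 0) := by
    have : ContinuousAt (fun y : E3 => C * ‖y - x‖ ^ α) x := by
      refine continuousAt_const.mul (ContinuousAt.rpow_const (by fun_prop) (Or.inr hα.le))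
    have h2 := this.tendsto
    simp only [sub_self, norm_zero, Real.zero_rpow hα.ne', mul_zero] at h2
    exact h2.mono_left nhdsWithin_le_nhds
  refine tendsto_iff_norm_sub_tendsto_zero.2 (squeeze_zero' (Filter.Eventually.of_forall
    fun _ => norm_nonneg _) ?_ h0)
  filter_upwards [self_mem_nhdsWithin] with y hy using h y hy x hx

variable {F G H : Type} [NormedAddCommGroup F] [NormedSpace ℝ F] [NormedAddCommGroup G]
  [NormedSpace ℝ G] [NormedAddCommGroup H] [NormedSpace ℝ H]

/-- All derivatives of order at most `n` of `f` are bounded by `C` in `U`, and the derivative of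
order `n` is Hölder continuous in `U` with exponent `α` and constant `C`. -/
structure HolderBound (α : ℝ) (U : Set E3) (n : ℕ) (C : ℝ) (f : E3 → F) : Prop where
  contDiffOn : ContDiffOn ℝ n f U
  bound : ∀ j ≤ n, ∀ x ∈ U, ‖iteratedFDeriv ℝ j f x‖ ≤ C
  holder : ∀ x ∈ U, ∀ y ∈ U,
    ‖iteratedFDeriv ℝ n f x - iteratedFDeriv ℝ n f y‖ ≤ C * ‖x - y‖ ^ α

variable {α C C₁ C₂ : ℝ} {U V : Set E3} {n : ℕ} {f f₁ f₂ : E3 → F} {g : E3 → G}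

theorem HolderBound.norm_le (h : HolderBound α U n C f) {x : E3} (hx : x ∈ U) : ‖f x‖ ≤ C := by
  simpa using h.bound 0 (Nat.zero_le _) x hx

theorem HolderBound.mono (h : HolderBound α U n C₁ f) (hC : C₁ ≤ C₂) (hV : V ⊆ U) :
    HolderBound α V n C₂ f where
  contDiffOn := h.contDiffOn.mono hV
  bound j hj x hx := (h.bound j hj x (hV hx)).trans hC
  holder x hx y hy := (h.holder x (hV hx) y (hV hy)).trans (by gcongr)

theorem HolderBound.congr (h : HolderBound α U n C f₁) (hU : IsOpen U) (hf : EqOn f₁ f₂ U) :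
    HolderBound α U n C f₂ := by
  have key : ∀ j, ∀ x ∈ U, iteratedFDeriv ℝ j f₁ x = iteratedFDeriv ℝ j f₂ x := fun j x hx =>
    (((hf.eventuallyEq_of_mem (hU.mem_nhds hx)).iteratedFDeriv ℝ j).eq_of_nhds)
  refine ⟨h.contDiffOn.congr fun x hx => (hf hx).symm, fun j hj x hx => ?_, fun x hx y hy => ?_⟩
  · rw [← key j x hx]; exact h.bound j hj x hx
  · rw [← key n x hx, ← key n y hy]; exact h.holder x hx y hy

theorem HolderBound.holder_zero (h : HolderBound α U 0 C f) {x y : E3} (hx : x ∈ U) (hy : y ∈ U) :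
    ‖f x - f y‖ ≤ C * ‖x - y‖ ^ α := by
  have := h.holder x hx y hy
  rw [iteratedFDeriv_zero_eq_comp, Function.comp_apply, Function.comp_apply, ← map_sub,
    LinearIsometryEquiv.norm_map] at this
  exact this

theorem HolderBound.of_zero (hα : 0 < α) (hb : ∀ x ∈ U, ‖f x‖ ≤ C)
    (h : ∀ x ∈ U, ∀ y ∈ U, ‖f x - f y‖ ≤ C * ‖x - y‖ ^ α) : HolderBound α U 0 C f := by
  refine ⟨?_, fun j hj x hx => ?_, fun x hx y hy => ?_⟩
  · simpa using continuousOn_of_holder hα h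
  · obtain rfl : j = 0 := by omega
    simpa using hb x hx
  · rw [iteratedFDeriv_zero_eq_comp, Function.comp_apply, Function.comp_apply, ← map_sub,
      LinearIsometryEquiv.norm_map]
    exact h x hx y hy

/-- Currying is an isometry between the derivative of order `n + 1` of `f` and the derivative of
order `n` of `fderiv ℝ f`. Every induction on the order below runs through this equivalence. -/
theorem holderBound_succ_iff (hU : IsOpen U) :
    HolderBound α U (n + 1) C f ↔ (∀ x ∈ U, ‖f x‖ ≤ C) ∧ DifferentiableOn ℝ f U ∧
      HolderBound α U n C (fderiv ℝ f) := by
  have hsub : ∀ x y, ‖iteratedFDeriv ℝ (n + 1) f x - iteratedFDeriv ℝ (n + 1) f y‖ =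
      ‖iteratedFDeriv ℝ n (fderiv ℝ f) x - iteratedFDeriv ℝ n (fderiv ℝ f) y‖ := by
    intro x y
    rw [iteratedFDeriv_succ_eq_comp_right, iteratedFDeriv_succ_eq_comp_right, ← dist_eq_norm,
      ← dist_eq_norm]
    exact LinearIsometryEquiv.dist_map _ _ _
  constructor
  · intro h
    have h1 := (contDiffOn_succ_iff_fderiv_of_isOpen (𝕜 := ℝ) (n := (n : WithTop ℕ∞)) hU).1
      (by exact_mod_cast h.contDiffOn)
    refine ⟨fun x hx => h.norm_le hx, h1.1, h1.2.2, fun j hj x hx => ?_, fun x hx y hy => ?_⟩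
    · rw [norm_iteratedFDeriv_fderiv]
      exact h.bound _ (by omega) x hx
    · rw [← hsub]
      exact h.holder x hx y hy
  · rintro ⟨h0, h1, h2⟩
    refine ⟨?_, fun j hj x hx => ?_, fun x hx y hy => ?_⟩
    · have := (contDiffOn_succ_iff_fderiv_of_isOpen (𝕜 := ℝ) (n := (n : WithTop ℕ∞)) hU).2
        ⟨h1, by simp, h2.contDiffOn⟩
      exact_mod_cast this
    · cases j with
      | zero => simpa using h0 x hx
      | succ i =>
        rw [← norm_iteratedFDeriv_fderiv]
        exact h2.bound i (by omega) x hx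
    · rw [hsub]
      exact h2.holder x hx y hy

theorem rpow_interpolate {a t : ℝ} (hα : 0 < α) (hα1 : α < 1) (ht : 0 ≤ t)
    (ha : a ≤ C * t) (hb : a ≤ 2 * C) (hC : 0 ≤ C) : a ≤ 2 * C * t ^ α := by
  rcases le_total t 1 with h | h
  · have : t ≤ t ^ α := by
      simpa using Real.rpow_le_rpow_of_exponent_ge' ht h hα.le hα1.le
    have h2 : 0 ≤ C * t ^ α := by positivity
    nlinarith
  · have := Real.one_le_rpow h hα.le
    nlinarith

theorem holder_of_fderiv_le (hα : 0 < α) (hα1 : α < 1) (hU : Convex ℝ U)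
    (hd : ∀ x ∈ U, DifferentiableAt ℝ f x) (hb : ∀ x ∈ U, ‖f x‖ ≤ C)
    (hb' : ∀ x ∈ U, ‖fderiv ℝ f x‖ ≤ C) {x y : E3} (hx : x ∈ U) (hy : y ∈ U) :
    ‖f x - f y‖ ≤ 2 * C * ‖x - y‖ ^ α := by
  refine rpow_interpolate hα hα1 (norm_nonneg _)
    (hU.norm_image_sub_le_of_norm_fderiv_le hd hb' hy hx) ?_ ((norm_nonneg _).trans (hb x hx))
  linarith [norm_sub_le (f x) (f y), hb x hx, hb y hy]

/-- On a convex set a bounded function with bounded derivative is Hölder: the mean value inequality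
serves for distances at most 1, the sup bound for larger ones. The factor 2 is the price of the
latter. -/
theorem HolderBound.pred (hα : 0 < α) (hα1 : α < 1) (hU : Convex ℝ U) (hUo : IsOpen U)
    (h : HolderBound α U (n + 1) C f) : HolderBound α U n (2 * C) f := by
  by_cases hne : U = ∅
  · subst hne
    exact ⟨by simp [contDiffOn_empty], by simp, by simp⟩
  obtain ⟨x₀, hx₀⟩ := nonempty_iff_ne_empty.2 hne
  have hC : 0 ≤ C := (norm_nonneg _).trans (h.norm_le hx₀)
  induction n generalizing F with
  | zero =>
    obtain ⟨h0, h1, h2⟩ := (holderBound_succ_iff hUo).1 h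
    exact HolderBound.of_zero hα (fun x hx => (h0 x hx).trans (by linarith)) fun x hx y hy =>
      holder_of_fderiv_le hα hα1 hU (fun x hx => h1.differentiableAt (hUo.mem_nhds hx)) h0
        (fun x hx => h2.norm_le hx) hx hy
  | succ n ih =>
    obtain ⟨h0, h1, h2⟩ := (holderBound_succ_iff hUo).1 h
    exact (holderBound_succ_iff hUo).2 ⟨fun x hx => (h0 x hx).trans (by linarith), h1, ih h2⟩

theorem HolderBound.of_le (hα : 0 < α) (hα1 : α < 1) (hU : Convex ℝ U) (hUo : IsOpen U) {m : ℕ}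
    (hm : m ≤ n) (h : HolderBound α U n C f) : HolderBound α U m (2 ^ (n - m) * C) f := by
  induction n, hm using Nat.le_induction generalizing C with
  | base => simpa using h
  | succ n hmn ih =>
    have := ih (h.pred hα hα1 hU hUo)
    rwa [← mul_assoc, ← pow_succ, ← Nat.sub_add_comm hmn] at this

theorem HolderBound.clm_comp (hUo : IsOpen U) (L : F →L[ℝ] G) {b : ℝ} (hL : ‖L‖ ≤ b)
    (h : HolderBound α U n C f) : HolderBound α U n (b * C) (fun x => L (f x)) := by
  have hb0 : 0 ≤ b := (norm_nonneg _).trans hL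
  refine ⟨L.contDiff.comp_contDiffOn h.contDiffOn, fun j hj x hx => ?_, fun x hx y hy => ?_⟩
  · have hc : ContDiffAt ℝ j f x :=
      (h.contDiffOn.contDiffAt (hUo.mem_nhds hx)).of_le (by exact_mod_cast hj)
    have := L.norm_iteratedFDeriv_comp_left (f := f) hc le_rfl
    refine this.trans (mul_le_mul hL (h.bound j hj x hx) (norm_nonneg _) hb0)
  · have hc : ∀ z ∈ U, iteratedFDeriv ℝ n (fun x => L (f x)) z =
        L.compContinuousMultilinearMap (iteratedFDeriv ℝ n f z) := fun z hz =>
      L.iteratedFDeriv_comp_left (h.contDiffOn.contDiffAt (hUo.mem_nhds hz)) le_rfl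
    rw [hc x hx, hc y hy]
    have : L.compContinuousMultilinearMap (iteratedFDeriv ℝ n f x) -
        L.compContinuousMultilinearMap (iteratedFDeriv ℝ n f y) =
        L.compContinuousMultilinearMap (iteratedFDeriv ℝ n f x - iteratedFDeriv ℝ n f y) := by
      ext m; simp
    rw [this, mul_assoc]
    exact (L.norm_compContinuousMultilinearMap_le _).trans
      (mul_le_mul hL (h.holder x hx y hy) (norm_nonneg _) hb0)

theorem HolderBound.add (hUo : IsOpen U) (h₁ : HolderBound α U n C₁ f₁)
    (h₂ : HolderBound α U n C₂ f₂) : HolderBound α U n (C₁ + C₂) (fun x => f₁ x + f₂ x) := by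
  have key : ∀ j ≤ n, ∀ x ∈ U, iteratedFDeriv ℝ j (fun x => f₁ x + f₂ x) x =
      iteratedFDeriv ℝ j f₁ x + iteratedFDeriv ℝ j f₂ x := fun j hj x hx =>
    iteratedFDeriv_add_apply
      ((h₁.contDiffOn.contDiffAt (hUo.mem_nhds hx)).of_le (by exact_mod_cast hj))
      ((h₂.contDiffOn.contDiffAt (hUo.mem_nhds hx)).of_le (by exact_mod_cast hj))
  refine ⟨h₁.contDiffOn.add h₂.contDiffOn, fun j hj x hx => ?_, fun x hx y hy => ?_⟩
  · rw [key j hj x hx]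
    exact (norm_add_le _ _).trans (add_le_add (h₁.bound j hj x hx) (h₂.bound j hj x hx))
  · rw [key n le_rfl x hx, key n le_rfl y hy, add_sub_add_comm, add_mul]
    exact (norm_add_le _ _).trans (add_le_add (h₁.holder x hx y hy) (h₂.holder x hx y hy))

theorem HolderBound.neg (hUo : IsOpen U) (h : HolderBound α U n C f) :
    HolderBound α U n C (fun x => -f x) := by
  have h1 : ‖(-ContinuousLinearMap.id ℝ F)‖ ≤ 1 := by
    rw [norm_neg]; exact ContinuousLinearMap.norm_id_le
  simpa using h.clm_comp hUo (-ContinuousLinearMap.id ℝ F) h1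

theorem HolderBound.sub (hUo : IsOpen U) (h₁ : HolderBound α U n C₁ f₁)
    (h₂ : HolderBound α U n C₂ f₂) : HolderBound α U n (C₁ + C₂) (fun x => f₁ x - f₂ x) := by
  simpa [sub_eq_add_neg] using h₁.add hUo (h₂.neg hUo)

theorem HolderBound.const_smul (hUo : IsOpen U) (h : HolderBound α U n C f) (c : ℝ) :
    HolderBound α U n (|c| * C) (fun x => c • f x) := by
  have h1 : ‖(c • ContinuousLinearMap.id ℝ F)‖ ≤ |c| := by
    rw [norm_smul, Real.norm_eq_abs]
    exact mul_le_of_le_one_right (abs_nonneg c) ContinuousLinearMap.norm_id_le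
  simpa using h.clm_comp hUo (c • ContinuousLinearMap.id ℝ F) h1

theorem holderBound_const (c : F) : HolderBound α U n ‖c‖ (fun _ => c) := by
  have key : ∀ j, ∀ x : E3, ‖iteratedFDeriv ℝ j (fun _ : E3 => c) x‖ ≤ ‖c‖ := by
    intro j x
    rcases Nat.eq_zero_or_pos j with rfl | hj
    · simp
    · rw [iteratedFDeriv_const_of_ne hj.ne']; simp
  refine ⟨contDiffOn_const, fun j _ x _ => key j x, fun x hx y hy => ?_⟩
  rcases Nat.eq_zero_or_pos n with rfl | hj
  · rw [iteratedFDeriv_zero_eq_comp]; simp; positivity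
  · rw [iteratedFDeriv_const_of_ne hj.ne']; simp; positivity

/-- Leibniz rule. Each derivative produces two terms, and in each of them the undifferentiated
factor is lowered by one order at the cost of a factor 2; this is the 4 per order. The initial 2
comes from the two terms in the Hölder difference of a product. -/
theorem HolderBound.bilin (hα : 0 < α) (hα1 : α < 1) (hU : Convex ℝ U) (hUo : IsOpen U)
    (B : F →L[ℝ] G →L[ℝ] H) {b : ℝ} (hB : ‖B‖ ≤ b) (hf : HolderBound α U n C₁ f)
    (hg : HolderBound α U n C₂ g) (hC₁ : 0 ≤ C₁) (hC₂ : 0 ≤ C₂) :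
    HolderBound α U n (2 * 4 ^ n * b * C₁ * C₂) (fun x => B (f x) (g x)) := by
  have hb0 : 0 ≤ b := (norm_nonneg B).trans hB
  have hle : ∀ x ∈ U, ‖f x‖ ≤ C₁ → ‖g x‖ ≤ C₂ → ‖B (f x) (g x)‖ ≤ b * C₁ * C₂ := by
    intro x _ h1 h2
    refine (B.le_opNorm₂ _ _).trans ?_
    gcongr
  induction n generalizing F G H b C₁ C₂ with
  | zero =>
    have hp : 0 ≤ b * C₁ * C₂ := by positivity
    refine HolderBound.of_zero hα (fun x hx => (hle x hx (hf.norm_le hx) (hg.norm_le hx)).trans ?_)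
      fun x hx y hy => ?_
    · linarith
    · have e : B (f x) (g x) - B (f y) (g y) = B (f x) (g x - g y) + B (f x - f y) (g y) := by
        simp
      have h1 : ‖B (f x) (g x - g y)‖ ≤ b * C₁ * (C₂ * ‖x - y‖ ^ α) := by
        refine (B.le_opNorm₂ _ _).trans ?_
        gcongr
        · exact hf.norm_le hx
        · exact hg.holder_zero hx hy
      have h2 : ‖B (f x - f y) (g y)‖ ≤ b * (C₁ * ‖x - y‖ ^ α) * C₂ := by
        refine (B.le_opNorm₂ _ _).trans ?_
        gcongr
        · exact hf.holder_zero hx hy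
        · exact hg.norm_le hy
      rw [e]
      refine (norm_add_le _ _).trans ?_
      nlinarith
  | succ n ih =>
    obtain ⟨f0, f1, f2⟩ := (holderBound_succ_iff hUo).1 hf
    obtain ⟨g0, g1, g2⟩ := (holderBound_succ_iff hUo).1 hg
    have hd : ∀ x ∈ U, HasFDerivAt (fun x => B (f x) (g x))
        (B.precompR E3 (f x) (fderiv ℝ g x) + B.precompL E3 (fderiv ℝ f x) (g x)) x := fun x hx =>
      B.hasFDerivAt_of_bilinear (f1.differentiableAt (hUo.mem_nhds hx)).hasFDerivAt
        (g1.differentiableAt (hUo.mem_nhds hx)).hasFDerivAt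
    have hp : 0 ≤ b * C₁ * C₂ := by positivity
    refine (holderBound_succ_iff hUo).2 ⟨fun x hx => (hle x hx (f0 x hx) (g0 x hx)).trans ?_,
      fun x hx => (hd x hx).differentiableAt.differentiableWithinAt, ?_⟩
    · have : (1 : ℝ) ≤ 4 ^ (n + 1) := one_le_pow₀ (by norm_num)
      nlinarith
    · have i1 := ih (B.precompR E3) ((B.norm_precompR_le E3).trans hB) (hf.pred hα hα1 hU hUo) g2
        (by linarith) hC₂ hb0 (fun x hx h1 h2 => by
          refine ((B.precompR E3).le_opNorm₂ _ _).trans ?_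
          have := (B.norm_precompR_le E3).trans hB
          gcongr)
      have i2 := ih (B.precompL E3) ((B.norm_precompL_le E3).trans hB) f2 (hg.pred hα hα1 hU hUo)
        hC₁ (by linarith) hb0 (fun x hx h1 h2 => by
          refine ((B.precompL E3).le_opNorm₂ _ _).trans ?_
          have := (B.norm_precompL_le E3).trans hB
          gcongr)
      refine ((i1.add hUo i2).mono (le_of_eq ?_) subset_rfl).congr hUo
        fun x hx => ((hd x hx).fderiv).symm
      ring

end HolderBound

/-! ### Ordinary differential equations -/

section ODE

variable {E : Type*} [NormedAddCommGroup E] [NormedSpace ℝ E]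

/-- A weaker closed form that covers `K = 0` and `K > 0` at once and is linear in `δ` and `ε`. It
rests on `e^y - 1 ≤ y e^y`. -/
theorem gronwallBound_le {δ K ε x : ℝ} (hK : 0 ≤ K) (hε : 0 ≤ ε) :
    gronwallBound δ K ε x ≤ (δ + ε * x) * Real.exp (K * x) := by
  rcases hK.eq_or_lt with rfl | hK
  · simp [gronwallBound_K0]
  · rw [gronwallBound_of_K_ne_0 hK.ne', add_mul]
    have h1 : 1 - K * x ≤ Real.exp (-(K * x)) := by linarith [Real.add_one_le_exp (-(K * x))]
    have h2 : Real.exp (K * x) * Real.exp (-(K * x)) = 1 := by rw [← Real.exp_add]; simp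
    have h3 : Real.exp (K * x) - 1 ≤ K * x * Real.exp (K * x) := by
      nlinarith [Real.exp_pos (K * x)]
    have h4 : ε / K * (Real.exp (K * x) - 1) ≤ ε / K * (K * x * Real.exp (K * x)) := by gcongr
    have h5 : ε / K * (K * x * Real.exp (K * x)) = ε * x * Real.exp (K * x) := by field_simp
    linarith

/-- Grönwall's inequality between two times `a` and `b` in either order. -/
theorem norm_le_of_norm_deriv_le {y y' : ℝ → E} {a b K ε : ℝ} (hK : 0 ≤ K) (hε : 0 ≤ ε)
    (hy : ∀ t ∈ uIcc a b, HasDerivAt y (y' t) t)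
    (hb : ∀ t ∈ uIcc a b, ‖y' t‖ ≤ K * ‖y t‖ + ε) :
    ‖y b‖ ≤ (‖y a‖ + ε * |b - a|) * Real.exp (K * |b - a|) := by
  have key : ∀ {z z' : ℝ → E} {a b : ℝ}, a ≤ b → (∀ t ∈ Icc a b, HasDerivAt z (z' t) t) →
      (∀ t ∈ Icc a b, ‖z' t‖ ≤ K * ‖z t‖ + ε) →
      ‖z b‖ ≤ (‖z a‖ + ε * |b - a|) * Real.exp (K * |b - a|) := by
    intro z z' a b hab hz hz'
    rw [abs_of_nonneg (sub_nonneg.2 hab)]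
    refine (norm_le_gronwallBound_of_norm_deriv_right_le
      (fun t ht => (hz t ht).continuousAt.continuousWithinAt)
      (fun t ht => (hz t (Ico_subset_Icc_self ht)).hasDerivWithinAt) le_rfl
      (fun t ht => hz' t (Ico_subset_Icc_self ht)) b ⟨hab, le_rfl⟩).trans ?_
    exact gronwallBound_le hK hε
  rcases le_total a b with hab | hab
  · rw [uIcc_of_le hab] at hy hb
    exact key hab hy hb
  · rw [uIcc_of_ge hab] at hy hb
    -- Reversing time reduces the case `b ≤ a` to the forward inequality.
    have := key (z := fun t => y (-t)) (z' := fun t => -y' (-t)) (neg_le_neg hab)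
      (fun t ht => by
        have h := (hy (-t) ⟨by linarith [ht.2], by linarith [ht.1]⟩).scomp t (hasDerivAt_neg t)
        simpa [Function.comp_def] using h)
      (fun t ht => by
        simpa using hb (-t) ⟨by linarith [ht.2], by linarith [ht.1]⟩)
    simp only [neg_neg] at this
    rwa [show |-b - -a| = |b - a| by rw [← abs_neg]; ring_nf] at this

/-- The radial retraction of a normed space to the closed ball of radius `B`. -/
def radialRetract (B : ℝ) (x : E) : E := (B / max B ‖x‖) • x

theorem radialRetract_of_le {B : ℝ} (hB : 0 < B) {x : E} (hx : ‖x‖ ≤ B) :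
    radialRetract B x = x := by
  rw [radialRetract, max_eq_left hx, div_self hB.ne', one_smul]

theorem norm_radialRetract_le {B : ℝ} (hB : 0 < B) (x : E) : ‖radialRetract B x‖ ≤ B := by
  have h1 : 0 < max B ‖x‖ := lt_max_of_lt_left hB
  rw [radialRetract, norm_smul, Real.norm_of_nonneg (by positivity), div_mul_eq_mul_div,
    div_le_iff₀ h1]
  gcongr
  exact le_max_right _ _

theorem norm_radialRetract_le_norm {B : ℝ} (hB : 0 < B) (x : E) : ‖radialRetract B x‖ ≤ ‖x‖ := by
  have h1 : 0 < max B ‖x‖ := lt_max_of_lt_left hB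
  rw [radialRetract, norm_smul, Real.norm_of_nonneg (by positivity)]
  exact mul_le_of_le_one_left (norm_nonneg _) ((div_le_one h1).2 (le_max_left _ _))

theorem lipschitzWith_radialRetract {B : ℝ} (hB : 0 < B) :
    LipschitzWith 2 (radialRetract B : E → E) := by
  refine LipschitzWith.of_dist_le_mul fun x y => ?_
  rw [dist_eq_norm, dist_eq_norm]
  have hx : 0 < max B ‖x‖ := lt_max_of_lt_left hB
  have hy : 0 < max B ‖y‖ := lt_max_of_lt_left hB
  have e : radialRetract B x - radialRetract B y =
      (B / max B ‖y‖) • (x - y) + (B / max B ‖x‖ - B / max B ‖y‖) • x := by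
    simp only [radialRetract, smul_sub, sub_smul]; abel
  have h1 : ‖(B / max B ‖y‖) • (x - y)‖ ≤ ‖x - y‖ := by
    rw [norm_smul, Real.norm_of_nonneg (by positivity)]
    exact mul_le_of_le_one_left (norm_nonneg _) ((div_le_one hy).2 (le_max_left _ _))
  have h2 : ‖(B / max B ‖x‖ - B / max B ‖y‖) • x‖ ≤ ‖x - y‖ := by
    rw [norm_smul, div_sub_div _ _ hx.ne' hy.ne', Real.norm_eq_abs, abs_div,
      abs_of_pos (mul_pos hx hy)]
    have h3 : |B * max B ‖y‖ - max B ‖x‖ * B| ≤ B * ‖x - y‖ := by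
      rw [mul_comm (max B ‖x‖), ← mul_sub, abs_mul, abs_of_pos hB]
      gcongr
      have := abs_max_sub_max_le_max B ‖y‖ B ‖x‖
      simp only [sub_self, abs_zero] at this
      refine this.trans (max_le (norm_nonneg _) ?_)
      rw [abs_sub_comm]
      exact abs_norm_sub_norm_le x y
    rw [div_mul_eq_mul_div, div_le_iff₀ (mul_pos hx hy)]
    have h4 : B * ‖x‖ ≤ max B ‖x‖ * max B ‖y‖ := by
      rw [mul_comm]
      exact mul_le_mul (le_max_right _ _) (le_max_left _ _) hB.le hx.le
    calc _ ≤ B * ‖x - y‖ * ‖x‖ := by gcongr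
      _ = ‖x - y‖ * (B * ‖x‖) := by ring
      _ ≤ _ := by gcongr
  rw [e]
  refine (norm_add_le _ _).trans ?_
  rw [NNReal.coe_ofNat]
  linarith

/-- Composing the right-hand side with the radial retraction makes it bounded, so that
Picard–Lindelöf applies on all of `[-T, T]` at once. Grönwall then shows that the solution never
leaves the ball where the retraction is the identity. -/
theorem exists_hasDerivAt_of_lipschitz_of_lt [CompleteSpace E] {f : ℝ → E → E} {T : ℝ}
    (hT : 0 < T) {K : ℝ≥0}
    (hf : ∀ t ∈ Icc (-T) T, LipschitzWith K (f t)) (hc : ∀ x, Continuous fun t => f t x) (x₀ : E) :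
    ∃ y : ℝ → E, y 0 = x₀ ∧ ∀ t ∈ Ioo (-T) T, HasDerivAt y (f t (y t)) t := by
  obtain ⟨L₀, hL₀⟩ := isCompact_Icc.exists_bound_of_continuousOn (s := Icc (-T) T)
    (hc 0).continuousOn
  have hL0 : 0 ≤ L₀ := (norm_nonneg _).trans (hL₀ 0 ⟨by linarith, hT.le⟩)
  -- The a priori Grönwall bound for solutions of linear growth; the summand 1 only keeps the radius
  -- positive.
  set B : ℝ := (‖x₀‖ + L₀ * T) * Real.exp (K * T) + 1 with hB
  have hBpos : 0 < B := by positivity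
  have hnorm : ∀ t ∈ Icc (-T) T, ∀ x, ‖f t x‖ ≤ K * ‖x‖ + L₀ := by
    intro t ht x
    have h1 := (hf t ht).dist_le_mul x 0
    rw [dist_eq_norm, dist_eq_norm, sub_zero] at h1
    calc ‖f t x‖ = ‖(f t x - f t 0) + f t 0‖ := by simp
      _ ≤ _ := (norm_add_le _ _).trans (add_le_add h1 (hL₀ t ht))
  let L : ℝ≥0 := ⟨K * B + L₀, by positivity⟩
  let a : ℝ≥0 := ⟨(K * B + L₀) * T, by positivity⟩
  have hPL : IsPicardLindelof (fun t x => f t (radialRetract B x)) (tmin := -T) (tmax := T)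
      ⟨0, by linarith, hT.le⟩ x₀ a 0 L (K * 2) := by
    refine ⟨fun t ht => ((hf t ht).comp (lipschitzWith_radialRetract hBpos)).lipschitzOnWith,
      fun x _ => (hc _).continuousOn, fun t ht x _ => ?_, ?_⟩
    · refine (hnorm t ht _).trans ?_
      change _ ≤ K * B + L₀
      have := norm_radialRetract_le hBpos x
      gcongr
    · simp only [a, L, sub_zero, zero_sub, neg_neg, max_self, NNReal.coe_zero]
      exact le_rfl
  obtain ⟨y, hy0, hy⟩ := hPL.exists_eq_forall_mem_Icc_hasDerivWithinAt₀
  have hy' : ∀ t ∈ Ioo (-T) T, HasDerivAt y (f t (radialRetract B (y t))) t := fun t ht =>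
    (hy t (Ioo_subset_Icc_self ht)).hasDerivAt (Icc_mem_nhds ht.1 ht.2)
  refine ⟨y, hy0, fun t ht => ?_⟩
  have hsub : uIcc 0 t ⊆ Ioo (-T) T :=
    Set.OrdConnected.uIcc_subset ordConnected_Ioo ⟨by linarith, hT⟩ ht
  have hle := norm_le_of_norm_deriv_le (y := y) (a := 0) (b := t) K.coe_nonneg hL0
    (fun s hs => hy' s (hsub hs)) (fun s hs =>
      (hnorm s (Ioo_subset_Icc_self (hsub hs)) _).trans (by
        have := norm_radialRetract_le_norm hBpos (y s)
        have := K.coe_nonneg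
        gcongr))
  have habs : |t - 0| ≤ T := by rw [sub_zero, abs_le]; exact ⟨ht.1.le, ht.2.le⟩
  have hyB : ‖y t‖ ≤ B := by
    rw [hy0] at hle
    refine hle.trans (le_trans ?_ (le_of_lt (lt_add_one _)))
    have := K.coe_nonneg
    gcongr
  have := hy' t ht
  rwa [radialRetract_of_le hBpos hyB] at this

/-- Global existence for ordinary differential equations with a Lipschitz right-hand side. -/
theorem exists_hasDerivAt_of_lipschitz [CompleteSpace E] {f : ℝ → E → E}
    (hf : ∀ T : ℝ, ∃ K : ℝ≥0, ∀ t ∈ Icc (-T) T, LipschitzWith K (f t))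
    (hc : ∀ x, Continuous fun t => f t x) (x₀ : E) :
    ∃ y : ℝ → E, y 0 = x₀ ∧ ∀ t, HasDerivAt y (f t (y t)) t := by
  have h1 : ∀ n : ℕ, ∃ y : ℝ → E, y 0 = x₀ ∧
      ∀ t ∈ Ioo (-(n + 1 : ℝ)) (n + 1), HasDerivAt y (f t (y t)) t := fun n => by
    obtain ⟨K, hK⟩ := hf (n + 1)
    exact exists_hasDerivAt_of_lipschitz_of_lt (by positivity) hK hc x₀
  choose Y hY0 hY using h1
  have huniq : ∀ m n : ℕ, m ≤ n → EqOn (Y m) (Y n) (Ioo (-(m + 1 : ℝ)) (m + 1)) := by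
    intro m n hmn
    obtain ⟨K, hK⟩ := hf (m + 1)
    have hmn' : (m : ℝ) ≤ n := by exact_mod_cast hmn
    refine ODE_solution_unique_of_mem_Ioo (v := f) (s := fun _ => univ) (K := K) (t₀ := 0)
      (fun t ht => (hK t (Ioo_subset_Icc_self ht)).lipschitzOnWith) ⟨by linarith, by positivity⟩
      (fun t ht => ⟨hY m t ht, mem_univ _⟩)
      (fun t ht => ⟨hY n t ⟨by linarith [ht.1], by linarith [ht.2]⟩, mem_univ _⟩) ?_
    rw [hY0, hY0]
  -- The solution of index `n` lives on `(-(n+1), n+1)`, so the index `⌈|t|⌉₊` is admissible at `t`.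
  -- The index changes with `t`; one index larger by 1 gives a single solution that agrees with the
  -- glued function near `t`.
  refine ⟨fun t => Y ⌈|t|⌉₊ t, by simp [hY0], fun t => ?_⟩
  set N : ℕ := ⌈|t|⌉₊ + 1 with hN
  have ht : |t| ≤ ⌈|t|⌉₊ := Nat.le_ceil _
  have hmem : t ∈ Ioo (-(N : ℝ)) N := by
    rw [hN]; push_cast
    rw [mem_Ioo, ← abs_lt]; linarith
  have hev : ∀ s ∈ Ioo (-(N : ℝ)) N, Y ⌈|s|⌉₊ s = Y N s := by
    intro s hs
    have h2 : |s| < N := abs_lt.2 hs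
    refine huniq _ _ (Nat.ceil_le.2 h2.le) ?_
    rw [mem_Ioo, ← abs_lt]
    linarith [Nat.le_ceil |s|]
  have hD := hY N t ⟨by linarith [hmem.1], by linarith [hmem.2]⟩
  rw [← hev t hmem] at hD
  exact hD.congr_of_eventuallyEq
    (Filter.eventually_of_mem (Ioo_mem_nhds hmem.1 hmem.2) hev)

end ODE

/-! ### The slab -/

section Slab

variable {d : ℝ}

/-- The `i`th coordinate as a continuous linear functional. -/
def coordProj (i : Fin 3) : E3 →L[ℝ] ℝ := EuclideanSpace.proj i

@[simp] theorem coordProj_apply (i : Fin 3) (x : E3) : coordProj i x = x i := rfl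

theorem slab_eq_preimage (d : ℝ) :
    slab d = (coordProj 2) ⁻¹' Ioo (-d) 0 := rfl

theorem isOpenMap_proj : IsOpenMap (coordProj 2) :=
  ContinuousLinearMap.isOpenMap _ fun a => ⟨EuclideanSpace.single 2 a, by simp⟩

theorem isOpen_slab (d : ℝ) : IsOpen (slab d) :=
  isOpen_Ioo.preimage (coordProj 2).continuous

theorem convex_slab (d : ℝ) : Convex ℝ (slab d) :=
  (convex_Ioo (-d) 0).linear_preimage
    (coordProj 2).toLinearMap

theorem closure_slab (hd : 0 < d) : closure (slab d) = {x | -d ≤ x 2 ∧ x 2 ≤ 0} := by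
  rw [slab_eq_preimage, ← isOpenMap_proj.preimage_closure_eq_closure_preimage
    (coordProj 2).continuous,
    closure_Ioo (by linarith)]
  rfl

theorem frontier_slab (hd : 0 < d) : frontier (slab d) = {x | x 2 = -d ∨ x 2 = 0} := by
  rw [slab_eq_preimage, ← isOpenMap_proj.preimage_frontier_eq_frontier_preimage
    (coordProj 2).continuous,
    frontier_Ioo (by linarith)]
  rfl

theorem isOpen_slabBall (d r : ℝ) : IsOpen (slabBall d r) := (isOpen_slab d).inter isOpen_ball

theorem convex_slabBall (d r : ℝ) : Convex ℝ (slabBall d r) :=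
  (convex_slab d).inter (convex_ball _ _)

theorem slabBall_subset_slab (d r : ℝ) : slabBall d r ⊆ slab d := inter_subset_left

theorem slabBall_mono (d : ℝ) {r R : ℝ} (h : r ≤ R) : slabBall d r ⊆ slabBall d R :=
  inter_subset_inter_right _ (ball_subset_ball h)

theorem mem_slabBall {r : ℝ} {x : E3} : x ∈ slabBall d r ↔ x ∈ slab d ∧ ‖x‖ < r := by
  rw [slabBall, mem_inter_iff, mem_ball_zero_iff]

theorem abs_apply_le (x : E3) (i : Fin 3) : |x i| ≤ ‖x‖ := by
  simpa using PiLp.norm_apply_le x i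

/-- The point `x` with its third coordinate replaced by `c`. -/
def setHeight (c : ℝ) (x : E3) : E3 := WithLp.toLp 2 (fun i => if i = 2 then c else x i)

theorem norm_setHeight_sub (c c' : ℝ) (x y : E3) :
    ‖setHeight c x - setHeight c' y‖ ^ 2 = (x 0 - y 0) ^ 2 + (x 1 - y 1) ^ 2 + (c - c') ^ 2 := by
  rw [EuclideanSpace.real_norm_sq_eq, Fin.sum_univ_three]
  simp [setHeight]

theorem norm_setHeight_sub_self (c c' : ℝ) (x : E3) :
    ‖setHeight c x - setHeight c' x‖ = |c - c'| := by
  rw [← abs_of_nonneg (norm_nonneg (setHeight c x - setHeight c' x)), ← sq_eq_sq_iff_abs_eq_abs,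
    norm_setHeight_sub]
  ring

theorem setHeight_self (x : E3) : setHeight (x 2) x = x := by
  ext i
  by_cases h : i = 2
  · subst h; simp [setHeight]
  · simp [setHeight, h]

/-- The projection of space to the closure of the slab. -/
def clamp (d : ℝ) (x : E3) : E3 := setHeight (max (-d) (min 0 (x 2))) x

theorem clamp_height (d : ℝ) (x : E3) : clamp d x 2 = max (-d) (min 0 (x 2)) := by
  simp [clamp, setHeight]

theorem abs_clamp_sub_le (d a b : ℝ) :
    |max (-d) (min 0 a) - max (-d) (min 0 b)| ≤ |a - b| := by
  have h1 := abs_max_sub_max_le_max (-d) (min 0 a) (-d) (min 0 b)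
  have h2 := abs_min_sub_min_le_max 0 a 0 b
  simp only [sub_self, abs_zero] at h1 h2
  refine h1.trans (max_le (abs_nonneg _) (h2.trans (max_le (abs_nonneg _) le_rfl)))

theorem lipschitzWith_clamp (d : ℝ) : LipschitzWith 1 (clamp d) := by
  refine LipschitzWith.of_dist_le_mul fun x y => ?_
  rw [dist_eq_norm, dist_eq_norm, NNReal.coe_one, one_mul]
  refine abs_le_of_sq_le_sq' ?_ (norm_nonneg _) |>.2
  nth_rw 2 [← setHeight_self x, ← setHeight_self y]
  rw [clamp, clamp, norm_setHeight_sub, norm_setHeight_sub]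
  have := sq_le_sq.2 (abs_clamp_sub_le d (x 2) (y 2))
  linarith

theorem clamp_mem (hd : 0 < d) (x : E3) : clamp d x ∈ closure (slab d) := by
  rw [closure_slab hd, mem_ofPred, clamp_height]
  exact ⟨le_max_left _ _, max_le (by linarith) (min_le_left _ _)⟩

theorem clamp_of_mem (hd : 0 < d) {x : E3} (hx : x ∈ closure (slab d)) : clamp d x = x := by
  rw [closure_slab hd] at hx
  rw [clamp, min_eq_right hx.2, max_eq_right hx.1, setHeight_self]

end Slab

/-! ### The flow of a vector field -/

/-- `φ` is the flow of `v` in `Ω`. -/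
structure IsFlow (Ω : Set E3) (v : E3 → E3) (φ : ℝ → E3 → E3) : Prop where
  zero : ∀ x ∈ Ω, φ 0 x = x
  mem : ∀ x ∈ Ω, ∀ t, φ t x ∈ Ω
  deriv : ∀ x ∈ Ω, ∀ t, HasDerivAt (fun t => φ t x) (v (φ t x)) t
  add : ∀ x ∈ Ω, ∀ s t, φ s (φ t x) = φ (s + t) x

theorem HasDerivAt.euclidean_apply {z : ℝ → E3} {z' : E3} {t : ℝ} (h : HasDerivAt z z' t)
    (i : Fin 3) : HasDerivAt (fun t => z t i) (z' i) t :=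
  ((coordProj i).hasFDerivAt.comp_hasDerivAt t h)

/-- Composition with `clamp d` extends the field to a Lipschitz field on the whole space, which has
global trajectories. Those that start in the slab cannot reach its boundary in finite time, so the
extension is never seen. The group law is uniqueness for the extended field. -/
theorem exists_flow {d : ℝ} (hd : 0 < d) {v : E3 → E3} {K : ℝ≥0}
    (hv : LipschitzOnWith K v (closure (slab d))) (hv0 : ∀ x ∈ frontier (slab d), v x 2 = 0) :
    ∃ φ, IsFlow (slab d) v φ := by
  have hlip : LipschitzWith K (v ∘ clamp d) := by
    rw [← lipschitzOnWith_univ, ← mul_one K]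
    exact hv.comp ((lipschitzWith_clamp d).lipschitzOnWith) fun x _ => clamp_mem hd x
  have hex := fun x₀ => exists_hasDerivAt_of_lipschitz (f := fun _ => v ∘ clamp d)
    (fun T => ⟨K, fun _ _ => hlip⟩) (fun x => continuous_const) x₀
  choose Y hY0 hY using hex
  -- The vertical velocity vanishes at the point straight above or below at height `c`, hence it is
  -- at most `K` times the distance to that height. Grönwall, run from a hitting time back to time
  -- 0, would place the starting point at height `c` as well.
  have hne : ∀ c, (c = -d ∨ c = 0) → ∀ x : E3, x 2 ≠ c → ∀ t, Y x t 2 ≠ c := by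
    intro c hc x hx t ht
    have hfix : max (-d) (min 0 c) = c := by
      rcases hc with rfl | rfl
      · rw [min_eq_right (by linarith), max_self]
      · rw [min_self, max_eq_right (by linarith)]
    have hbound : ∀ s, |(v ∘ clamp d) (Y x s) 2| ≤ K * |Y x s 2 - c| := by
      intro s
      set q : E3 := setHeight c (Y x s)
      have hq2 : q 2 = c := by simp [q, setHeight]
      have hq : v q 2 = 0 := hv0 q (by rw [frontier_slab hd, mem_ofPred, hq2]; exact hc)
      have hqmem : q ∈ closure (slab d) := by
        rw [closure_slab hd, mem_ofPred, hq2]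
        rcases hc with rfl | rfl <;> constructor <;> linarith
      have h1 : ‖v (clamp d (Y x s)) - v q‖ ≤ K * ‖clamp d (Y x s) - q‖ := by
        rw [← dist_eq_norm, ← dist_eq_norm]
        exact hv.dist_le_mul _ (clamp_mem hd _) _ hqmem
      have h2 := abs_apply_le (v (clamp d (Y x s)) - v q) 2
      rw [PiLp.sub_apply, hq, sub_zero] at h2
      refine h2.trans (h1.trans ?_)
      rw [clamp, norm_setHeight_sub_self]
      have := abs_clamp_sub_le d (Y x s 2) c
      rw [hfix] at this
      gcongr
    have h := norm_le_of_norm_deriv_le (y := fun s => Y x s 2 - c)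
      (y' := fun s => (v ∘ clamp d) (Y x s) 2) (a := t) (b := 0) (ε := 0) K.coe_nonneg le_rfl
      (fun s _ => (HasDerivAt.euclidean_apply (hY x s) 2).sub_const c)
      (fun s _ => by simpa using hbound s)
    simp only [ht, sub_self, norm_zero, zero_mul, add_zero, hY0, norm_le_zero_iff] at h
    exact hx (sub_eq_zero.1 h)
  have hcont : ∀ x, Continuous fun t => Y x t 2 := fun x =>
    continuous_iff_continuousAt.2 fun t => (HasDerivAt.euclidean_apply (hY x t) 2).continuousAt
  have hmem : ∀ x ∈ slab d, ∀ t, Y x t ∈ slab d := by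
    intro x hx t
    constructor
    · by_contra! hlt
      obtain ⟨s, -, hs⟩ := intermediate_value_uIcc (a := t) (b := 0) (hcont x).continuousOn
        (show -d ∈ _ from mem_uIcc.2 (Or.inl ⟨hlt, by rw [hY0]; exact hx.1.le⟩))
      exact hne (-d) (Or.inl rfl) x hx.1.ne' s hs
    · by_contra! hlt
      obtain ⟨s, -, hs⟩ := intermediate_value_uIcc (a := 0) (b := t) (hcont x).continuousOn
        (show (0 : ℝ) ∈ _ from mem_uIcc.2 (Or.inl ⟨by rw [hY0]; exact hx.2.le, hlt⟩))
      exact hne 0 (Or.inr rfl) x hx.2.ne s hs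
  have hder : ∀ x ∈ slab d, ∀ t, HasDerivAt (Y x) (v (Y x t)) t := fun x hx t => by
    have := hY x t
    rwa [Function.comp_apply, clamp_of_mem hd (subset_closure (hmem x hx t))] at this
  refine ⟨fun t x => Y x t, fun x _ => hY0 x, hmem, hder, fun x hx s t => ?_⟩
  have := ODE_solution_unique_univ (v := fun _ => v ∘ clamp d) (s := fun _ => univ) (K := K)
    (t₀ := 0) (f := Y (Y x t)) (g := fun s => Y x (s + t)) (fun _ => hlip.lipschitzOnWith)
    (fun s => ⟨hY _ s, mem_univ _⟩) (fun s => ⟨(hY x (s + t)).comp_add_const s t, mem_univ _⟩)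
    (by simp [hY0])
  exact congrFun this s

/-! ### Linear transport systems -/

/-- Grönwall with `K = 0` for the difference between `y` and an affine function of slope `m`: a mean
value estimate that does not depend on the order of the endpoints. -/
theorem norm_sub_smul_le_of_deriv {E : Type*} [NormedAddCommGroup E] [NormedSpace ℝ E]
    {y y' : ℝ → E} {a b ε : ℝ} {m : E}
    (hy : ∀ t ∈ uIcc a b, HasDerivAt y (y' t) t) (hb : ∀ t ∈ uIcc a b, ‖y' t - m‖ ≤ ε) :
    ‖y b - y a - (b - a) • m‖ ≤ ε * |b - a| := by
  have hε : 0 ≤ ε := (norm_nonneg _).trans (hb a left_mem_uIcc)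
  have := norm_le_of_norm_deriv_le (y := fun t => y t - y a - (t - a) • m)
    (y' := fun t => y' t - m) (a := a) (b := b) (K := 0) le_rfl hε
    (fun t ht => by
      have := ((hasDerivAt_id t).sub_const a).smul_const m
      rw [one_smul] at this
      exact ((hy t ht).sub_const (y a)).sub this) (fun t ht => by simpa using hb t ht)
  simpa using this

/-- `v` is bounded and Lipschitz continuous in `Ω` with constant `B`, and its first component
is `1`. -/
structure IsUnitSpeed (Ω : Set E3) (B : ℝ) (v : E3 → E3) : Prop where
  nonneg : 0 ≤ B
  norm_le : ∀ x ∈ Ω, ‖v x‖ ≤ B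
  lipschitz : ∀ x ∈ Ω, ∀ y ∈ Ω, ‖v x - v y‖ ≤ B * ‖x - y‖
  apply_zero : ∀ x ∈ Ω, v x 0 = 1

section Flow

variable {Ω : Set E3} {B d : ℝ} {v : E3 → E3} {φ : ℝ → E3 → E3}

theorem IsFlow.apply_zero (hφ : IsFlow Ω v φ) (hv : IsUnitSpeed Ω B v) {x : E3} (hx : x ∈ Ω)
    (t : ℝ) : φ t x 0 = x 0 + t := by
  have := norm_sub_smul_le_of_deriv (a := 0) (b := t) (m := (1 : ℝ)) (ε := 0)
    (fun s _ => HasDerivAt.euclidean_apply (hφ.deriv x hx s) 0)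
    (fun s _ => by rw [hv.apply_zero _ (hφ.mem x hx s)]; simp)
  rw [hφ.zero x hx] at this
  simp only [sub_zero, smul_eq_mul, mul_one, zero_mul, norm_le_zero_iff] at this
  linarith

theorem IsFlow.norm_sub_le (hφ : IsFlow Ω v φ) (hv : IsUnitSpeed Ω B v) {x : E3} (hx : x ∈ Ω)
    (t : ℝ) : ‖φ t x - x‖ ≤ B * |t| := by
  have := norm_sub_smul_le_of_deriv (a := 0) (b := t) (m := (0 : E3)) (ε := B)
    (fun s _ => hφ.deriv x hx s)
    (fun s _ => by simpa using hv.norm_le _ (hφ.mem x hx s))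
  rw [hφ.zero x hx] at this
  simpa using this

theorem IsFlow.norm_sub_flow_le (hφ : IsFlow Ω v φ) (hv : IsUnitSpeed Ω B v) {x y : E3}
    (hx : x ∈ Ω) (hy : y ∈ Ω) (t : ℝ) :
    ‖φ t x - φ t y‖ ≤ Real.exp (B * |t|) * ‖x - y‖ := by
  have := norm_le_of_norm_deriv_le (a := 0) (b := t) (ε := 0) hv.nonneg le_rfl
    (fun s _ => (hφ.deriv x hx s).sub (hφ.deriv y hy s))
    (fun s _ => by simpa using hv.lipschitz _ (hφ.mem x hx s) _ (hφ.mem y hy s))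
  simp only [Pi.sub_apply, hφ.zero x hx, hφ.zero y hy, sub_zero, zero_mul, add_zero] at this
  rwa [mul_comm]

/-- A point of norm less than `ρ` is within time `ρ` of the plane `{x₁ = 0}`, and on the way its
trajectory stays in the ball enlarged by `1 + B`. All later enlargements of radii come from here. -/
theorem IsFlow.mem_slabBall (hφ : IsFlow (slab d) v φ) (hv : IsUnitSpeed (slab d) B v) {ρ : ℝ}
    {x : E3} (hx : x ∈ slabBall d ρ) {t : ℝ} (ht : |t| ≤ ρ) :
    φ t x ∈ slabBall d ((1 + B) * ρ) := by
  rw [SteadyTransport.mem_slabBall] at hx ⊢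
  refine ⟨hφ.mem x hx.1 t, ?_⟩
  have h1 := hφ.norm_sub_le hv hx.1 t
  have h2 := norm_sub_norm_le (φ t x) x
  have h3 : B * |t| ≤ B * ρ := mul_le_mul_of_nonneg_left ht hv.nonneg
  linarith [hx.2]

end Flow

section Transport

variable {E : Type} [NormedAddCommGroup E] [NormedSpace ℝ E]

/-- `w` solves the linear transport system `v · ∇w + A w = F` along the trajectories of the flow
`φ` of `v`, with `w = w₀` on the plane `{x₁ = 0}`. -/
structure IsTransport (Ω : Set E3) (φ : ℝ → E3 → E3) (A : E3 → E →L[ℝ] E) (F w₀ w : E3 → E) :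
    Prop where
  deriv : ∀ x ∈ Ω, ∀ t, HasDerivAt (fun t => w (φ t x)) (F (φ t x) - A (φ t x) (w (φ t x))) t
  init : ∀ x ∈ Ω, x 0 = 0 → w x = w₀ x

variable {Ω : Set E3} {α B d N C₀ : ℝ} {v : E3 → E3} {φ : ℝ → E3 → E3} {A : E3 → E →L[ℝ] E}
  {F w₀ w : E3 → E}

/-- Along the trajectory through a point `p` of the plane, the system is a linear ordinary
differential equation; its solution at time `x₁` is the value at `x`, where `p` is the crossing
point of the trajectory of `x`. -/
theorem exists_isTransport [CompleteSpace E] (hφ : IsFlow Ω v φ) (hv : IsUnitSpeed Ω B v)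
    (hA : ContinuousOn A Ω) (hF : ContinuousOn F Ω) (w₀ : E3 → E) :
    ∃ w, IsTransport Ω φ A F w₀ w := by
  have hex : ∀ p : E3, ∃ y : ℝ → E, p ∈ Ω → y 0 = w₀ p ∧
      ∀ t, HasDerivAt y (F (φ t p) - A (φ t p) (y t)) t := by
    intro p
    by_cases hp : p ∈ Ω
    · have hc : Continuous fun t => φ t p :=
        continuous_iff_continuousAt.2 fun t => (hφ.deriv p hp t).continuousAt
      have hcA : Continuous fun t => A (φ t p) :=
        hA.comp_continuous hc fun t => hφ.mem p hp t
      have hcF : Continuous fun t => F (φ t p) :=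
        hF.comp_continuous hc fun t => hφ.mem p hp t
      obtain ⟨y, hy0, hy⟩ := exists_hasDerivAt_of_lipschitz
        (f := fun t y => F (φ t p) - A (φ t p) y) (fun T => by
          obtain ⟨K, hK⟩ := isCompact_Icc.exists_bound_of_continuousOn (s := Icc (-T) T)
            hcA.continuousOn
          refine ⟨K.toNNReal, fun t ht => LipschitzWith.of_dist_le_mul fun y z => ?_⟩
          rw [dist_sub_left, dist_eq_norm, dist_eq_norm, ← map_sub]
          exact (A (φ t p)).le_of_opNorm_le ((hK t ht).trans (Real.le_coe_toNNReal K)) _)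
        (fun y => hcF.sub (hcA.clm_apply continuous_const)) (w₀ p)
      exact ⟨y, fun _ => ⟨hy0, hy⟩⟩
    · exact ⟨0, fun h => absurd h hp⟩
  choose Y hY using hex
  -- All points of a trajectory have the same crossing point.
  have hkey : ∀ x ∈ Ω, ∀ t, φ (-(φ t x) 0) (φ t x) = φ (-(x 0)) x := by
    intro x hx t
    rw [hφ.add x hx, hφ.apply_zero hv hx]
    congr 1
    ring
  refine ⟨fun x => Y (φ (-(x 0)) x) (x 0), fun x hx t => ?_, fun x hx hx0 => ?_⟩
  · have hp := hφ.mem x hx (-(x 0))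
    have h1 : ∀ s, φ (x 0 + s) (φ (-(x 0)) x) = φ s x := fun s => by
      rw [hφ.add x hx]; congr 1; ring
    have h2 := ((hY _ hp).2 (x 0 + t)).comp_const_add (x 0) t
    rw [h1] at h2
    have h3 : ∀ s, Y (φ (-(φ s x) 0) (φ s x)) ((φ s x) 0) = Y (φ (-(x 0)) x) (x 0 + s) := fun s => by
      rw [hkey x hx, hφ.apply_zero hv hx]
    simp only [h3]
    exact h2
  · simp only [hx0, neg_zero, hφ.zero x hx]
    exact (hY x hx).1

/-- A bound for the solution of a transport system in terms of a bound for its data. -/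
theorem IsTransport.norm_le (hw : IsTransport (slab d) φ A F w₀ w) (hφ : IsFlow (slab d) v φ)
    (hv : IsUnitSpeed (slab d) B v) {ρ : ℝ} (hN : 0 ≤ N)
    (hA : ∀ x ∈ slabBall d ((1 + B) * ρ), ‖A x‖ ≤ N)
    (hF : ∀ x ∈ slabBall d ((1 + B) * ρ), ‖F x‖ ≤ N)
    (h₀ : ∀ x ∈ slabBall d ((1 + B) * ρ), ‖w₀ x‖ ≤ N) {x : E3} (hx : x ∈ slabBall d ρ) :
    ‖w x‖ ≤ (N + N * ρ) * Real.exp (N * ρ) := by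
  have hxs := (mem_slabBall.1 hx).1
  have hx0 : |x 0| ≤ ρ := (abs_apply_le x 0).trans (mem_slabBall.1 hx).2.le
  have hmem : ∀ t ∈ uIcc (-(x 0)) 0, φ t x ∈ slabBall d ((1 + B) * ρ) := by
    intro t ht
    refine hφ.mem_slabBall hv hx (le_trans ?_ hx0)
    have := abs_sub_right_of_mem_uIcc ht
    simpa using this
  have h := norm_le_of_norm_deriv_le (y := fun t => w (φ t x)) (a := -(x 0)) (b := 0) hN hN
    (fun t _ => hw.deriv x hxs t) (fun t ht => by
      refine (norm_sub_le _ _).trans ?_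
      have h1 := hF _ (hmem t ht)
      have h2 := (A (φ t x)).le_of_opNorm_le (hA _ (hmem t ht)) (w (φ t x))
      linarith)
  have hp : ‖w (φ (-(x 0)) x)‖ ≤ N := by
    rw [hw.init _ (hφ.mem x hxs _) (by rw [hφ.apply_zero hv hxs]; ring)]
    exact h₀ _ (hmem _ left_mem_uIcc)
  simp only [zero_sub, neg_neg, hφ.zero x hxs] at h
  refine h.trans ?_
  have : 0 ≤ ρ := (abs_nonneg _).trans hx0
  gcongr

theorem rpow_mul_le {c h β : ℝ} (hc : 1 ≤ c) (hh : 0 ≤ h) (hβ : β ≤ 1) :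
    (c * h) ^ β ≤ c * h ^ β := by
  rw [Real.mul_rpow (by linarith) hh]
  gcongr
  simpa using Real.rpow_le_rpow_of_exponent_le hc hβ

theorem le_mul_rpow {ρ h : ℝ} (hα : 0 < α) (hα1 : α < 1) (hh : 0 ≤ h) (hρ : h ≤ 2 * ρ) :
    h ≤ (1 + 2 * ρ) * h ^ α := by
  have h0 : 0 ≤ h ^ α := by positivity
  rcases le_total h 1 with h1 | h1
  · have : h ≤ h ^ α := by simpa using Real.rpow_le_rpow_of_exponent_ge' hh h1 hα.le hα1.le
    nlinarith
  · have := Real.one_le_rpow h1 hα.le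
    nlinarith

/-- The points on the trajectories through two nearby points `x` and `x'` at the time when the
first of them crosses the plane `{x₁ = 0}`, and the point where the second one crosses it. -/
theorem IsFlow.crossing_estimates (hφ : IsFlow (slab d) v φ) (hv : IsUnitSpeed (slab d) B v)
    {ρ : ℝ} {x x' : E3} (hx : x ∈ slabBall d ρ) (hx' : x' ∈ slabBall d ρ) :
    (∀ t ∈ uIcc (-(x 0)) 0, φ t x ∈ slabBall d ((1 + B) * ρ) ∧
      φ t x' ∈ slabBall d ((1 + B) * ρ) ∧
      ‖φ t x' - φ t x‖ ≤ Real.exp (B * ρ) * ‖x' - x‖) ∧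
    φ (-(x 0)) x 0 = 0 ∧ φ (-(x 0)) x' 0 = x' 0 - x 0 ∧
    |x' 0 - x 0| ≤ ‖x' - x‖ ∧
    ∀ s ∈ uIcc (-(x' 0 - x 0)) 0,
      φ s (φ (-(x 0)) x') ∈ slabBall d ((1 + B) * ((1 + B) * ρ)) ∧
      ‖φ s (φ (-(x 0)) x') - φ (-(x 0)) x‖ ≤ (B + Real.exp (B * ρ)) * ‖x' - x‖ := by
  have hxs := (SteadyTransport.mem_slabBall.1 hx).1
  have hxs' := (SteadyTransport.mem_slabBall.1 hx').1
  have hx0 : |x 0| ≤ ρ := (abs_apply_le x 0).trans (SteadyTransport.mem_slabBall.1 hx).2.le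
  have hdiff : |x' 0 - x 0| ≤ ‖x' - x‖ := abs_apply_le (x' - x) 0
  have hfst : ∀ t ∈ uIcc (-(x 0)) 0, φ t x ∈ slabBall d ((1 + B) * ρ) ∧
      φ t x' ∈ slabBall d ((1 + B) * ρ) ∧
      ‖φ t x' - φ t x‖ ≤ Real.exp (B * ρ) * ‖x' - x‖ := by
    intro t ht
    have h1 : |t| ≤ ρ := by
      have := abs_sub_right_of_mem_uIcc ht
      simp only [zero_sub, abs_neg, neg_neg] at this
      exact this.trans hx0
    refine ⟨hφ.mem_slabBall hv hx h1, hφ.mem_slabBall hv hx' h1,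
      (hφ.norm_sub_flow_le hv hxs' hxs t).trans ?_⟩
    have := hv.nonneg
    gcongr
  refine ⟨hfst, by rw [hφ.apply_zero hv hxs]; ring, by rw [hφ.apply_zero hv hxs']; ring, hdiff,
    fun s hs => ?_⟩
  obtain ⟨-, h2, h3⟩ := hfst _ left_mem_uIcc
  have h4 : |s| ≤ |x' 0 - x 0| := by
    have := abs_sub_right_of_mem_uIcc hs
    simp only [zero_sub, abs_neg, neg_neg] at this
    exact this
  have h5 : |x' 0 - x 0| ≤ (1 + B) * ρ := by
    have h := abs_apply_le (φ (-(x 0)) x') 0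
    rw [hφ.apply_zero hv hxs', ← sub_eq_add_neg] at h
    exact h.trans (SteadyTransport.mem_slabBall.1 h2).2.le
  refine ⟨hφ.mem_slabBall hv h2 (h4.trans h5), ?_⟩
  have h6 := hφ.norm_sub_le hv (SteadyTransport.mem_slabBall.1 h2).1 s
  have h7 : B * |s| ≤ B * ‖x' - x‖ := mul_le_mul_of_nonneg_left (h4.trans hdiff) hv.nonneg
  refine (norm_sub_le_norm_sub_add_norm_sub _ (φ (-(x 0)) x') _).trans ?_
  linarith

/-- A Hölder bound for the solution of a transport system in terms of Hölder bounds for its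
data. -/
theorem exists_holderBound_zero (hα : 0 < α) (hα1 : α < 1) (d B : ℝ) {ρ : ℝ} (hρ : 0 < ρ)
    (hN : 0 ≤ N) :
    ∃ C, 0 ≤ C ∧ ∀ (v : E3 → E3) (φ : ℝ → E3 → E3), IsFlow (slab d) v φ →
      IsUnitSpeed (slab d) B v →
      ∀ (E : Type) [NormedAddCommGroup E] [NormedSpace ℝ E] (A : E3 → E →L[ℝ] E) (F w₀ w : E3 → E),
      HolderBound α (slabBall d ((1 + B) * ((1 + B) * ((1 + B) * ρ)))) 0 N A →
      HolderBound α (slabBall d ((1 + B) * ((1 + B) * ((1 + B) * ρ)))) 0 N F →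
      HolderBound α (slabBall d ((1 + B) * ((1 + B) * ((1 + B) * ρ)))) 0 N w₀ →
      IsTransport (slab d) φ A F w₀ w → HolderBound α (slabBall d ρ) 0 C w := by
  by_cases hB : 0 ≤ B
  swap
  · exact ⟨0, le_rfl, fun v φ _ hv => absurd hv.nonneg hB⟩
  -- Three enlargements: `ρ₁` contains both trajectories until the first one crosses the plane, `ρ₂`
  -- also the extra stretch on which the second one reaches it, and `ρ₃` the data needed to bound
  -- `w` on the ball of radius `ρ₂`.
  set ρ₁ := (1 + B) * ρ with hρ₁
  set ρ₂ := (1 + B) * ρ₁ with hρ₂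
  set ρ₃ := (1 + B) * ρ₂ with hρ₃
  have hρ₁pos : 0 < ρ₁ := by positivity
  have hρ₂pos : 0 < ρ₂ := by positivity
  have le1 : ρ ≤ ρ₁ := by nlinarith
  have le2 : ρ₁ ≤ ρ₂ := by nlinarith
  have le3 : ρ₂ ≤ ρ₃ := by nlinarith
  set C₀ := (N + N * ρ₂) * Real.exp (N * ρ₂) with hC₀
  set L := Real.exp (B * ρ) with hL
  set I := N * (1 + C₀) * (1 + 2 * ρ) + N * (B + L) with hI
  set ε := N * (1 + C₀) * L with hε
  have hL1 : 1 ≤ L := Real.one_le_exp (by positivity)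
  have hC₀0 : 0 ≤ C₀ := by positivity
  set C := C₀ + (I + ε * ρ) * Real.exp (N * ρ) with hC
  have hC0 : 0 ≤ C := by positivity
  refine ⟨C, hC0, fun v φ hφ hv E _ _ A F w₀ w hA hF h₀ hw => ?_⟩
  have hsup : ∀ y ∈ slabBall d ρ₂, ‖w y‖ ≤ C₀ := fun y hy =>
    hw.norm_le hφ hv hN (fun _ h => hA.norm_le h) (fun _ h => hF.norm_le h)
      (fun _ h => h₀.norm_le h) hy
  have hCC : C₀ ≤ C := by rw [hC]; exact le_add_of_nonneg_right (by positivity)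
  refine HolderBound.of_zero hα
    (fun x hx => (hsup x (slabBall_mono d (le1.trans le2) hx)).trans hCC) fun x' hx' x hx => ?_
  obtain ⟨hz, hp0, hp0', hdiff, hcr⟩ := hφ.crossing_estimates hv hx hx'
  have hxs := (mem_slabBall.1 hx).1
  have hxs' := (mem_slabBall.1 hx').1
  set h := ‖x' - x‖ with hh
  have hh0 : 0 ≤ h := norm_nonneg _
  have hh2 : h ≤ 2 * ρ := by
    have := norm_sub_le x' x
    linarith [(mem_slabBall.1 hx).2, (mem_slabBall.1 hx').2]
  have hhα : 0 ≤ h ^ α := by positivity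
  set p := φ (-(x 0)) x with hp
  set p' := φ (-(x 0)) x' with hp'
  have hps : p ∈ slab d := hφ.mem x hxs _
  have hps' : p' ∈ slab d := hφ.mem x' hxs' _
  -- The point `p'` is generally off the plane, but within time `|x'₁ - x₁| ≤ h` of its own crossing
  -- point `p''`. On this stretch `w` changes at a bounded rate; between `p''` and `p` it is the
  -- Hölder bound of `w₀` that counts.
  have hinit : ‖w p' - w p‖ ≤ I * h ^ α := by
    have h1 := norm_sub_smul_le_of_deriv (y := fun s => w (φ s p')) (a := -(x' 0 - x 0)) (b := 0)
      (m := 0) (ε := N * (1 + C₀)) (fun s _ => hw.deriv p' hps' s) (fun s hs => by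
        rw [sub_zero]
        have hm := (hcr s hs).1
        refine (norm_sub_le _ _).trans ?_
        have e1 := hF.norm_le (slabBall_mono d le3 hm)
        have e2 := (A (φ s p')).le_of_opNorm_le (hA.norm_le (slabBall_mono d le3 hm)) (w (φ s p'))
        have e3 := mul_le_mul_of_nonneg_left (hsup _ hm) hN
        linarith)
    rw [smul_zero, sub_zero, zero_sub, neg_neg, hφ.zero p' hps'] at h1
    set p'' := φ (-(x' 0 - x 0)) p' with hp''
    have hm := hcr _ left_mem_uIcc
    have hp0'' : p'' 0 = 0 := by rw [hp'', hφ.apply_zero hv hps', hp0']; ring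
    have h2 : ‖w p'' - w p‖ ≤ N * ((B + L) * h ^ α) := by
      rw [hw.init _ (hφ.mem _ hps' _) hp0'', hw.init _ hps hp0]
      refine (h₀.holder_zero (slabBall_mono d le3 hm.1)
        (slabBall_mono d (le2.trans le3) (hz _ left_mem_uIcc).1)).trans ?_
      gcongr
      refine le_trans ?_ (rpow_mul_le (c := B + L) (by linarith) hh0 hα1.le)
      exact Real.rpow_le_rpow (norm_nonneg _) hm.2 hα.le
    have h3 : N * (1 + C₀) * |x' 0 - x 0| ≤ N * (1 + C₀) * ((1 + 2 * ρ) * h ^ α) := by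
      gcongr
      exact hdiff.trans (le_mul_rpow hα hα1 hh0 hh2)
    calc _ ≤ ‖w p' - w p''‖ + ‖w p'' - w p‖ := norm_sub_le_norm_sub_add_norm_sub _ _ _
      _ ≤ N * (1 + C₀) * ((1 + 2 * ρ) * h ^ α) + N * ((B + L) * h ^ α) :=
        add_le_add (h1.trans h3) h2
      _ = I * h ^ α := by rw [hI]; ring
  -- Grönwall for the difference of `w` along the two trajectories, at equal times. Its derivative
  -- is `-A` applied to the difference, up to Hölder increments of `F` and `A`, which are of size `h
  -- ^ α` because the flow is Lipschitz.
  have hG := norm_le_of_norm_deriv_le (y := fun t => w (φ t x') - w (φ t x)) (a := -(x 0)) (b := 0)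
    (ε := ε * h ^ α) hN (by positivity)
    (fun t _ => (hw.deriv x' hxs' t).sub (hw.deriv x hxs t)) (fun t ht => by
      obtain ⟨m1, m2, m3⟩ := hz t ht
      set z := φ t x
      set z' := φ t x'
      have m1' := slabBall_mono d (le2.trans le3) m1
      have m2' := slabBall_mono d (le2.trans le3) m2
      have hq : ‖z' - z‖ ^ α ≤ L * h ^ α :=
        (Real.rpow_le_rpow (norm_nonneg _) m3 hα.le).trans (rpow_mul_le hL1 hh0 hα1.le)
      have e : F z' - A z' (w z') - (F z - A z (w z)) =
          (F z' - F z) - (A z' - A z) (w z') - A z (w z' - w z) := by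
        simp only [sub_apply, map_sub]; abel
      have e1 : ‖F z' - F z‖ ≤ N * (L * h ^ α) :=
        (hF.holder_zero m2' m1').trans (by gcongr)
      have e2 : ‖(A z' - A z) (w z')‖ ≤ N * (L * h ^ α) * C₀ := by
        refine ((A z' - A z).le_opNorm _).trans ?_
        have := hsup z' (slabBall_mono d le2 m2)
        have := (hA.holder_zero m2' m1').trans (mul_le_mul_of_nonneg_left hq hN)
        gcongr
      have e3 := (A z).le_of_opNorm_le (hA.norm_le m1') (w z' - w z)
      rw [e]
      refine ((norm_sub_le _ _).trans (add_le_add (norm_sub_le _ _) le_rfl)).trans ?_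
      rw [hε]
      linarith)
  simp only [zero_sub, neg_neg, hφ.zero x hxs, hφ.zero x' hxs'] at hG
  have hx0 : |x 0| ≤ ρ := (abs_apply_le x 0).trans (mem_slabBall.1 hx).2.le
  calc ‖w x' - w x‖ ≤ (I * h ^ α + ε * h ^ α * ρ) * Real.exp (N * ρ) := by
        refine hG.trans ?_
        gcongr
    _ = ((I + ε * ρ) * Real.exp (N * ρ)) * h ^ α := by ring
    _ ≤ C * h ^ α := by
        gcongr
        rw [hC]
        exact le_add_of_nonneg_left hC₀0

end Transport

/-! ### First-order Taylor expansions with remainder of order `1 + α` -/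

section Taylor

variable {F : Type} [NormedAddCommGroup F] [NormedSpace ℝ F] {α C : ℝ} {U : Set E3} {f : E3 → F}

/-- The mean value inequality for `f` minus its linear part at `x`, on the convex set of points of
`U` no farther from `x` than `y`. -/
theorem HolderBound.norm_taylor_le (h : HolderBound α U 1 C f) (hα : 0 < α) (hU : Convex ℝ U)
    (hUo : IsOpen U) {x y : E3} (hx : x ∈ U) (hy : y ∈ U) :
    ‖f y - f x - fderiv ℝ f x (y - x)‖ ≤ C * ‖y - x‖ ^ (1 + α) := by
  obtain ⟨-, h1, h2⟩ := (holderBound_succ_iff (n := 0) hUo).1 h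
  have hC : 0 ≤ C := (norm_nonneg _).trans (h2.norm_le hx)
  rcases (norm_nonneg (y - x)).eq_or_lt with h0 | h0
  · rw [sub_eq_zero.1 (norm_eq_zero.1 h0.symm)]
    simp
    positivity
  have := (hU.inter (convex_closedBall x ‖y - x‖)).norm_image_sub_le_of_norm_fderiv_le'
    (f := f) (φ := fderiv ℝ f x) (C := C * ‖y - x‖ ^ α) (x := x) (y := y)
    (fun z hz => h1.differentiableAt (hUo.mem_nhds hz.1))
    (fun z hz => (h2.holder_zero hz.1 hx).trans (by
      have := mem_closedBall_iff_norm.1 hz.2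
      gcongr)) ⟨hx, mem_closedBall_self (norm_nonneg _)⟩
    ⟨hy, mem_closedBall_iff_norm.2 le_rfl⟩
  refine this.trans (le_of_eq ?_)
  rw [Real.rpow_add h0, Real.rpow_one]
  ring

theorem hasFDerivAt_of_norm_taylor_le (hα : 0 < α) {f' : E3 →L[ℝ] F} {x : E3}
    (h : ∀ᶠ y in nhds x, ‖f y - f x - f' (y - x)‖ ≤ C * ‖y - x‖ ^ (1 + α)) :
    HasFDerivAt f f' x := by
  rw [hasFDerivAt_iff_isLittleO]
  have h1 : (fun y => f y - f x - f' (y - x)) =O[nhds x] fun y => ‖y - x‖ ^ (1 + α) :=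
    Asymptotics.IsBigO.of_bound C (h.mono fun y hy => by
      rwa [Real.norm_of_nonneg (by positivity : (0 : ℝ) ≤ ‖y - x‖ ^ (1 + α))])
  refine h1.trans_isLittleO ?_
  refine Asymptotics.IsLittleO.of_norm_right ?_
  have h2 : (fun y => ‖y - x‖ ^ α) =o[nhds x] fun _ => (1 : ℝ) := by
    rw [Asymptotics.isLittleO_one_iff]
    have : ContinuousAt (fun y : E3 => ‖y - x‖ ^ α) x :=
      ContinuousAt.rpow_const (by fun_prop) (Or.inr hα.le)
    simpa [Real.zero_rpow hα.ne'] using this.tendsto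
  have h3 := (Asymptotics.isBigO_refl (fun y : E3 => ‖y - x‖) (nhds x)).mul_isLittleO h2
  simp only [mul_one] at h3
  refine h3.congr_left fun y => ?_
  rcases (norm_nonneg (y - x)).eq_or_lt with h0 | h0
  · rw [← h0, zero_mul, Real.zero_rpow (by linarith)]
  · rw [Real.rpow_add h0, Real.rpow_one]

end Taylor

/-! ### The differentiated transport system -/

section Derivative

variable {E : Type} [NormedAddCommGroup E] [NormedSpace ℝ E]

/-- The zeroth-order coefficient in the transport system for the derivative of a solution. -/
def derivCoeff (v : E3 → E3) (A : E3 → E →L[ℝ] E) (x : E3) : (E3 →L[ℝ] E) →L[ℝ] (E3 →L[ℝ] E) :=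
  ContinuousLinearMap.compL ℝ E3 E E (A x) +
    (ContinuousLinearMap.compL ℝ E3 E3 E).flip (fderiv ℝ v x)

/-- The right-hand side in the transport system for the derivative of a solution. -/
def derivSource (A : E3 → E →L[ℝ] E) (F w : E3 → E) (x : E3) : E3 →L[ℝ] E :=
  fderiv ℝ F x - (fderiv ℝ A x).flip (w x)

/-- The initial values in the transport system for the derivative of a solution. -/
def derivInit (v : E3 → E3) (A : E3 → E →L[ℝ] E) (F w₀ : E3 → E) (x : E3) : E3 →L[ℝ] E :=
  fderiv ℝ w₀ x + (coordProj 0).smulRight (F x - A x (w₀ x) - fderiv ℝ w₀ x (v x))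

@[simp] theorem derivCoeff_apply (v : E3 → E3) (A : E3 → E →L[ℝ] E) (x : E3) (W : E3 →L[ℝ] E)
    (h : E3) : derivCoeff v A x W h = A x (W h) + W (fderiv ℝ v x h) := rfl

@[simp] theorem derivSource_apply (A : E3 → E →L[ℝ] E) (F w : E3 → E) (x h : E3) :
    derivSource A F w x h = fderiv ℝ F x h - fderiv ℝ A x h (w x) := rfl

@[simp] theorem derivInit_apply (v : E3 → E3) (A : E3 → E →L[ℝ] E) (F w₀ : E3 → E) (x h : E3) :
    derivInit v A F w₀ x h =
      fderiv ℝ w₀ x h + h 0 • (F x - A x (w₀ x) - fderiv ℝ w₀ x (v x)) := rfl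

variable {α B d N : ℝ} {v : E3 → E3} {φ : ℝ → E3 → E3} {A : E3 → E →L[ℝ] E}
  {F w₀ w : E3 → E} {W : E3 → E3 →L[ℝ] E}

/-- On the plane the derivative of `w` is forced: tangentially it is that of `w₀`, and in the
direction `v`, which has first component 1, it is `F - A w₀` by the equation. `derivInit` is the
linear map with these values. The claim is that it gives a first-order expansion of `w` from `p`
also to points `p'` off the plane. -/
theorem IsTransport.taylor_init (hα : 0 < α) (hα1 : α < 1) {ρ : ℝ} (hN : 0 ≤ N)
    (hφ : IsFlow (slab d) v φ) (hv : IsUnitSpeed (slab d) B v)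
    (hA : HolderBound α (slabBall d ((1 + B) * ((1 + B) * ρ))) 0 N A)
    (hF : HolderBound α (slabBall d ((1 + B) * ((1 + B) * ρ))) 0 N F)
    (h₀ : HolderBound α (slabBall d ((1 + B) * ((1 + B) * ρ))) 1 N w₀)
    (hw : IsTransport (slab d) φ A F w₀ w)
    (hw0 : HolderBound α (slabBall d ((1 + B) * ((1 + B) * ρ))) 0 N w)
    {x x' : E3} (hx : x ∈ slabBall d ρ) (hx' : x' ∈ slabBall d ρ) (hh1 : ‖x' - x‖ ≤ 1) :
    ‖w (φ (-(x 0)) x') - w (φ (-(x 0)) x) -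
      derivInit v A F w₀ (φ (-(x 0)) x) (φ (-(x 0)) x' - φ (-(x 0)) x)‖ ≤
      ((N + 2 * N * N) * (B + Real.exp (B * ρ)) + N * (B + Real.exp (B * ρ)) ^ 2 +
        N * (B * (B + Real.exp (B * ρ)))) * ‖x' - x‖ ^ (1 + α) := by
  obtain ⟨hz, hp0, hp0', hdiff, hcr⟩ := hφ.crossing_estimates hv hx hx'
  have hB := hv.nonneg
  have hρ : 0 ≤ ρ := (norm_nonneg _).trans (mem_slabBall.1 hx).2.le
  have hL1 : 1 ≤ Real.exp (B * ρ) := Real.one_le_exp (by positivity)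
  set c := B + Real.exp (B * ρ) with hc
  have hc1 : 1 ≤ c := by linarith
  set h := ‖x' - x‖ with hh
  have hh0 : 0 ≤ h := norm_nonneg _
  have hxs := (mem_slabBall.1 hx).1
  have hxs' := (mem_slabBall.1 hx').1
  set p := φ (-(x 0)) x with hp
  set p' := φ (-(x 0)) x' with hp'
  have hps : p ∈ slab d := hφ.mem x hxs _
  have hps' : p' ∈ slab d := hφ.mem x' hxs' _
  set τ := x' 0 - x 0 with hτ
  have hpow : h * h ^ α = h ^ (1 + α) := by
    rcases hh0.eq_or_lt with h0 | h0
    · rw [← h0, zero_mul, Real.zero_rpow (by linarith)]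
    · rw [Real.rpow_add h0, Real.rpow_one]
  have hsq : h * h ≤ h ^ (1 + α) := by
    rw [← hpow]
    gcongr
    simpa using Real.rpow_le_rpow_of_exponent_ge' hh0 hh1 hα.le hα1.le
  have hpB : p ∈ slabBall d ((1 + B) * ((1 + B) * ρ)) := by
    refine slabBall_mono d ?_ (hz _ left_mem_uIcc).1
    have : 0 ≤ (1 + B) * ρ := by positivity
    nlinarith
  have hcα : ∀ s ∈ uIcc (-τ) 0, ‖φ s p' - p‖ ^ α ≤ c * h ^ α := fun s hs =>
    (Real.rpow_le_rpow (norm_nonneg _) (hcr s hs).2 hα.le).trans (rpow_mul_le hc1 hh0 hα1.le)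
  set p'' := φ (-τ) p' with hp''
  have hm := hcr _ left_mem_uIcc
  have hps'' : p'' ∈ slab d := hφ.mem _ hps' _
  have hp0'' : p'' 0 = 0 := by rw [hp'', hφ.apply_zero hv hps', hp0']; ring
  have t1 : ‖w p' - w p'' - τ • (F p - A p (w p))‖ ≤ (N + 2 * N * N) * c * h ^ (1 + α) := by
    have h1 := norm_sub_smul_le_of_deriv (y := fun s => w (φ s p')) (a := -τ) (b := 0)
      (m := F p - A p (w p)) (ε := (N + 2 * N * N) * (c * h ^ α))
      (fun s _ => hw.deriv p' hps' s) (fun s hs => by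
        have hm := (hcr s hs).1
        set z := φ s p'
        have e : F z - A z (w z) - (F p - A p (w p)) =
            (F z - F p) - (A z - A p) (w z) - A p (w z - w p) := by
          simp only [sub_apply, map_sub]; abel
        have hq := hcα s hs
        have e1 : ‖F z - F p‖ ≤ N * (c * h ^ α) := (hF.holder_zero hm hpB).trans (by gcongr)
        have e2 : ‖(A z - A p) (w z)‖ ≤ N * (c * h ^ α) * N := by
          refine ((A z - A p).le_opNorm _).trans ?_
          have := hw0.norm_le hm
          have := (hA.holder_zero hm hpB).trans (mul_le_mul_of_nonneg_left hq hN)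
          gcongr
        have e3 : ‖A p (w z - w p)‖ ≤ N * (N * (c * h ^ α)) := by
          refine ((A p).le_opNorm _).trans ?_
          have := hA.norm_le hpB
          have := (hw0.holder_zero hm hpB).trans (mul_le_mul_of_nonneg_left hq hN)
          gcongr
        rw [e]
        refine ((norm_sub_le _ _).trans (add_le_add (norm_sub_le _ _) le_rfl)).trans ?_
        linarith)
    simp only [zero_sub, neg_neg, hφ.zero p' hps'] at h1
    refine h1.trans ?_
    rw [← hpow]
    calc (N + 2 * N * N) * (c * h ^ α) * |τ| ≤ (N + 2 * N * N) * (c * h ^ α) * h := by gcongr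
      _ = _ := by ring
  have t2 : ‖w₀ p'' - w₀ p - fderiv ℝ w₀ p (p'' - p)‖ ≤ N * c ^ 2 * h ^ (1 + α) := by
    refine (h₀.norm_taylor_le hα (convex_slabBall _ _) (isOpen_slabBall _ _) hpB hm.1).trans ?_
    rw [mul_assoc]
    gcongr
    refine (Real.rpow_le_rpow (norm_nonneg _) hm.2 (by linarith)).trans ?_
    rw [Real.mul_rpow (by linarith) hh0]
    gcongr
    rw [← Real.rpow_natCast]
    exact Real.rpow_le_rpow_of_exponent_le hc1 (by push_cast; linarith)
  have t3 : ‖fderiv ℝ w₀ p (p'' - p' + τ • v p)‖ ≤ N * (B * c) * h ^ (1 + α) := by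
    have h1 := norm_sub_smul_le_of_deriv (y := fun s => φ s p') (a := -τ) (b := 0)
      (m := v p) (ε := B * (c * h)) (fun s _ => hφ.deriv p' hps' s) (fun s hs =>
        (hv.lipschitz _ (hφ.mem _ hps' s) _ hps).trans
          (mul_le_mul_of_nonneg_left (hcr s hs).2 hB))
    simp only [zero_sub, neg_neg, hφ.zero p' hps'] at h1
    rw [← norm_neg] at h1
    have e : p'' - p' + τ • v p = -(p' - p'' - τ • v p) := by abel
    refine ((fderiv ℝ w₀ p).le_opNorm _).trans ?_
    have h2 : ‖fderiv ℝ w₀ p‖ ≤ N :=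
      ((holderBound_succ_iff (n := 0) (isOpen_slabBall _ _)).1 h₀).2.2.norm_le hpB
    rw [e]
    calc _ ≤ N * (B * (c * h) * |τ|) := by gcongr
      _ ≤ N * (B * (c * h) * h) := by gcongr
      _ = N * (B * c) * (h * h) := by ring
      _ ≤ _ := by gcongr
  -- The remainder splits into three errors of order `1 + α`: following the second trajectory from
  -- the plane for time `τ`, expanding `w₀` within the plane, and replacing the displacement `p' -
  -- p''` by `τ v(p)`. The last is quadratic in `h`, hence the restriction to `h ≤ 1`.
  have e : w p' - w p - derivInit v A F w₀ p (p' - p) =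
      (w p' - w p'' - τ • (F p - A p (w p))) + (w₀ p'' - w₀ p - fderiv ℝ w₀ p (p'' - p)) +
        fderiv ℝ w₀ p (p'' - p' + τ • v p) := by
    rw [derivInit_apply, PiLp.sub_apply, hp0, hp0', sub_zero, hw.init _ hps hp0,
      hw.init _ hps'' hp0'']
    simp only [map_sub, map_add, map_smul, smul_sub]
    abel
  rw [e]
  refine (norm_add_le _ _).trans ((add_le_add (norm_add_le _ _) le_rfl).trans ?_)
  linarith

/-- No differentiability of `w` is assumed: `W` is only a candidate that solves the formally
differentiated system. The remainder `w(z') - w(z) - W(z)(z' - z)` along two trajectories solves `r'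
= -A(z) r` up to an error of order `1 + α`, and it is small on the plane by `taylor_init`, so
Grönwall carries the estimate to `x` and `x'`. -/
theorem IsTransport.norm_taylor_le (hα : 0 < α) (hα1 : α < 1) {ρ : ℝ} (hN : 0 ≤ N)
    (hφ : IsFlow (slab d) v φ) (hv : IsUnitSpeed (slab d) B v)
    (hv1 : HolderBound α (slabBall d ((1 + B) * ((1 + B) * ρ))) 1 N v)
    (hA : HolderBound α (slabBall d ((1 + B) * ((1 + B) * ρ))) 1 N A)
    (hA0 : HolderBound α (slabBall d ((1 + B) * ((1 + B) * ρ))) 0 N A)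
    (hF : HolderBound α (slabBall d ((1 + B) * ((1 + B) * ρ))) 1 N F)
    (hF0 : HolderBound α (slabBall d ((1 + B) * ((1 + B) * ρ))) 0 N F)
    (h₀ : HolderBound α (slabBall d ((1 + B) * ((1 + B) * ρ))) 1 N w₀)
    (hw : IsTransport (slab d) φ A F w₀ w)
    (hw0 : HolderBound α (slabBall d ((1 + B) * ((1 + B) * ρ))) 0 N w)
    (hW : IsTransport (slab d) φ (derivCoeff v A) (derivSource A F w) (derivInit v A F w₀) W)
    (hW0 : HolderBound α (slabBall d ((1 + B) * ((1 + B) * ρ))) 0 N W) :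
    ∃ C, ∀ x ∈ slabBall d ρ, ∀ x' ∈ slabBall d ρ, ‖x' - x‖ ≤ 1 →
      ‖w x' - w x - W x (x' - x)‖ ≤ C * ‖x' - x‖ ^ (1 + α) := by
  set L := Real.exp (B * ρ) with hL
  set I := (N + 2 * N * N) * (B + L) + N * (B + L) ^ 2 + N * (B * (B + L)) with hI
  set ε := (N + 3 * N * N) * L ^ 2 with hε
  refine ⟨(I + ε * ρ) * Real.exp (N * ρ), fun x hx x' hx' hh1 => ?_⟩
  have hB := hv.nonneg
  have hρ : 0 ≤ ρ := (norm_nonneg _).trans (mem_slabBall.1 hx).2.le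
  have hinit := hw.taylor_init hα hα1 hN hφ hv hA0 hF0 h₀ hw0 hx hx' hh1
  obtain ⟨hz, hp0, hp0', hdiff, hcr⟩ := hφ.crossing_estimates hv hx hx'
  have hL1 : 1 ≤ L := Real.one_le_exp (by positivity)
  set h := ‖x' - x‖ with hh
  have hh0 : 0 ≤ h := norm_nonneg _
  have hxs := (mem_slabBall.1 hx).1
  have hxs' := (mem_slabBall.1 hx').1
  have hUc := convex_slabBall d ((1 + B) * ((1 + B) * ρ))
  have hUo := isOpen_slabBall d ((1 + B) * ((1 + B) * ρ))
  have hsub : slabBall d ((1 + B) * ρ) ⊆ slabBall d ((1 + B) * ((1 + B) * ρ)) := by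
    refine slabBall_mono d ?_
    have : 0 ≤ (1 + B) * ρ := by positivity
    nlinarith
  have hh1α : 0 ≤ h ^ (1 + α) := by positivity
  have hG := norm_le_of_norm_deriv_le
    (y := fun t => w (φ t x') - w (φ t x) - W (φ t x) (φ t x' - φ t x)) (a := -(x 0)) (b := 0)
    (ε := ε * h ^ (1 + α)) hN (by positivity)
    (fun t _ => ((hw.deriv x' hxs' t).sub (hw.deriv x hxs t)).sub
      ((hW.deriv x hxs t).clm_apply ((hφ.deriv x' hxs' t).sub (hφ.deriv x hxs t))))
    (fun t ht => by
      obtain ⟨m1, m2, m3⟩ := hz t ht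
      set z := φ t x
      set z' := φ t x'
      replace m1 := hsub m1
      replace m2 := hsub m2
      set q := ‖z' - z‖ with hq
      have hq0 : 0 ≤ q := norm_nonneg _
      have hqα : q * q ^ α = q ^ (1 + α) := by
        rcases hq0.eq_or_lt with h0 | h0
        · rw [← h0, zero_mul, Real.zero_rpow (by linarith)]
        · rw [Real.rpow_add h0, Real.rpow_one]
      have hqh : q ^ (1 + α) ≤ L ^ 2 * h ^ (1 + α) := by
        refine (Real.rpow_le_rpow hq0 m3 (by linarith)).trans ?_
        rw [Real.mul_rpow (by linarith) hh0]
        gcongr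
        rw [← Real.rpow_natCast]
        exact Real.rpow_le_rpow_of_exponent_le hL1 (by push_cast; linarith)
      -- The term `W ∘ Dv` in `derivCoeff` cancels the linear part of `v(z') - v(z)`, so that apart
      -- from the product of the increments of `A` and `w` only Taylor remainders of `F`, `A`, `v`
      -- and the unknown remainder itself are left.
      have e : F z' - A z' (w z') - (F z - A z (w z)) -
          ((derivSource A F w z - derivCoeff v A z (W z)) (z' - z) + W z (v z' - v z)) =
          (F z' - F z - fderiv ℝ F z (z' - z)) - (A z' - A z - fderiv ℝ A z (z' - z)) (w z')
          - fderiv ℝ A z (z' - z) (w z' - w z) - W z (v z' - v z - fderiv ℝ v z (z' - z))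
          - A z (w z' - w z - W z (z' - z)) := by
        simp only [sub_apply, map_sub, derivSource_apply, derivCoeff_apply]; abel
      have e1 : ‖F z' - F z - fderiv ℝ F z (z' - z)‖ ≤ N * q ^ (1 + α) :=
        hF.norm_taylor_le hα hUc hUo m1 m2
      have e2 : ‖(A z' - A z - fderiv ℝ A z (z' - z)) (w z')‖ ≤ N * q ^ (1 + α) * N := by
        refine (ContinuousLinearMap.le_opNorm _ _).trans ?_
        have := hw0.norm_le m2
        have := hA.norm_taylor_le hα hUc hUo m1 m2
        gcongr
      have e3 : ‖fderiv ℝ A z (z' - z) (w z' - w z)‖ ≤ N * q * (N * q ^ α) := by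
        refine ((fderiv ℝ A z).le_opNorm₂ _ _).trans ?_
        have := hw0.holder_zero m2 m1
        have : ‖fderiv ℝ A z‖ ≤ N :=
          ((holderBound_succ_iff (n := 0) hUo).1 hA).2.2.norm_le m1
        gcongr
      have e4 : ‖W z (v z' - v z - fderiv ℝ v z (z' - z))‖ ≤ N * (N * q ^ (1 + α)) := by
        refine (ContinuousLinearMap.le_opNorm _ _).trans ?_
        have := hW0.norm_le m1
        have := hv1.norm_taylor_le hα hUc hUo m1 m2
        gcongr
      have e5 := (A z).le_of_opNorm_le (hA.norm_le m1) (w z' - w z - W z (z' - z))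
      have e6 : (N + 3 * N * N) * q ^ (1 + α) ≤ ε * h ^ (1 + α) := by
        have := mul_le_mul_of_nonneg_left hqh (show 0 ≤ N + 3 * N * N by positivity)
        rw [hε]
        linarith
      have e7 : N * q * (N * q ^ α) = N * N * q ^ (1 + α) := by rw [← hqα]; ring
      rw [e]
      refine (norm_sub_le _ _).trans ((add_le_add ((norm_sub_le _ _).trans (add_le_add
        ((norm_sub_le _ _).trans (add_le_add (norm_sub_le _ _) le_rfl)) le_rfl)) le_rfl).trans ?_)
      linarith)
  simp only [zero_sub, neg_neg, hφ.zero x hxs, hφ.zero x' hxs'] at hG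
  rw [hW.init _ (hφ.mem x hxs _) hp0] at hG
  have hx0 : |x 0| ≤ ρ := (abs_apply_le x 0).trans (mem_slabBall.1 hx).2.le
  calc ‖w x' - w x - W x (x' - x)‖
      ≤ (I * h ^ (1 + α) + ε * h ^ (1 + α) * ρ) * Real.exp (N * ρ) := by
        refine hG.trans ?_
        gcongr
    _ = _ := by ring

end Derivative

/-! ### Hölder bounds for the data of the differentiated system -/

section DerivedData

variable {E : Type} [NormedAddCommGroup E] [NormedSpace ℝ E] {α N B C : ℝ} {U : Set E3} {n : ℕ}
  {v : E3 → E3} {A : E3 → E →L[ℝ] E} {F w₀ w : E3 → E}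

theorem HolderBound.fderiv {G : Type} [NormedAddCommGroup G] [NormedSpace ℝ G] {f : E3 → G}
    (h : HolderBound α U (n + 1) C f) (hUo : IsOpen U) :
    HolderBound α U n C (fderiv ℝ f) := ((holderBound_succ_iff hUo).1 h).2.2

set_option maxSynthPendingDepth 2 in
theorem HolderBound.derivCoeff (hUo : IsOpen U) (hv : HolderBound α U (n + 1) B v)
    (hA : HolderBound α U n N A) : HolderBound α U n (N + B) (derivCoeff v A) := by
  have h1 := hA.clm_comp hUo (ContinuousLinearMap.compL ℝ E3 E E)
    (ContinuousLinearMap.norm_compL_le ℝ E3 E E)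
  have h2 := (hv.fderiv hUo).clm_comp hUo (ContinuousLinearMap.compL ℝ E3 E3 E).flip
    ((ContinuousLinearMap.opNorm_flip _).le.trans (ContinuousLinearMap.norm_compL_le ℝ E3 E3 E))
  rw [one_mul] at h1 h2
  exact h1.add hUo h2

theorem HolderBound.derivSource (hα : 0 < α) (hα1 : α < 1) (hU : Convex ℝ U) (hUo : IsOpen U)
    (hA : HolderBound α U (n + 1) N A) (hF : HolderBound α U (n + 1) N F)
    (hw : HolderBound α U n C w) (hN : 0 ≤ N) (hC : 0 ≤ C) :
    HolderBound α U n (N + 2 * 4 ^ n * 1 * N * C) (derivSource A F w) := by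
  have h1 := (hA.fderiv hUo).bilin hα hα1 hU hUo
    (ContinuousLinearMap.flipₗᵢ ℝ E3 E E).toContinuousLinearEquiv.toContinuousLinearMap (b := 1)
    (ContinuousLinearMap.opNorm_le_bound _ zero_le_one fun f => by simp) hw hN hC
  exact (hF.fderiv hUo).sub hUo h1

theorem norm_coordProj_le (i : Fin 3) : ‖coordProj i‖ ≤ 1 :=
  ContinuousLinearMap.opNorm_le_bound _ zero_le_one fun x => by
    simpa using abs_apply_le x i

theorem HolderBound.clm_apply {G H : Type} [NormedAddCommGroup G] [NormedSpace ℝ G]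
    [NormedAddCommGroup H] [NormedSpace ℝ H] {T : E3 → G →L[ℝ] H} {f : E3 → G} {C₁ C₂ : ℝ}
    (hα : 0 < α) (hα1 : α < 1) (hU : Convex ℝ U) (hUo : IsOpen U)
    (hT : HolderBound α U n C₁ T) (hf : HolderBound α U n C₂ f) (hC₁ : 0 ≤ C₁) (hC₂ : 0 ≤ C₂) :
    HolderBound α U n (2 * 4 ^ n * 1 * C₁ * C₂) (fun x => T x (f x)) :=
  hT.bilin hα hα1 hU hUo (ContinuousLinearMap.id ℝ (G →L[ℝ] H))
    ContinuousLinearMap.norm_id_le hf hC₁ hC₂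

theorem HolderBound.derivInit (hα : 0 < α) (hα1 : α < 1) (hU : Convex ℝ U) (hUo : IsOpen U)
    (hv : HolderBound α U n B v) (hA : HolderBound α U n N A) (hF : HolderBound α U n N F)
    (h₀ : HolderBound α U n N w₀) (h₀' : HolderBound α U n N (_root_.fderiv ℝ w₀)) (hN : 0 ≤ N)
    (hB : 0 ≤ B) :
    HolderBound α U n (N + 1 * (N + 2 * 4 ^ n * 1 * N * N + 2 * 4 ^ n * 1 * N * B))
      (derivInit v A F w₀) := by
  have h1 := hA.clm_apply hα hα1 hU hUo h₀ hN hN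
  have h2 := h₀'.clm_apply hα hα1 hU hUo hv hN hB
  have h3 := ((hF.sub hUo h1).sub hUo h2).clm_comp hUo
    (ContinuousLinearMap.smulRightL ℝ E3 E (coordProj 0)) (b := 1)
    (ContinuousLinearMap.opNorm_le_bound _ zero_le_one fun x => by
      rw [ContinuousLinearMap.smulRightL_apply_apply, ContinuousLinearMap.norm_smulRight_apply]
      have := norm_coordProj_le 0
      gcongr)
  exact h₀'.add hUo h3

end DerivedData

/-! ### Regularity of every order by induction -/

section Induction

variable {α d B : ℝ} {n : ℕ} {v : E3 → E3} {φ : ℝ → E3 → E3}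

/-- `f` has a finite Hölder norm of order `n + α` in every bounded part of the slab. -/
def HolderBoundLoc {F : Type} [NormedAddCommGroup F] [NormedSpace ℝ F] (α d : ℝ) (n : ℕ)
    (f : E3 → F) : Prop :=
  ∀ ρ, ∃ N, 0 ≤ N ∧ HolderBound α (slabBall d ρ) n N f

theorem HolderBound.loc {F : Type} [NormedAddCommGroup F] [NormedSpace ℝ F] {f : E3 → F}
    (h : HolderBound α (slab d) n B f) (hB : 0 ≤ B) : HolderBoundLoc α d n f :=
  fun ρ => ⟨B, hB, h.mono le_rfl (slabBall_subset_slab d ρ)⟩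

theorem HolderBoundLoc.of_le {F : Type} [NormedAddCommGroup F] [NormedSpace ℝ F] {f : E3 → F}
    {m : ℕ} (h : HolderBoundLoc α d n f) (hα : 0 < α) (hα1 : α < 1) (hm : m ≤ n) :
    HolderBoundLoc α d m f := fun ρ => by
  obtain ⟨N, hN, h⟩ := h ρ
  exact ⟨_, by positivity, h.of_le hα hα1 (convex_slabBall _ _) (isOpen_slabBall _ _) hm⟩

theorem mem_slabBall_norm_add_one {x : E3} (hx : x ∈ slab d) : x ∈ slabBall d (‖x‖ + 1) :=
  mem_slabBall.2 ⟨hx, lt_add_one _⟩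

theorem HolderBoundLoc.continuousOn {F : Type} [NormedAddCommGroup F] [NormedSpace ℝ F]
    {f : E3 → F} (h : HolderBoundLoc α d n f) : ContinuousOn f (slab d) := by
  intro x hx
  obtain ⟨N, -, h⟩ := h (‖x‖ + 1)
  exact ((h.contDiffOn.continuousOn.continuousAt
    ((isOpen_slabBall _ _).mem_nhds (mem_slabBall_norm_add_one hx)))).continuousWithinAt

/-- The order `max n 1` ensures that the field is Lipschitz even at the base of the induction, `n =
0`; `2 ^ n` absorbs the descent from order `max n 1` to order 1. -/
theorem HolderBound.isUnitSpeed (hα : 0 < α) (hα1 : α < 1)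
    (h : HolderBound α (slab d) (max n 1) B v) (hB : 0 ≤ B) (hv1 : ∀ x ∈ slab d, v x 0 = 1) :
    IsUnitSpeed (slab d) (2 ^ n * B) v := by
  have h1 : HolderBound α (slab d) 1 (2 ^ n * B) v := by
    refine (h.of_le hα hα1 (convex_slab d) (isOpen_slab d) (le_max_right n 1)).mono ?_ subset_rfl
    gcongr
    · norm_num
    · omega
  obtain ⟨h0, h2, h3⟩ := (holderBound_succ_iff (n := 0) (isOpen_slab d)).1 h1
  exact ⟨by positivity, h0, fun x hx y hy => (convex_slab d).norm_image_sub_le_of_norm_fderiv_le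
    (fun z hz => h2.differentiableAt ((isOpen_slab d).mem_nhds hz)) (fun z hz => h3.norm_le hz)
    hy hx, hv1⟩

variable {E : Type} [NormedAddCommGroup E] [NormedSpace ℝ E]

theorem IsTransport.hasFDerivAt {A : E3 → E →L[ℝ] E} {F w₀ w : E3 → E} {W : E3 → E3 →L[ℝ] E}
    (hα : 0 < α) (hα1 : α < 1) (hφ : IsFlow (slab d) v φ) (hv : IsUnitSpeed (slab d) B v)
    (hv1 : HolderBoundLoc α d 1 v) (hA : HolderBoundLoc α d 1 A) (hF : HolderBoundLoc α d 1 F)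
    (h₀ : HolderBoundLoc α d 1 w₀) (hw : IsTransport (slab d) φ A F w₀ w)
    (hw0 : HolderBoundLoc α d 0 w)
    (hW : IsTransport (slab d) φ (derivCoeff v A) (derivSource A F w) (derivInit v A F w₀) W)
    (hW0 : HolderBoundLoc α d 0 W) {x : E3} (hx : x ∈ slab d) : HasFDerivAt w (W x) x := by
  set ρ := ‖x‖ + 1
  set R := (1 + B) * ((1 + B) * ρ)
  obtain ⟨N₁, p₁, b₁⟩ := hv1 R
  obtain ⟨N₂, p₂, b₂⟩ := hA R
  obtain ⟨N₃, p₃, b₃⟩ := hF R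
  obtain ⟨N₄, p₄, b₄⟩ := h₀ R
  obtain ⟨N₅, p₅, b₅⟩ := hw0 R
  obtain ⟨N₆, p₆, b₆⟩ := hW0 R
  have c₂ := b₂.pred hα hα1 (convex_slabBall _ _) (isOpen_slabBall _ _)
  have c₃ := b₃.pred hα hα1 (convex_slabBall _ _) (isOpen_slabBall _ _)
  set N := N₁ + 2 * N₂ + 2 * N₃ + N₄ + N₅ + N₆
  obtain ⟨C, hC⟩ := hw.norm_taylor_le hα hα1 (N := N) (ρ := ρ) (by positivity) hφ hv
    (b₁.mono (by linarith) subset_rfl) (b₂.mono (by linarith) subset_rfl)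
    (c₂.mono (by linarith) subset_rfl) (b₃.mono (by linarith) subset_rfl)
    (c₃.mono (by linarith) subset_rfl) (b₄.mono (by linarith) subset_rfl)
    (b₅.mono (by linarith) subset_rfl) hW (b₆.mono (by linarith) subset_rfl)
  refine hasFDerivAt_of_norm_taylor_le hα (C := C) ?_
  filter_upwards [(isOpen_slabBall d ρ).mem_nhds (mem_slabBall_norm_add_one hx),
    closedBall_mem_nhds x zero_lt_one] with y hy hy1
  exact hC x (mem_slabBall_norm_add_one hx) y hy (mem_closedBall_iff_norm.1 hy1)

/-- Hölder regularity of order `n + α` for linear transport systems, with bounds that are uniform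
in the data. -/
def TransportRegularity (α d : ℝ) (n : ℕ) : Prop :=
  ∀ ρ B : ℝ, 0 < ρ → 0 ≤ B →
    ∃ R, ρ ≤ R ∧ ∀ N, 0 ≤ N → ∃ C, 0 ≤ C ∧ ∀ (v : E3 → E3) (φ : ℝ → E3 → E3),
      IsFlow (slab d) v φ → (∀ x ∈ slab d, v x 0 = 1) →
      HolderBound α (slab d) (max n 1) B v →
      ∀ (E : Type) [NormedAddCommGroup E] [NormedSpace ℝ E] [CompleteSpace E]
        (A : E3 → E →L[ℝ] E) (F w₀ w : E3 → E),
      HolderBoundLoc α d n A → HolderBoundLoc α d n F → HolderBoundLoc α d n w₀ →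
      HolderBound α (slabBall d R) n N A → HolderBound α (slabBall d R) n N F →
      HolderBound α (slabBall d R) n N w₀ → IsTransport (slab d) φ A F w₀ w →
      HolderBound α (slabBall d ρ) n C w

theorem TransportRegularity.loc [CompleteSpace E] (H : TransportRegularity α d n) (hB : 0 ≤ B)
    (hφ : IsFlow (slab d) v φ) (hv1 : ∀ x ∈ slab d, v x 0 = 1)
    (hv : HolderBound α (slab d) (max n 1) B v) {A : E3 → E →L[ℝ] E} {F w₀ w : E3 → E}
    (hA : HolderBoundLoc α d n A) (hF : HolderBoundLoc α d n F) (h₀ : HolderBoundLoc α d n w₀)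
    (hw : IsTransport (slab d) φ A F w₀ w) : HolderBoundLoc α d n w := fun ρ => by
  obtain ⟨R, -, H⟩ := H (max ρ 1) B (by positivity) hB
  obtain ⟨N₁, p₁, b₁⟩ := hA R
  obtain ⟨N₂, p₂, b₂⟩ := hF R
  obtain ⟨N₃, p₃, b₃⟩ := h₀ R
  obtain ⟨C, hC, H⟩ := H (N₁ + N₂ + N₃) (by positivity)
  exact ⟨C, hC, (H v φ hφ hv1 hv E A F w₀ w hA hF h₀ (b₁.mono (by linarith) subset_rfl)
    (b₂.mono (by linarith) subset_rfl) (b₃.mono (by linarith) subset_rfl) hw).mono le_rfl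
    (slabBall_mono d (le_max_left _ _))⟩

theorem HolderBoundLoc.derivSource {A : E3 → E →L[ℝ] E} {F w : E3 → E} (hα : 0 < α) (hα1 : α < 1)
    (hA : HolderBoundLoc α d (n + 1) A) (hF : HolderBoundLoc α d (n + 1) F)
    (hw : HolderBoundLoc α d n w) : HolderBoundLoc α d n (derivSource A F w) := fun ρ => by
  obtain ⟨N₁, p₁, b₁⟩ := hA ρ
  obtain ⟨N₂, p₂, b₂⟩ := hF ρ
  obtain ⟨N₃, p₃, b₃⟩ := hw ρ
  exact ⟨_, by positivity, (b₁.mono (le_add_of_nonneg_right p₂) subset_rfl).derivSource hα hα1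
    (convex_slabBall _ _) (isOpen_slabBall _ _) (b₂.mono (le_add_of_nonneg_left p₁) subset_rfl)
    b₃ (by positivity) p₃⟩

theorem HolderBoundLoc.derivInit {A : E3 → E →L[ℝ] E} {F w₀ : E3 → E} (hα : 0 < α) (hα1 : α < 1)
    (hv : HolderBoundLoc α d n v) (hA : HolderBoundLoc α d n A) (hF : HolderBoundLoc α d n F)
    (h₀ : HolderBoundLoc α d (n + 1) w₀) : HolderBoundLoc α d n (derivInit v A F w₀) := fun ρ => by
  obtain ⟨N₀, p₀, b₀⟩ := hv ρ
  obtain ⟨N₁, p₁, b₁⟩ := hA ρ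
  obtain ⟨N₂, p₂, b₂⟩ := hF ρ
  obtain ⟨N₃, p₃, b₃⟩ := h₀ ρ
  have hUo := isOpen_slabBall d ρ
  set N := N₁ + N₂ + 2 * N₃
  exact ⟨_, by positivity, HolderBound.derivInit (N := N) hα hα1 (convex_slabBall _ _) hUo b₀
    (b₁.mono (by linarith) subset_rfl) (b₂.mono (by linarith) subset_rfl)
    ((b₃.pred hα hα1 (convex_slabBall _ _) hUo).mono (by linarith) subset_rfl)
    ((b₃.fderiv hUo).mono (by linarith) subset_rfl) (by positivity) p₀⟩

theorem HolderBoundLoc.derivCoeff {A : E3 → E →L[ℝ] E} (hv : HolderBoundLoc α d (n + 1) v)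
    (hA : HolderBoundLoc α d n A) : HolderBoundLoc α d n (derivCoeff v A) := fun ρ => by
  obtain ⟨N₀, p₀, b₀⟩ := hv ρ
  obtain ⟨N₁, p₁, b₁⟩ := hA ρ
  exact ⟨_, by positivity, b₀.derivCoeff (isOpen_slabBall _ _) b₁⟩

/-- The differentiated system has data of order `n`, as it involves one derivative of the given data
and `w` itself, which has order `n` by the hypothesis. The same hypothesis, with `E3 →L[ℝ] E` in
place of `E`, then bounds its solution, which is the derivative of `w`. The qualitative local bounds
are carried along because the differentiated system has to be solved in the whole slab. -/
theorem TransportRegularity.succ (hα : 0 < α) (hα1 : α < 1) (H : TransportRegularity α d n) :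
    TransportRegularity α d (n + 1) := by
  intro ρ B hρ hB
  have hB2 : 0 ≤ 2 * B := by positivity
  -- Both radii are fixed before `N` is known. This is essential: the bound on the data of the
  -- second application involves the constant `C₂` from the first.
  obtain ⟨R₁, hR₁, H₁⟩ := H ρ (2 * B) hρ hB2
  obtain ⟨R₂, hR₂, H₂⟩ := H R₁ (2 * B) (hρ.trans_le hR₁) hB2
  refine ⟨R₂, hR₁.trans hR₂, fun N hN => ?_⟩
  obtain ⟨C₂, hC₂, H₂⟩ := H₂ (2 * N) (by positivity)
  set K₁ := 2 * N + B
  set K₂ := N + 2 * 4 ^ n * 1 * N * C₂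
  set K₃ := 2 * N + 1 * (2 * N + 2 * 4 ^ n * 1 * (2 * N) * (2 * N) +
    2 * 4 ^ n * 1 * (2 * N) * (2 * B))
  have hK₁ : 0 ≤ K₁ := by positivity
  have hK₂ : 0 ≤ K₂ := by positivity
  have hK₃ : 0 ≤ K₃ := by positivity
  obtain ⟨C₁, hC₁, H₁⟩ := H₁ (K₁ + K₂ + K₃) (by positivity)
  refine ⟨C₁ + C₂, by positivity, fun v φ hφ hv1 hv E _ _ _ A F w₀ w hA hF h₀ bA bF b₀ hw => ?_⟩
  have hso := isOpen_slab d
  have hsc := convex_slab d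
  rw [max_eq_left (by omega : 1 ≤ n + 1)] at hv
  have hvn : HolderBound α (slab d) n (2 * B) v := hv.pred hα hα1 hsc hso
  have hvn' : HolderBound α (slab d) (max n 1) (2 * B) v := by
    rcases Nat.eq_zero_or_pos n with rfl | hn
    · exact hv.mono (by linarith) subset_rfl
    · rwa [max_eq_left hn]
  have hu := hvn'.isUnitSpeed hα hα1 hB2 hv1
  have hle : n ≤ n + 1 := Nat.le_succ n
  have lA := hA.of_le hα hα1 hle
  have lF := hF.of_le hα hα1 hle
  have l₀ := h₀.of_le hα hα1 hle
  have lw : HolderBoundLoc α d n w := H.loc hB2 hφ hv1 hvn' lA lF l₀ hw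
  have lA' := HolderBoundLoc.derivCoeff (hv.loc hB) lA
  have lF' := hA.derivSource hα hα1 hF lw
  have l₀' := HolderBoundLoc.derivInit hα hα1 (hvn.loc hB2) lA lF h₀
  obtain ⟨W, hW⟩ := exists_isTransport hφ hu lA'.continuousOn lF'.continuousOn
    (derivInit v A F w₀)
  have lW : HolderBoundLoc α d n W := H.loc hB2 hφ hv1 hvn' lA' lF' l₀' hW
  have hle1 : 1 ≤ n + 1 := by omega
  have hderiv : ∀ x ∈ slab d, HasFDerivAt w (W x) x := fun x hx =>
    hw.hasFDerivAt hα hα1 hφ hu ((hv.loc hB).of_le hα hα1 hle1) (hA.of_le hα hα1 hle1)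
      (hF.of_le hα hα1 hle1) (h₀.of_le hα hα1 hle1) (lw.of_le hα hα1 (Nat.zero_le n)) hW
      (lW.of_le hα hα1 (Nat.zero_le n)) hx
  have o₁ := isOpen_slabBall d R₁
  have c₁ := convex_slabBall d R₁
  have o₂ := isOpen_slabBall d R₂
  have c₂ := convex_slabBall d R₂
  have bw : HolderBound α (slabBall d R₁) n C₂ w :=
    H₂ v φ hφ hv1 hvn' E A F w₀ w lA lF l₀ (bA.pred hα hα1 c₂ o₂) (bF.pred hα hα1 c₂ o₂)
      (b₀.pred hα hα1 c₂ o₂) hw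
  have s₁ := slabBall_mono d hR₂
  have s₀ := slabBall_subset_slab d R₁
  have dA := bA.mono le_rfl s₁
  have dF := bF.mono le_rfl s₁
  have d₀ := b₀.mono le_rfl s₁
  have bW : HolderBound α (slabBall d ρ) n C₁ W := by
    refine H₁ v φ hφ hv1 hvn' _ _ _ _ W lA' lF' l₀' ?_ ?_ ?_ hW
    · exact ((hv.mono le_rfl s₀).derivCoeff o₁ (dA.pred hα hα1 c₁ o₁)).mono
        (by linarith) subset_rfl
    · exact (dA.derivSource hα hα1 c₁ o₁ dF bw hN hC₂).mono (by linarith) subset_rfl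
    · exact ((hvn.mono le_rfl s₀).derivInit hα hα1 c₁ o₁ (dA.pred hα hα1 c₁ o₁)
        (dF.pred hα hα1 c₁ o₁) (d₀.pred hα hα1 c₁ o₁)
        ((d₀.fderiv o₁).mono (by linarith) subset_rfl) (by positivity) hB2).mono
        (by linarith) subset_rfl
  have s : slabBall d ρ ⊆ slab d := slabBall_subset_slab d ρ
  refine (holderBound_succ_iff (isOpen_slabBall d ρ)).2 ⟨fun x hx => ?_, fun x hx => ?_, ?_⟩
  · exact (bw.norm_le (slabBall_mono d hR₁ hx)).trans (by linarith)
  · exact (hderiv x (s hx)).differentiableAt.differentiableWithinAt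
  · exact (bW.mono (by linarith) subset_rfl).congr (isOpen_slabBall d ρ)
      fun x hx => (hderiv x (s hx)).fderiv.symm

theorem transportRegularity (hα : 0 < α) (hα1 : α < 1) (d : ℝ) (n : ℕ) :
    TransportRegularity α d n := by
  induction n with
  | zero =>
    intro ρ B hρ hB
    refine ⟨(1 + 2 ^ 0 * B) * ((1 + 2 ^ 0 * B) * ((1 + 2 ^ 0 * B) * ρ)), ?_, fun N hN => ?_⟩
    · have h1 : 1 ≤ 1 + 2 ^ 0 * B := by linarith
      have h2 : ∀ r : ℝ, 0 < r → r ≤ (1 + 2 ^ 0 * B) * r := fun r hr =>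
        le_mul_of_one_le_left hr.le h1
      exact (h2 _ hρ).trans ((h2 _ (by positivity)).trans (h2 _ (by positivity)))
    obtain ⟨C, hC0, hC⟩ := exists_holderBound_zero hα hα1 d (2 ^ 0 * B) hρ hN
    exact ⟨C, hC0, fun v φ hφ hv1 hv E _ _ _ A F w₀ w _ _ _ hA hF h₀ hw =>
      hC v φ hφ (hv.isUnitSpeed hα hα1 hB hv1) E A F w₀ w hA hF h₀ hw⟩
  | succ n ih => exact ih.succ hα hα1

end Induction

/-! ### Hölder norms and quantitative Hölder bounds -/

section HolderNorm

variable {F : Type} [NormedAddCommGroup F] [NormedSpace ℝ F] {s α C : ℝ} {U V : Set E3}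
  {n : ℕ} {f : E3 → F}

theorem HolderBound.of_holderNorm_le (hf : ContDiffOn ℝ ⌊s⌋₊ f U) (hC : 0 ≤ C)
    (h : holderNorm s U f ≤ ENNReal.ofReal C) : HolderBound (Int.fract s) U ⌊s⌋₊ C f := by
  refine ⟨hf, fun j hj x hx => ?_, fun x hx y hy => ?_⟩
  · have h1 : ‖iteratedFDeriv ℝ j f x‖ₑ ≤ ENNReal.ofReal C := by
      refine le_trans ?_ ((le_add_of_nonneg_right zero_le).trans h)
      exact le_iSup₂_of_le j hj (le_iSup₂_of_le x hx le_rfl)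
    rwa [← ofReal_norm, ENNReal.ofReal_le_ofReal_iff hC] at h1
  · rcases eq_or_ne x y with rfl | hxy
    · simp only [sub_self, norm_zero]
      positivity
    have h1 : ‖iteratedFDeriv ℝ ⌊s⌋₊ f x - iteratedFDeriv ℝ ⌊s⌋₊ f y‖ₑ / edist x y ^ Int.fract s ≤
        ENNReal.ofReal C := by
      refine le_trans ?_ ((le_add_of_nonneg_left zero_le).trans h)
      exact le_iSup₂_of_le x hx (le_iSup₂_of_le y hy (le_iSup_of_le hxy le_rfl))
    have h0 : 0 < ‖x - y‖ := norm_pos_iff.2 (sub_ne_zero.2 hxy)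
    rw [edist_dist, dist_eq_norm, ENNReal.ofReal_rpow_of_pos h0, ← ofReal_norm,
      ← ENNReal.ofReal_div_of_pos (by positivity), ENNReal.ofReal_le_ofReal_iff hC,
      div_le_iff₀ (by positivity)] at h1
    exact h1

/-- The norm is a sum of a supremum and a seminorm, each at most `C`; a factor 2 is thus lost
whenever a bound is turned back into a norm. -/
theorem HolderBound.holderNorm_le (h : HolderBound (Int.fract s) U ⌊s⌋₊ C f) :
    holderNorm s U f ≤ ENNReal.ofReal C + ENNReal.ofReal C := by
  refine add_le_add (iSup₂_le fun j hj => iSup₂_le fun x hx => ?_)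
    (iSup₂_le fun x hx => iSup₂_le fun y hy => iSup_le fun hxy => ?_)
  · rw [← ofReal_norm]
    exact ENNReal.ofReal_le_ofReal (h.bound j hj x hx)
  · have h0 : 0 < ‖x - y‖ := norm_pos_iff.2 (sub_ne_zero.2 hxy)
    rw [edist_dist, dist_eq_norm, ENNReal.ofReal_rpow_of_pos h0, ← ofReal_norm,
      ← ENNReal.ofReal_div_of_pos (by positivity)]
    exact ENNReal.ofReal_le_ofReal ((div_le_iff₀ (by positivity)).2 (h.holder x hx y hy))

theorem holderNorm_mono (s : ℝ) (f : E3 → F) (h : V ⊆ U) : holderNorm s V f ≤ holderNorm s U f := by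
  refine add_le_add (iSup₂_mono fun j hj => ?_) ?_
  · exact iSup₂_le fun x hx => le_iSup₂_of_le x (h hx) le_rfl
  · exact iSup₂_le fun x hx => iSup₂_le fun y hy =>
      le_iSup₂_of_le x (h hx) (le_iSup₂_of_le y (h hy) le_rfl)

theorem MemHolder.mono (hf : MemHolder s U f) (h : V ⊆ U) : MemHolder s V f where
  continuousOn := hf.continuousOn.mono (closure_mono h)
  contDiffOn := hf.contDiffOn.mono h
  extends_closure j hj := by
    obtain ⟨D, h1, h2⟩ := hf.extends_closure j hj
    exact ⟨D, h1.mono (closure_mono h), h2.mono h⟩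
  norm_lt_top := (holderNorm_mono s f h).trans_lt hf.norm_lt_top

theorem MemHolder.holderBound (hf : MemHolder s U f) :
    HolderBound (Int.fract s) U ⌊s⌋₊ (holderNorm s U f).toReal f :=
  HolderBound.of_holderNorm_le hf.contDiffOn ENNReal.toReal_nonneg
    (by rw [ENNReal.ofReal_toReal hf.norm_lt_top.ne])

theorem exists_tendsto_of_holder {X : Type*} [NormedAddCommGroup X] [CompleteSpace X]
    {D : E3 → X} (hα : 0 < α)
    (h : ∀ x ∈ U, ∀ y ∈ U, ‖D x - D y‖ ≤ C * ‖x - y‖ ^ α) {x : E3} (hx : x ∈ closure U) :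
    ∃ y, Filter.Tendsto D (nhdsWithin x U) (nhds y) := by
  have : (nhdsWithin x U).NeBot := mem_closure_iff_nhdsWithin_neBot.1 hx
  refine cauchy_map_iff_exists_tendsto.1 (Metric.cauchy_iff.2 ⟨inferInstance, fun ε hε => ?_⟩)
  obtain ⟨δ, hδ, hlt⟩ : ∃ δ > 0, |C| * (2 * δ) ^ α < ε := by
    have h0 : Filter.Tendsto (fun t : ℝ => |C| * (2 * t) ^ α) (nhdsWithin 0 (Ioi 0)) (nhds 0) := by
      have : ContinuousAt (fun t : ℝ => |C| * (2 * t) ^ α) 0 :=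
        continuousAt_const.mul (ContinuousAt.rpow_const (by fun_prop) (Or.inr hα.le))
      simpa [Real.zero_rpow hα.ne'] using this.tendsto.mono_left nhdsWithin_le_nhds
    obtain ⟨δ, h1, h2⟩ := ((h0.eventually_lt_const hε).and self_mem_nhdsWithin).exists
    exact ⟨δ, h2, h1⟩
  refine ⟨D '' (ball x δ ∩ U), Filter.image_mem_map (inter_comm U _ ▸ inter_mem_nhdsWithin U (ball_mem_nhds x hδ)), ?_⟩
  rintro _ ⟨y, hy, rfl⟩ _ ⟨z, hz, rfl⟩
  rw [dist_eq_norm]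
  refine lt_of_le_of_lt ((h y hy.2 z hz.2).trans ?_) hlt
  have hd : ‖y - z‖ ≤ 2 * δ := by
    rw [← dist_eq_norm]
    linarith [dist_triangle_right y z x, mem_ball.1 hy.1, mem_ball.1 hz.1]
  gcongr
  exact le_abs_self C

theorem exists_continuousOn_closure_of_tendsto {X : Type*} [NormedAddCommGroup X]
    {D : E3 → X} (hD : ContinuousOn D U)
    (h : ∀ x ∈ closure U, ∃ y, Filter.Tendsto D (nhdsWithin x U) (nhds y)) :
    ∃ D' : E3 → X, ContinuousOn D' (closure U) ∧ EqOn D' D U :=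
  ⟨extendFrom U D, continuousOn_extendFrom subset_rfl h,
    fun x hx => extendFrom_eq (subset_closure hx) (hD x hx)⟩

/-- By convexity the derivatives of lower order are Hölder as well; all of them are therefore
uniformly continuous and extend to the closure. -/
theorem HolderBound.memHolder [CompleteSpace F] (hs : 0 < Int.fract s) (hU : Convex ℝ U)
    (hUo : IsOpen U) (h : HolderBound (Int.fract s) U ⌊s⌋₊ C f)
    (hc : ContinuousOn f (closure U)) : MemHolder s U f where
  continuousOn := hc
  contDiffOn := h.contDiffOn
  extends_closure j hj := by
    have hj' := h.of_le hs (Int.fract_lt_one s) hU hUo hj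
    exact exists_continuousOn_closure_of_tendsto (continuousOn_of_holder hs hj'.holder)
      fun x hx => exists_tendsto_of_holder hs hj'.holder hx
  norm_lt_top := h.holderNorm_le.trans_lt (by simp)

end HolderNorm

/-! ### Local Hölder classes on the slab and its closure -/

section Loc

variable {F : Type} [NormedAddCommGroup F] [NormedSpace ℝ F] {s d : ℝ} {f : E3 → F}

theorem MemHolderLoc.memHolder_slabBall (hf : MemHolderLoc s (slab d) f) (ρ : ℝ) :
    MemHolder s (slabBall d ρ) f :=
  hf _ (isOpen_slabBall d ρ) (isBounded_ball.subset inter_subset_right) (slabBall_subset_slab d ρ)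

theorem MemHolderLoc.holderBoundLoc (hf : MemHolderLoc s (slab d) f) :
    HolderBoundLoc (Int.fract s) d ⌊s⌋₊ f := fun ρ =>
  ⟨_, ENNReal.toReal_nonneg, (hf.memHolder_slabBall ρ).holderBound⟩

theorem HolderBoundLoc.memHolderLoc [CompleteSpace F] (hs : 0 < Int.fract s)
    (hf : HolderBoundLoc (Int.fract s) d ⌊s⌋₊ f) (hc : ContinuousOn f (closure (slab d))) :
    MemHolderLoc s (slab d) f := by
  intro U _ hU hUs
  obtain ⟨ρ, hρ⟩ := hU.subset_ball 0
  obtain ⟨N, -, hN⟩ := hf ρ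
  exact (hN.memHolder hs (convex_slabBall d ρ) (isOpen_slabBall d ρ)
    (hc.mono (closure_mono (slabBall_subset_slab d ρ)))).mono (subset_inter hUs hρ)

theorem MemHolder.loc (hf : MemHolder s (slab d) f) : MemHolderLoc s (slab d) f :=
  fun _ _ _ hU => hf.mono hU

theorem nhdsWithin_slabBall (x : E3) :
    nhdsWithin x (slabBall d (‖x‖ + 1)) = nhdsWithin x (slab d) :=
  nhdsWithin_inter_of_mem' (mem_nhdsWithin_of_mem_nhds
    (isOpen_ball.mem_nhds (by simp)))

theorem mem_closure_slabBall {x : E3} (hx : x ∈ closure (slab d)) :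
    x ∈ closure (slabBall d (‖x‖ + 1)) := by
  rw [mem_closure_iff_nhdsWithin_neBot, nhdsWithin_slabBall]
  exact mem_closure_iff_nhdsWithin_neBot.1 hx

theorem HolderBoundLoc.exists_tendsto {α : ℝ} {n : ℕ} [CompleteSpace F] (hα : 0 < α) (hα1 : α < 1)
    (hf : HolderBoundLoc α d n f) {x : E3} (hx : x ∈ closure (slab d)) :
    ∃ y, Filter.Tendsto f (nhdsWithin x (slab d)) (nhds y) := by
  obtain ⟨N, -, h⟩ := hf.of_le hα hα1 (Nat.zero_le n) (‖x‖ + 1)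
  rw [← nhdsWithin_slabBall]
  exact exists_tendsto_of_holder hα (fun x hx y hy => h.holder_zero hx hy)
    (mem_closure_slabBall hx)

theorem MemHolderLoc.continuousOn (hf : MemHolderLoc s (slab d) f) :
    ContinuousOn f (closure (slab d)) := by
  intro x hx
  have h := (hf.memHolder_slabBall (‖x‖ + 1)).continuousOn x (mem_closure_slabBall hx)
  refine h.mono_of_mem_nhdsWithin ?_
  have : closure (slab d) ∩ ball x 1 ⊆ closure (slabBall d (‖x‖ + 1)) := by
    refine (IsOpen.closure_inter isOpen_ball).trans (closure_mono ?_)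
    rintro y ⟨hy, hyx⟩
    refine mem_slabBall.2 ⟨hy, ?_⟩
    linarith [norm_sub_norm_le y x, mem_ball_iff_norm.1 hyx]
  exact Filter.mem_of_superset (inter_mem_nhdsWithin _ (ball_mem_nhds x one_pos)) this

theorem MemHolderLoc.differentiableAt (hf : MemHolderLoc s (slab d) f) (hs : 1 ≤ ⌊s⌋₊) {x : E3}
    (hx : x ∈ slab d) : DifferentiableAt ℝ f x :=
  ((hf.memHolder_slabBall (‖x‖ + 1)).contDiffOn.contDiffAt
    ((isOpen_slabBall _ _).mem_nhds (mem_slabBall_norm_add_one hx))).differentiableAt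
    (by exact_mod_cast (Nat.one_le_iff_ne_zero.1 hs))

end Loc

/-! ### Products and inverses -/

section Algebra

variable {F : Type} [NormedAddCommGroup F] [NormedSpace ℝ F] {α C C₁ C₂ δ : ℝ} {U : Set E3}
  {n : ℕ} {f : E3 → F} {a : E3 → ℝ}

theorem HolderBound.smul (hα : 0 < α) (hα1 : α < 1) (hU : Convex ℝ U) (hUo : IsOpen U)
    (ha : HolderBound α U n C₁ a) (hf : HolderBound α U n C₂ f) (hC₁ : 0 ≤ C₁) (hC₂ : 0 ≤ C₂) :
    HolderBound α U n (2 * 4 ^ n * 1 * C₁ * C₂) (fun x => a x • f x) :=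
  ha.bilin hα hα1 hU hUo (ContinuousLinearMap.lsmul ℝ ℝ) ContinuousLinearMap.opNorm_lsmul_le hf
    hC₁ hC₂

/-- The derivative `-a⁻¹ a⁻¹ Da` involves only `a⁻¹` of one order less, which is what the induction
provides. -/
theorem exists_holderBound_inv (hα : 0 < α) (hα1 : α < 1) (n : ℕ) (hC : 0 ≤ C) (hδ : 0 < δ) :
    ∃ C', 0 ≤ C' ∧ ∀ (U : Set E3) (a : E3 → ℝ), Convex ℝ U → IsOpen U → HolderBound α U n C a →
      (∀ x ∈ U, δ ≤ a x) → HolderBound α U n C' (fun x => (a x)⁻¹) := by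
  have hinv : ∀ t : ℝ, δ ≤ t → ‖t⁻¹‖ ≤ δ⁻¹ := fun t ht => by
    have : 0 < t := hδ.trans_le ht
    rw [Real.norm_of_nonneg (by positivity)]
    gcongr
  induction n generalizing C with
  | zero =>
    refine ⟨δ⁻¹ + δ⁻¹ * δ⁻¹ * C, by positivity, fun U a hU hUo ha hδa => ?_⟩
    refine HolderBound.of_zero hα (fun x hx => (hinv _ (hδa x hx)).trans
      (le_add_of_nonneg_right (by positivity))) fun x hx y hy => ?_
    have hx' := hδ.trans_le (hδa x hx)
    have hy' := hδ.trans_le (hδa y hy)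
    have e : (a x)⁻¹ - (a y)⁻¹ = (a x)⁻¹ * (a y)⁻¹ * (a y - a x) := by field_simp
    rw [e, norm_mul, norm_mul, norm_sub_rev (a y)]
    calc _ ≤ δ⁻¹ * δ⁻¹ * (C * ‖x - y‖ ^ α) := by
          gcongr
          · exact hinv _ (hδa x hx)
          · exact hinv _ (hδa y hy)
          · exact ha.holder_zero hx hy
      _ ≤ _ := by
          rw [← mul_assoc]
          gcongr
          exact le_add_of_nonneg_left (by positivity)
  | succ n ih =>
    obtain ⟨K, hK, ih⟩ := ih (C := 2 * C) (by positivity)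
    set K₂ := 2 * 4 ^ n * 1 * K * (2 * 4 ^ n * 1 * K * C) with hK₂
    refine ⟨δ⁻¹ + K₂, by positivity, fun U a hU hUo ha hδa => ?_⟩
    have h1 := ih U a hU hUo (ha.pred hα hα1 hU hUo) hδa
    obtain ⟨-, h2, h3⟩ := (holderBound_succ_iff hUo).1 ha
    have hd : ∀ x ∈ U, HasFDerivAt (fun x => (a x)⁻¹)
        (-((a x)⁻¹ • ((a x)⁻¹ • fderiv ℝ a x))) x := by
      intro x hx
      have hx' := hδ.trans_le (hδa x hx)
      have := (hasDerivAt_inv hx'.ne').comp_hasFDerivAt x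
        (h2.differentiableAt (hUo.mem_nhds hx)).hasFDerivAt
      convert! this using 1
      rw [smul_smul, neg_smul]
      congr 2
      field_simp
    refine (holderBound_succ_iff hUo).2 ⟨fun x hx => (hinv _ (hδa x hx)).trans
      (le_add_of_nonneg_right (by positivity)),
      fun x hx => (hd x hx).differentiableAt.differentiableWithinAt, ?_⟩
    have h4 := (h1.smul hα hα1 hU hUo (h1.smul hα hα1 hU hUo h3 hK hC) hK (by positivity)).neg hUo
    exact (h4.mono (le_add_of_nonneg_left (by positivity)) subset_rfl).congr hUo
      fun x hx => (hd x hx).fderiv.symm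

/-- Allows normalization by a bound `c'` that is strictly positive, even when the actual bound `c`
is 0. -/
theorem HolderBound.of_forall_gt {c K : ℝ} (h : ∀ c' > c, HolderBound α U n (K * c') f) :
    HolderBound α U n (K * c) f := by
  have key : ∀ a b : ℝ, (∀ c' > c, a ≤ K * c' * b) → a ≤ K * c * b := by
    intro a b hab
    have hc : ContinuousWithinAt (fun c' => K * c' * b) (Ioi c) c := by fun_prop
    exact ge_of_tendsto hc.tendsto (Filter.eventually_of_mem self_mem_nhdsWithin hab)
  have h1 := h (c + 1) (by linarith)
  refine ⟨h1.contDiffOn, fun j hj x hx => ?_, fun x hx y hy => ?_⟩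
  · have := key _ 1 fun c' hc' => by simpa using (h c' hc').bound j hj x hx
    simpa using this
  · exact key _ _ fun c' hc' => (h c' hc').holder x hx y hy

end Algebra

/-! ### The transport problem -/

section Problem

variable {d l₁ l₂ δ s : ℝ} {u : E3 → E3} {f g g' : E3 → ℝ} {φ : ℝ → E3 → E3}

theorem fract_pos_of_ne (hs : ∀ n : ℤ, s ≠ n) : 0 < Int.fract s := Int.fract_pos.2 (hs _)

theorem one_le_floor (hs : 1 < s) : 1 ≤ ⌊s⌋₊ := Nat.le_floor (by exact_mod_cast hs.le)

/-- The field `u / u₁`, whose flow advances the first coordinate at unit speed. -/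
def velocity (u : E3 → E3) (x : E3) : E3 := (u x 0)⁻¹ • u x

theorem velocity_apply (u : E3 → E3) (x : E3) (i : Fin 3) :
    velocity u x i = (u x 0)⁻¹ * u x i := rfl

theorem setU_pos (hδ : 0 < δ) (hu : u ∈ setU d l₁ l₂ δ s) {x : E3} (hx : x ∈ closure (slab d)) :
    0 < u x 0 := hδ.trans (hu.2.2 x hx)

theorem velocity_apply_zero (hδ : 0 < δ) (hu : u ∈ setU d l₁ l₂ δ s) {x : E3}
    (hx : x ∈ slab d) : velocity u x 0 = 1 :=
  inv_mul_cancel₀ (setU_pos hδ hu (subset_closure hx)).ne'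

theorem exists_velocity_holderBound (d l₁ l₂ : ℝ) (hδ : 0 < δ) (hs : ∀ n : ℤ, s ≠ n) (M : ℝ≥0) :
    ∃ B K : ℝ, 0 ≤ B ∧ 0 ≤ K ∧ ∀ u ∈ setU d l₁ l₂ δ s, holderNorm s (slab d) u ≤ M →
      HolderBound (Int.fract s) (slab d) ⌊s⌋₊ B (velocity u) ∧
      HolderBound (Int.fract s) (slab d) ⌊s⌋₊ K (fun x => (u x 0)⁻¹) := by
  have hα := fract_pos_of_ne hs
  have hα1 := Int.fract_lt_one s
  obtain ⟨K, hK, H⟩ := exists_holderBound_inv hα hα1 ⌊s⌋₊ (C := 1 * M) (by positivity) hδ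
  refine ⟨2 * 4 ^ ⌊s⌋₊ * 1 * K * M, K, by positivity, hK, fun u hu huM => ?_⟩
  · have hso := isOpen_slab d
    have h1 : HolderBound (Int.fract s) (slab d) ⌊s⌋₊ M u :=
      HolderBound.of_holderNorm_le hu.1.1.contDiffOn M.2 (by simpa using huM)
    have h2 := H _ _ (convex_slab d) hso (h1.clm_comp hso (coordProj 0) (norm_coordProj_le 0))
      fun x hx => (hu.2.2 x (subset_closure hx)).le
    exact ⟨h2.smul hα hα1 (convex_slab d) hso h1 hK M.2, h2⟩

theorem continuousOn_velocity (hδ : 0 < δ) (hu : u ∈ setU d l₁ l₂ δ s) :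
    ContinuousOn (velocity u) (closure (slab d)) := by
  have h1 := hu.1.1.continuousOn
  exact (((coordProj 0).continuous.comp_continuousOn h1).inv₀
    fun x hx => (setU_pos hδ hu hx).ne').smul h1

theorem exists_norm_bound (hu : u ∈ setU d l₁ l₂ δ s) :
    ∃ M : ℝ≥0, holderNorm s (slab d) u ≤ M :=
  ⟨_, (ENNReal.coe_toNNReal hu.1.1.norm_lt_top.ne).ge⟩

theorem exists_flow_velocity (hd : 0 < d) (hδ : 0 < δ) (hs : 1 < s) (hn : ∀ n : ℤ, s ≠ n)
    (hu : u ∈ setU d l₁ l₂ δ s) : ∃ φ, IsFlow (slab d) (velocity u) φ := by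
  obtain ⟨M, hM⟩ := exists_norm_bound hu
  obtain ⟨B, K, hB, -, H⟩ := exists_velocity_holderBound d l₁ l₂ hδ hn M
  have h1 := (H u hu hM).1
  rw [← max_eq_left (one_le_floor hs)] at h1
  have h2 := h1.isUnitSpeed (fract_pos_of_ne hn) (Int.fract_lt_one s) hB
    fun x hx => velocity_apply_zero hδ hu hx
  refine exists_flow hd (K := ⟨_, h2.nonneg⟩)
    (LipschitzOnWith.closure (continuousOn_velocity hδ hu) ?_) fun x hx => ?_
  · exact LipschitzOnWith.of_dist_le_mul fun x hx y hy => by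
      rw [dist_eq_norm, dist_eq_norm]
      exact h2.lipschitz x hx y hy
  · rw [velocity_apply, hu.2.1 x hx, mul_zero]

theorem inner_gradient_eq (u : E3) (g : E3 → ℝ) (x : E3) :
    inner ℝ u (gradient g x) = fderiv ℝ g x u := by simp

theorem Solves.isTransport (hφ : IsFlow (slab d) (velocity u) φ) (hg : ∀ x ∈ slab d, DifferentiableAt ℝ g x)
    (h : Solves d u f g) : IsTransport (slab d) φ (fun _ => (0 : ℝ →L[ℝ] ℝ))
      (fun x => (u x 0)⁻¹ • f x) (fun _ => 0) g := by
  refine ⟨fun x hx t => ?_, fun x hx hx0 => h.2 x (subset_closure hx) hx0⟩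
  have hm := hφ.mem x hx t
  have h1 := (hg _ hm).hasFDerivAt.comp_hasDerivAt t (hφ.deriv x hx t)
  have h2 := h.1 _ hm
  rw [inner_gradient_eq] at h2
  rw [velocity, map_smul, h2] at h1
  simp only [zero_apply, sub_zero]
  exact h1

theorem IsTransport.solves (hδ : 0 < δ) (hu : u ∈ setU d l₁ l₂ δ s)
    (hφ : IsFlow (slab d) (velocity u) φ) (hg : ∀ x ∈ slab d, DifferentiableAt ℝ g x)
    (h : IsTransport (slab d) φ (fun _ => (0 : ℝ →L[ℝ] ℝ)) (fun x => (u x 0)⁻¹ • f x)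
      (fun _ => 0) g) {x : E3} (hx : x ∈ slab d) : inner ℝ (u x) (gradient g x) = f x := by
  have h0 := hφ.zero x hx
  have hm := hφ.mem x hx 0
  have h1 := (hg _ hm).hasFDerivAt.comp_hasDerivAt 0 (hφ.deriv x hx 0)
  have h2 := h1.unique (h.deriv x hx 0)
  rw [h0, velocity, map_smul] at h2
  simp only [zero_apply, sub_zero, smul_eq_mul] at h2
  rw [inner_gradient_eq]
  exact mul_left_cancel₀ (inv_ne_zero (setU_pos hδ hu (subset_closure hx)).ne') h2

/-- The difference is constant along trajectories and vanishes where they cross the plane. -/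
theorem IsTransport.eqOn {v : E3 → E3} {B : ℝ} {F w w' : E3 → ℝ} (hφ : IsFlow (slab d) v φ)
    (hv : IsUnitSpeed (slab d) B v)
    (h : IsTransport (slab d) φ (fun _ => (0 : ℝ →L[ℝ] ℝ)) F (fun _ => 0) w)
    (h' : IsTransport (slab d) φ (fun _ => (0 : ℝ →L[ℝ] ℝ)) F (fun _ => 0) w') :
    EqOn w w' (slab d) := by
  intro x hx
  have h1 := norm_le_of_norm_deriv_le (K := 0) (ε := 0) (a := -(x 0)) (b := 0) le_rfl le_rfl
    (fun t _ => (h.deriv x hx t).sub (h'.deriv x hx t)) (fun t _ => by simp)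
  have hp : φ (-(x 0)) x 0 = 0 := by rw [hφ.apply_zero hv hx]; ring
  simp only [Pi.sub_apply, hφ.zero x hx, h.init _ (hφ.mem x hx _) hp,
    h'.init _ (hφ.mem x hx _) hp, sub_self, norm_zero, zero_mul, add_zero,
    norm_le_zero_iff] at h1
  exact sub_eq_zero.1 h1

theorem isUnitSpeed_velocity (hδ : 0 < δ) (hs : 1 < s) (hn : ∀ n : ℤ, s ≠ n)
    (hu : u ∈ setU d l₁ l₂ δ s) : ∃ B, IsUnitSpeed (slab d) B (velocity u) := by
  obtain ⟨M, hM⟩ := exists_norm_bound hu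
  obtain ⟨B, K, hB, -, H⟩ := exists_velocity_holderBound d l₁ l₂ hδ hn M
  have h1 := (H u hu hM).1
  rw [← max_eq_left (one_le_floor hs)] at h1
  exact ⟨_, h1.isUnitSpeed (fract_pos_of_ne hn) (Int.fract_lt_one s) hB
    fun x hx => velocity_apply_zero hδ hu hx⟩

/-- Uniqueness for the transport problem. -/
theorem Solves.eqOn (hd : 0 < d) (hδ : 0 < δ) (hs : 1 < s) (hn : ∀ n : ℤ, s ≠ n)
    (hu : u ∈ setU d l₁ l₂ δ s) (hg : ∀ x ∈ slab d, DifferentiableAt ℝ g x)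
    (hg' : ∀ x ∈ slab d, DifferentiableAt ℝ g' x) (hc : ContinuousOn g (closure (slab d)))
    (hc' : ContinuousOn g' (closure (slab d))) (h : Solves d u f g) (h' : Solves d u f g') :
    EqOn g g' (closure (slab d)) := by
  obtain ⟨φ, hφ⟩ := exists_flow_velocity hd hδ hs hn hu
  obtain ⟨B, hv⟩ := isUnitSpeed_velocity hδ hs hn hu
  exact ((h.isTransport hφ hg).eqOn hφ hv (h'.isTransport hφ hg')).of_subset_closure
    hc hc' subset_closure subset_rfl

theorem continuous_setHeight (x : E3) : Continuous fun c => setHeight c x := by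
  refine (PiLp.continuous_toLp 2 _).comp (continuous_pi fun i => ?_)
  by_cases h : i = 2
  · simpa [h] using continuous_id'
  · simpa [h] using continuous_const

/-- Boundary points of the plane are reached by moving vertically inside it. This transfers the
condition `g = 0` from the open slab to its closure. -/
theorem closure_plane_subset (hd : 0 < d) :
    closure (slab d) ∩ {x | x 0 = 0} ⊆ closure (slab d ∩ {x | x 0 = 0}) := by
  rintro x ⟨hx, hx0⟩
  have h1 : x 2 ∈ closure (Ioo (-d) 0) := by
    rw [closure_Ioo (by linarith)]
    rwa [closure_slab hd] at hx
  have := map_mem_closure (continuous_setHeight x) h1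
    (t := slab d ∩ {x | x 0 = 0}) fun c hc => ⟨by simpa [slab, setHeight] using hc, by
      simpa [setHeight] using hx0⟩
  rwa [setHeight_self] at this

theorem MemHolderLoc.holderBoundLoc_div (hδ : 0 < δ) (hn : ∀ n : ℤ, s ≠ n)
    (hu : u ∈ setU d l₁ l₂ δ s) (hf : MemHolderLoc s (slab d) f) :
    HolderBoundLoc (Int.fract s) d ⌊s⌋₊ (fun x => (u x 0)⁻¹ • f x) := fun ρ => by
  obtain ⟨M, hM⟩ := exists_norm_bound hu
  obtain ⟨B, K, hB, hK, H⟩ := exists_velocity_holderBound d l₁ l₂ hδ hn M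
  obtain ⟨N, hN, hf⟩ := hf.holderBoundLoc ρ
  exact ⟨_, by positivity, ((H u hu hM).2.mono le_rfl (slabBall_subset_slab d ρ)).smul
    (fract_pos_of_ne hn) (Int.fract_lt_one s) (convex_slabBall d ρ) (isOpen_slabBall d ρ) hf hK hN⟩

theorem holderBoundLoc_zero {F : Type} [NormedAddCommGroup F] [NormedSpace ℝ F] (α d : ℝ) (n : ℕ) :
    HolderBoundLoc α d n (fun _ : E3 => (0 : F)) :=
  fun _ => ⟨‖(0 : F)‖, norm_nonneg _, holderBound_const 0⟩

/-- Existence for the transport problem. -/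
theorem exists_solves (hd : 0 < d) (hδ : 0 < δ) (hs : 1 < s) (hn : ∀ n : ℤ, s ≠ n)
    (hu : u ∈ setU d l₁ l₂ δ s) (hf : MemHolderLoc s (slab d) f) :
    ∃ g, MemHolderLoc s (slab d) g ∧ Solves d u f g := by
  obtain ⟨φ, hφ⟩ := exists_flow_velocity hd hδ hs hn hu
  obtain ⟨B₀, hv⟩ := isUnitSpeed_velocity hδ hs hn hu
  have hα := fract_pos_of_ne hn
  have hα1 := Int.fract_lt_one s
  obtain ⟨M, hM⟩ := exists_norm_bound hu
  obtain ⟨B, K, hB, hK, H⟩ := exists_velocity_holderBound d l₁ l₂ hδ hn M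
  have hvB := (H u hu hM).1
  have hF := hf.holderBoundLoc_div hδ hn hu
  obtain ⟨w, hw⟩ := exists_isTransport hφ hv (A := fun _ => (0 : ℝ →L[ℝ] ℝ)) continuousOn_const
    hF.continuousOn (fun _ => 0)
  have hwl : HolderBoundLoc (Int.fract s) d ⌊s⌋₊ w :=
    (transportRegularity hα hα1 d ⌊s⌋₊).loc hB hφ (fun x hx => velocity_apply_zero hδ hu hx)
      (by rwa [max_eq_left (one_le_floor hs)]) (holderBoundLoc_zero _ _ _) hF
      (holderBoundLoc_zero _ _ _) hw
  -- Outside the open slab the values of `w` are arbitrary, so `w` is replaced by its continuous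
  -- extension to the closure.
  obtain ⟨g, hgc, hgw⟩ := exists_continuousOn_closure_of_tendsto hwl.continuousOn
    fun x hx => hwl.exists_tendsto hα hα1 hx
  have hgl : MemHolderLoc s (slab d) g := by
    refine HolderBoundLoc.memHolderLoc hα (fun ρ => ?_) hgc
    obtain ⟨N, hN, h⟩ := hwl ρ
    exact ⟨N, hN, h.congr (isOpen_slabBall d ρ) fun x hx => (hgw hx.1).symm⟩
  have hg : ∀ x ∈ slab d, DifferentiableAt ℝ g x := fun x hx =>
    hgl.differentiableAt (one_le_floor hs) hx
  have hgt : IsTransport (slab d) φ (fun _ => (0 : ℝ →L[ℝ] ℝ)) (fun x => (u x 0)⁻¹ • f x)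
      (fun _ => 0) g := by
    refine ⟨fun x hx t => ?_, fun x hx hx0 => ?_⟩
    · have h1 := hw.deriv x hx t
      rw [← hgw (hφ.mem x hx t)] at h1
      exact h1.congr_of_eventuallyEq (Filter.Eventually.of_forall fun t => hgw (hφ.mem x hx t))
    · rw [hgw hx]
      exact hw.init x hx hx0
  refine ⟨g, hgl, fun x hx => hgt.solves hδ hu hφ hg hx, fun x hx hx0 => ?_⟩
  exact Set.EqOn.of_subset_closure (s := slab d ∩ {x | x 0 = 0})
    (t := closure (slab d) ∩ {x | x 0 = 0}) (f := g) (g := fun _ => 0)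
    (fun y hy => hgt.init y hy.1 hy.2) (hgc.mono inter_subset_left) continuousOn_const
    (inter_subset_inter_left _ subset_closure) (closure_plane_subset hd) ⟨hx, hx0⟩

/-- Local bounds for the transport problem. -/
theorem exists_solves_holderBound (d l₁ l₂ : ℝ) (hd : 0 < d) (hδ : 0 < δ) (hs : 1 < s)
    (hn : ∀ n : ℤ, s ≠ n) (M : ℝ≥0) {ρ : ℝ} (hρ : 0 < ρ) :
    ∃ R C : ℝ, 0 ≤ C ∧ ∀ u ∈ setU d l₁ l₂ δ s, holderNorm s (slab d) u ≤ M →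
      ∀ f g : E3 → ℝ, MemHolderLoc s (slab d) f → MemHolderLoc s (slab d) g → Solves d u f g →
      ∀ c, 0 ≤ c → HolderBound (Int.fract s) (slabBall d R) ⌊s⌋₊ c f →
        HolderBound (Int.fract s) (slabBall d ρ) ⌊s⌋₊ (C * c) g := by
  have hα := fract_pos_of_ne hn
  have hα1 := Int.fract_lt_one s
  obtain ⟨B, K, hB, hK, H⟩ := exists_velocity_holderBound d l₁ l₂ hδ hn M
  obtain ⟨R, -, HR⟩ := transportRegularity hα hα1 d ⌊s⌋₊ ρ B hρ hB
  -- The bound for `f / u₁` when `f` has bound 1. Since the problem is linear, applying this to `f /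
  -- c'` and scaling back makes the final estimate linear in the bound of `f`.
  obtain ⟨C, hC, HC⟩ := HR (2 * 4 ^ ⌊s⌋₊ * 1 * K * 1) (by positivity)
  refine ⟨R, C, hC, fun u hu huM f g hf hg hsol c hc hfc => HolderBound.of_forall_gt
    fun c' hc' => ?_⟩
  obtain ⟨φ, hφ⟩ := exists_flow_velocity hd hδ hs hn hu
  have hc0 : 0 < c' := hc.trans_lt hc'
  have hF := hf.holderBoundLoc_div hδ hn hu
  have hgt := hsol.isTransport hφ fun x hx => hg.differentiableAt (one_le_floor hs) hx
  have hgt' : IsTransport (slab d) φ (fun _ => (0 : ℝ →L[ℝ] ℝ))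
      (fun x => c'⁻¹ • ((u x 0)⁻¹ • f x)) (fun _ => 0) (fun x => c'⁻¹ • g x) := by
    refine ⟨fun x hx t => ?_, fun x hx hx0 => by simp [hgt.init x hx hx0]⟩
    have := (hgt.deriv x hx t).const_smul c'⁻¹
    simp only [zero_apply, sub_zero] at this ⊢
    exact this
  have o := isOpen_slabBall d R
  have hcinv : |c'⁻¹| = c'⁻¹ := abs_of_pos (by positivity)
  have hF' : HolderBoundLoc (Int.fract s) d ⌊s⌋₊ (fun x => c'⁻¹ • ((u x 0)⁻¹ • f x)) := fun r => by
    obtain ⟨N, hN, h⟩ := hF r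
    exact ⟨_, by positivity, h.const_smul (isOpen_slabBall d r) c'⁻¹⟩
  have hz : ∀ (X : Type) [NormedAddCommGroup X] [NormedSpace ℝ X],
      HolderBound (Int.fract s) (slabBall d R) ⌊s⌋₊ (2 * 4 ^ ⌊s⌋₊ * 1 * K * 1)
        (fun _ : E3 => (0 : X)) := fun X _ _ =>
    (holderBound_const (0 : X)).mono (by rw [norm_zero]; positivity) subset_rfl
  have h1 := HC (velocity u) φ hφ (fun x hx => velocity_apply_zero hδ hu hx)
    (by rw [max_eq_left (one_le_floor hs)]; exact (H u hu huM).1) ℝ _ _ _ _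
    (holderBoundLoc_zero _ _ _) hF' (holderBoundLoc_zero _ _ _) (hz _) (by
      have h2 := ((((H u hu huM).2.mono le_rfl (slabBall_subset_slab d R)).smul hα hα1
        (convex_slabBall d R) o (hfc.mono hc'.le subset_rfl) hK hc0.le).const_smul o c'⁻¹)
      refine h2.mono (le_of_eq ?_) subset_rfl
      rw [hcinv]
      field_simp) (hz _) hgt'
  have h3 := h1.const_smul (isOpen_slabBall d ρ) c'
  rw [abs_of_pos hc0, mul_comm] at h3
  refine h3.congr (isOpen_slabBall d ρ) fun x _ => ?_
  simp only [smul_eq_mul]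
  field_simp

end Problem

/-! ### Translations and reflections -/

section Isometries

variable {d a b : ℝ} {x : E3}

theorem shift_eq (a b : ℝ) (x : E3) :
    shift a b x = x + (EuclideanSpace.single 0 a + EuclideanSpace.single 1 b) := by
  rw [shift, add_assoc]

@[simp] theorem shift_apply_zero (a b : ℝ) (x : E3) : shift a b x 0 = x 0 + a := by simp [shift]

@[simp] theorem shift_apply_one (a b : ℝ) (x : E3) : shift a b x 1 = x 1 + b := by simp [shift]

@[simp] theorem shift_apply_two (a b : ℝ) (x : E3) : shift a b x 2 = x 2 := by simp [shift]

theorem ext_three {x y : E3} (h0 : x 0 = y 0) (h1 : x 1 = y 1) (h2 : x 2 = y 2) : x = y := by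
  ext i
  fin_cases i <;> assumption

theorem shift_shift (a b a' b' : ℝ) (x : E3) :
    shift a b (shift a' b' x) = shift (a' + a) (b' + b) x :=
  ext_three (by simp [add_assoc]) (by simp [add_assoc]) (by simp)

@[simp] theorem shift_zero (x : E3) : shift 0 0 x = x := ext_three (by simp) (by simp) (by simp)

@[simp] theorem shift_mem_slab : shift a b x ∈ slab d ↔ x ∈ slab d := by simp [slab]

theorem shift_mem_closure (hd : 0 < d) : shift a b x ∈ closure (slab d) ↔ x ∈ closure (slab d) := by
  simp [closure_slab hd]

theorem hasFDerivAt_shift (a b : ℝ) (x : E3) :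
    HasFDerivAt (shift a b) (ContinuousLinearMap.id ℝ E3) x := by
  have := (hasFDerivAt_id (𝕜 := ℝ) x).add_const
    (EuclideanSpace.single 0 a + EuclideanSpace.single 1 b)
  exact this.congr_of_eventuallyEq (Filter.Eventually.of_forall fun y => shift_eq a b y)

theorem continuous_shift (a b : ℝ) : Continuous (shift a b) :=
  continuous_iff_continuousAt.2 fun x => (hasFDerivAt_shift a b x).continuousAt

/-- The reflection `R_j` as a continuous linear map. -/
def reflectCLM (j : Fin 3) : E3 →L[ℝ] E3 :=
  ContinuousLinearMap.id ℝ E3 -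
    (2 : ℝ) • (coordProj j).smulRight (EuclideanSpace.single j (1 : ℝ))

theorem reflect_apply (j i : Fin 3) (x : E3) : reflect j x i = if i = j then -x i else x i := rfl

theorem reflectCLM_apply (j : Fin 3) (x : E3) : reflectCLM j x = reflect j x := by
  ext i
  rw [reflect_apply]
  by_cases h : i = j
  · subst h
    simp [reflectCLM]
    ring
  · simp [reflectCLM, h]

theorem hasFDerivAt_reflect (j : Fin 3) (x : E3) : HasFDerivAt (reflect j) (reflectCLM j) x :=
  (reflectCLM j).hasFDerivAt.congr_of_eventuallyEq
    (Filter.Eventually.of_forall fun y => (reflectCLM_apply j y).symm)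

theorem continuous_reflect (j : Fin 3) : Continuous (reflect j) :=
  continuous_iff_continuousAt.2 fun x => (hasFDerivAt_reflect j x).continuousAt

@[simp] theorem reflect_reflect (j : Fin 3) (x : E3) : reflect j (reflect j x) = x := by
  ext i
  by_cases h : i = j <;> simp [reflect_apply, h]

@[simp] theorem reflect_castSucc_apply_two (j : Fin 2) (x : E3) :
    reflect j.castSucc x 2 = x 2 := by
  fin_cases j <;> simp [reflect_apply]

@[simp] theorem reflect_mem_slab {j : Fin 2} : reflect j.castSucc x ∈ slab d ↔ x ∈ slab d := by
  simp [slab]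

theorem reflect_mem_closure (hd : 0 < d) {j : Fin 2} :
    reflect j.castSucc x ∈ closure (slab d) ↔ x ∈ closure (slab d) := by
  simp [closure_slab hd]

theorem isPeriodic_of_shift {F : Type*} {l₁ l₂ : ℝ} (hd : 0 < d) {h : E3 → F}
    (h₁ : ∀ x ∈ closure (slab d), h (shift l₁ 0 x) = h x)
    (h₂ : ∀ x ∈ closure (slab d), h (shift 0 l₂ x) = h x) : IsPeriodic d l₁ l₂ h := by
  have key : ∀ a b : ℝ, (∀ x ∈ closure (slab d), h (shift a b x) = h x) →
      ∀ m : ℤ, ∀ x ∈ closure (slab d), h (shift (m * a) (m * b) x) = h x := by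
    intro a b hab m
    induction m using Int.induction_on with
    | zero => intro x _; simp
    | succ i ih =>
      intro x hx
      have e := hab _ ((shift_mem_closure (a := ((i : ℤ) : ℝ) * a) (b := ((i : ℤ) : ℝ) * b) hd).2 hx)
      rw [shift_shift, ih x hx] at e
      rw [← e]
      push_cast
      ring_nf
    | pred i ih =>
      intro x hx
      rw [← ih x hx, ← hab (shift _ _ x) ((shift_mem_closure hd).2 hx), shift_shift]
      push_cast
      ring_nf
  intro m n x hx
  have e : shift (m * l₁) (n * l₂) x = shift (m * l₁) (m * 0) (shift (n * 0) (n * l₂) x) := by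
    rw [shift_shift]; simp
  rw [e, key _ _ h₁ m _ ((shift_mem_closure hd).2 hx), key _ _ h₂ n x hx]

theorem IsPeriodic.shift_fst {F : Type*} {l₁ l₂ : ℝ} {h : E3 → F} (hh : IsPeriodic d l₁ l₂ h)
    (hx : x ∈ closure (slab d)) : h (shift l₁ 0 x) = h x := by
  simpa using hh 1 0 x hx

theorem IsPeriodic.shift_snd {F : Type*} {l₁ l₂ : ℝ} {h : E3 → F} (hh : IsPeriodic d l₁ l₂ h)
    (hx : x ∈ closure (slab d)) : h (shift 0 l₂ x) = h x := by
  simpa using hh 0 1 x hx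

variable {F : Type} [NormedAddCommGroup F] [NormedSpace ℝ F] {α C : ℝ} {U V : Set E3} {n : ℕ}
  {f : E3 → F}

theorem iteratedFDeriv_comp_shift (n : ℕ) (f : E3 → F) (a b : ℝ) (x : E3) :
    iteratedFDeriv ℝ n (fun y => f (shift a b y)) x = iteratedFDeriv ℝ n f (shift a b x) := by
  simp only [shift_eq]
  exact iteratedFDeriv_comp_add_right n _ x

theorem HolderBound.comp_shift (h : HolderBound α U n C f) (a b : ℝ)
    (hV : ∀ x ∈ V, shift a b x ∈ U) : HolderBound α V n C (fun x => f (shift a b x)) where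
  contDiffOn := h.contDiffOn.comp (by
    have : shift a b = fun x => x + (EuclideanSpace.single 0 a + EuclideanSpace.single 1 b) :=
      funext fun x => shift_eq a b x
    rw [this]
    exact (contDiff_id.add contDiff_const).contDiffOn) hV
  bound j hj x hx := by
    rw [iteratedFDeriv_comp_shift]
    exact h.bound j hj _ (hV x hx)
  holder x hx y hy := by
    rw [iteratedFDeriv_comp_shift, iteratedFDeriv_comp_shift]
    have e : shift a b x - shift a b y = x - y := by rw [shift_eq, shift_eq]; abel
    rw [← e]
    exact h.holder _ (hV x hx) _ (hV y hy)

theorem norm_le_sum_abs (x : E3) : ‖x‖ ≤ |x 0| + |x 1| + |x 2| := by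
  refine abs_le_of_sq_le_sq' ?_ (by positivity) |>.2
  rw [EuclideanSpace.real_norm_sq_eq, Fin.sum_univ_three]
  nlinarith [abs_nonneg (x 0), abs_nonneg (x 1), abs_nonneg (x 2), sq_abs (x 0), sq_abs (x 1),
    sq_abs (x 2), mul_nonneg (abs_nonneg (x 0)) (abs_nonneg (x 1)),
    mul_nonneg (abs_nonneg (x 0)) (abs_nonneg (x 2)),
    mul_nonneg (abs_nonneg (x 1)) (abs_nonneg (x 2))]

/-- Every point of the slab has a translate by the lattice in a fixed bounded set. -/
theorem exists_shift_norm_le {l₁ l₂ : ℝ} (hl₁ : 0 < l₁) (hl₂ : 0 < l₂) (hx : x ∈ slab d) :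
    ∃ m n : ℤ, ‖shift (m * l₁) (n * l₂) x‖ ≤ l₁ + l₂ + d := by
  have key : ∀ l : ℝ, 0 < l → ∀ t : ℝ, |t + (-⌊t / l⌋ : ℤ) * l| ≤ l := by
    intro l hl t
    have h1 := Int.fract_nonneg (t / l)
    have h2 := (Int.fract_lt_one (t / l)).le
    have e : t + (-⌊t / l⌋ : ℤ) * l = Int.fract (t / l) * l := by
      rw [Int.fract, sub_mul, div_mul_cancel₀ _ hl.ne']
      push_cast
      ring
    rw [e, abs_of_nonneg (by positivity)]
    nlinarith
  refine ⟨-⌊x 0 / l₁⌋, -⌊x 1 / l₂⌋, (norm_le_sum_abs _).trans ?_⟩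
  rw [shift_apply_zero, shift_apply_one, shift_apply_two]
  refine add_le_add (add_le_add (key _ hl₁ _) (key _ hl₂ _)) (abs_le.2 ⟨hx.1.le, ?_⟩)
  linarith [hx.1, hx.2]

/-- Two points at distance less than 1 are moved by a common lattice translation into the given
ball; the summand 1 in its radius makes room for the second point. At larger distances the sup bound
suffices, with factor 2. -/
theorem HolderBound.slab_of_isPeriodic {l₁ l₂ : ℝ} (hα : 0 < α) (hl₁ : 0 < l₁) (hl₂ : 0 < l₂)
    (hC : 0 ≤ C) (hf : IsPeriodic d l₁ l₂ f)
    (h : HolderBound α (slabBall d (l₁ + l₂ + d + 1)) n C f) :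
    HolderBound α (slab d) n (2 * C) f := by
  have hper : ∀ m k : ℤ, ∀ x ∈ slab d, (fun y => f (shift (m * l₁) (k * l₂) y)) =ᶠ[nhds x] f :=
    fun m k x hx => Filter.eventually_of_mem ((isOpen_slab d).mem_nhds hx)
      fun y hy => hf m k y (subset_closure hy)
  have hder : ∀ j : ℕ, ∀ m k : ℤ, ∀ x ∈ slab d,
      iteratedFDeriv ℝ j f (shift (m * l₁) (k * l₂) x) = iteratedFDeriv ℝ j f x :=
    fun j m k x hx => by
      rw [← iteratedFDeriv_comp_shift]
      exact ((hper m k x hx).iteratedFDeriv ℝ j).eq_of_nhds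
  have hex : ∀ x ∈ slab d, ∃ m k : ℤ, ∀ y ∈ slab d, ‖x - y‖ < 1 →
      shift (m * l₁) (k * l₂) y ∈ slabBall d (l₁ + l₂ + d + 1) := by
    intro x hx
    obtain ⟨m, k, hmk⟩ := exists_shift_norm_le hl₁ hl₂ hx
    refine ⟨m, k, fun y hy hxy => mem_slabBall.2 ⟨shift_mem_slab.2 hy, ?_⟩⟩
    have e : shift (m * l₁) (k * l₂) y - shift (m * l₁) (k * l₂) x = y - x := by
      rw [shift_eq, shift_eq]; abel
    have h2 := norm_sub_norm_le (shift (m * l₁) (k * l₂) y) (shift (m * l₁) (k * l₂) x)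
    rw [e, norm_sub_rev] at h2
    linarith
  have hb : ∀ j ≤ n, ∀ x ∈ slab d, ‖iteratedFDeriv ℝ j f x‖ ≤ C := by
    intro j hj x hx
    obtain ⟨m, k, hmk⟩ := hex x hx
    rw [← hder j m k x hx]
    exact h.bound j hj _ (hmk x hx (by simp))
  refine ⟨fun x hx => ?_, fun j hj x hx => (hb j hj x hx).trans (by linarith),
    fun x hx y hy => ?_⟩
  · obtain ⟨m, k, hmk⟩ := hex x hx
    have h1 : ContDiffAt ℝ n f (shift (m * l₁) (k * l₂) x) :=
      h.contDiffOn.contDiffAt ((isOpen_slabBall _ _).mem_nhds (hmk x hx (by simp)))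
    have h2 : ContDiffAt ℝ n (fun y => f (shift (m * l₁) (k * l₂) y)) x := by
      simp only [shift_eq] at h1 ⊢
      exact h1.comp x (contDiff_id.add contDiff_const).contDiffAt
    exact (h2.congr_of_eventuallyEq (hper m k x hx).symm).contDiffWithinAt
  · rcases lt_or_ge ‖x - y‖ 1 with hxy | hxy
    · obtain ⟨m, k, hmk⟩ := hex x hx
      rw [← hder n m k x hx, ← hder n m k y hy]
      have e : shift (m * l₁) (k * l₂) x - shift (m * l₁) (k * l₂) y = x - y := by
        rw [shift_eq, shift_eq]; abel
      have h1 := h.holder _ (hmk x hx (by simp)) _ (hmk y hy hxy)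
      rw [e] at h1
      refine h1.trans ?_
      gcongr
      linarith
    · have h1 := Real.one_le_rpow hxy hα.le
      have h2 := norm_sub_le (iteratedFDeriv ℝ n f x) (iteratedFDeriv ℝ n f y)
      have h3 := hb n le_rfl x hx
      have h4 := hb n le_rfl y hy
      nlinarith

end Isometries

/-! ### Periodicity and symmetry of solutions -/

section Symmetry

variable {d l₁ l₂ δ s : ℝ} {u : E3 → E3} {f g : E3 → ℝ}

theorem fderiv_comp_shift (hg : ∀ x ∈ slab d, DifferentiableAt ℝ g x) (a b : ℝ) {x : E3}
    (hx : x ∈ slab d) :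
    HasFDerivAt (fun x => g (shift a b x)) (fderiv ℝ g (shift a b x)) x :=
  (hg _ (shift_mem_slab.2 hx)).hasFDerivAt.comp x (hasFDerivAt_shift a b x)

theorem fderiv_comp_reflect (hg : ∀ x ∈ slab d, DifferentiableAt ℝ g x) (j : Fin 2) {x : E3}
    (hx : x ∈ slab d) :
    HasFDerivAt (fun x => g (reflect j.castSucc x))
      ((fderiv ℝ g (reflect j.castSucc x)).comp (reflectCLM j.castSucc)) x :=
  (hg _ (reflect_mem_slab.2 hx)).hasFDerivAt.comp x (hasFDerivAt_reflect j.castSucc x)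

/-- The sign `(-1)^j` in the symmetry conditions. -/
theorem sign_mul_self (j : Fin 2) : ((-1 : ℝ) ^ ((j : ℕ) + 1)) * (-1) ^ ((j : ℕ) + 1) = 1 := by
  rw [← mul_pow]; simp

/-- The signs combine so that `(-1)^j g ∘ R_j` solves the same transport problem as `g` when `f` is
invariant under `R_j`. -/
theorem fderiv_comp_reflect_velocity (hu : IsSymmVector d 1 u)
    (hg : ∀ x ∈ slab d, DifferentiableAt ℝ g x) (j : Fin 2) {x : E3} (hx : x ∈ slab d) :
    fderiv ℝ (fun x => g (reflect j.castSucc x)) x (u x) =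
      (-1) ^ ((j : ℕ) + 1) * fderiv ℝ g (reflect j.castSucc x) (u (reflect j.castSucc x)) := by
  rw [(fderiv_comp_reflect hg j hx).fderiv, hu j x (subset_closure hx), map_smul, smul_eq_mul,
    one_mul, ← mul_assoc, sign_mul_self, one_mul, ContinuousLinearMap.comp_apply, reflectCLM_apply]

theorem ContinuousOn.comp_shift (hd : 0 < d) {F : Type*} [TopologicalSpace F] {g : E3 → F}
    (hg : ContinuousOn g (closure (slab d))) (a b : ℝ) :
    ContinuousOn (fun x => g (shift a b x)) (closure (slab d)) :=
  hg.comp (continuous_shift a b).continuousOn fun _ hx => (shift_mem_closure hd).2 hx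

theorem ContinuousOn.comp_reflect (hd : 0 < d) {F : Type*} [TopologicalSpace F] {g : E3 → F}
    (hg : ContinuousOn g (closure (slab d))) (j : Fin 2) :
    ContinuousOn (fun x => g (reflect j.castSucc x)) (closure (slab d)) :=
  hg.comp (continuous_reflect _).continuousOn fun _ hx => (reflect_mem_closure hd).2 hx

theorem solves_iff : Solves d u f g ↔ (∀ x ∈ slab d, fderiv ℝ g x (u x) = f x) ∧
    ∀ x ∈ closure (slab d), x 0 = 0 → g x = 0 := by
  simp only [Solves, inner_gradient_eq]

theorem Solves.shift_snd (hd : 0 < d) (hδ : 0 < δ) (hs : 1 < s) (hn : ∀ n : ℤ, s ≠ n)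
    (hu : u ∈ setU d l₁ l₂ δ s) (hf : IsPeriodic d l₁ l₂ f)
    (hg : ∀ x ∈ slab d, DifferentiableAt ℝ g x) (hc : ContinuousOn g (closure (slab d)))
    (h : Solves d u f g) {x : E3} (hx : x ∈ closure (slab d)) : g (shift 0 l₂ x) = g x := by
  refine Solves.eqOn (f := f) hd hδ hs hn hu
    (fun x hx => (fderiv_comp_shift hg 0 l₂ hx).differentiableAt) hg
    (ContinuousOn.comp_shift hd hc 0 l₂) hc (solves_iff.2 ⟨fun x hx => ?_, fun x hx hx0 => ?_⟩) h hx
  · have hx' := subset_closure hx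
    rw [(fderiv_comp_shift hg 0 l₂ hx).fderiv, ← hu.1.2.1.shift_snd hx',
      (solves_iff.1 h).1 _ (shift_mem_slab.2 hx), hf.shift_snd hx']
  · exact h.2 _ ((shift_mem_closure hd).2 hx) (by simpa using hx0)

theorem Solves.isSymmScalar (hd : 0 < d) (hδ : 0 < δ) (hs : 1 < s) (hn : ∀ n : ℤ, s ≠ n)
    (hu : u ∈ setU d l₁ l₂ δ s) (hf : IsSymmScalar d 1 f)
    (hg : ∀ x ∈ slab d, DifferentiableAt ℝ g x) (hc : ContinuousOn g (closure (slab d)))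
    (h : Solves d u f g) : IsSymmScalar d (-1) g := by
  intro j x hx
  have key := Solves.eqOn (f := f) (g := fun x => (-1) ^ ((j : ℕ) + 1) * g (reflect j.castSucc x))
    hd hδ hs hn hu (fun x hx => (fderiv_comp_reflect hg j hx).differentiableAt.const_mul _) hg
    ((ContinuousOn.comp_reflect hd hc j).const_mul _) hc
    (solves_iff.2 ⟨fun x hx => ?_, fun x hx hx0 => ?_⟩) h hx
  · simp only at key
    rw [← key, ← mul_assoc, sign_mul_self, one_mul]
  · rw [fderiv_const_mul (fderiv_comp_reflect hg j hx).differentiableAt, smul_apply, smul_eq_mul,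
      fderiv_comp_reflect_velocity hu.1.2.2.1 hg j hx, ← mul_assoc, sign_mul_self, one_mul,
      (solves_iff.1 h).1 _ (reflect_mem_slab.2 hx), hf j x (subset_closure hx)]
    simp
  · rw [h.2 _ ((reflect_mem_closure hd).2 hx) (by rw [reflect_apply, hx0]; simp), mul_zero]

theorem periodDiff_differentiableAt (hg : ∀ x ∈ slab d, DifferentiableAt ℝ g x) (l₁ : ℝ) {x : E3}
    (hx : x ∈ slab d) : HasFDerivAt (periodDiff l₁ g)
      (fderiv ℝ g (shift l₁ 0 x) - fderiv ℝ g x) x :=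
  (fderiv_comp_shift hg l₁ 0 hx).sub (hg x hx).hasFDerivAt

theorem continuousOn_periodDiff (hd : 0 < d) (hc : ContinuousOn g (closure (slab d))) (l₁ : ℝ) :
    ContinuousOn (periodDiff l₁ g) (closure (slab d)) :=
  (ContinuousOn.comp_shift hd hc l₁ 0).sub hc

/-- By periodicity `u · ∇G = 0`, and by symmetry of `u` the same holds for `G ∘ R₁`. Their
difference vanishes on `{x₁ = 0}`, which `R₁` fixes pointwise, so it solves the problem with zero
data. -/
theorem Solves.periodDiff_reflect_zero (hd : 0 < d) (hδ : 0 < δ) (hs : 1 < s)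
    (hn : ∀ n : ℤ, s ≠ n) (hu : u ∈ setU d l₁ l₂ δ s) (hf : IsPeriodic d l₁ l₂ f)
    (hg : ∀ x ∈ slab d, DifferentiableAt ℝ g x) (hc : ContinuousOn g (closure (slab d)))
    (h : Solves d u f g) {x : E3} (hx : x ∈ closure (slab d)) :
    periodDiff l₁ g (reflect 0 x) = periodDiff l₁ g x := by
  have hG : ∀ x ∈ slab d, DifferentiableAt ℝ (periodDiff l₁ g) x := fun x hx =>
    (periodDiff_differentiableAt hg l₁ hx).differentiableAt
  have hcG := continuousOn_periodDiff hd hc l₁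
  have h0 : ∀ x ∈ slab d, fderiv ℝ (periodDiff l₁ g) x (u x) = 0 := fun x hx => by
    have hx' := subset_closure hx
    rw [(periodDiff_differentiableAt hg l₁ hx).fderiv, sub_apply, (solves_iff.1 h).1 _ hx]
    nth_rw 1 [← hu.1.2.1.shift_fst hx']
    rw [(solves_iff.1 h).1 _ (shift_mem_slab.2 hx), hf.shift_fst hx', sub_self]
  have key := Solves.eqOn (f := fun _ => 0) (g' := fun _ => 0)
    (g := fun x => periodDiff l₁ g (reflect (Fin.castSucc (0 : Fin 2)) x) - periodDiff l₁ g x)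
    hd hδ hs hn hu (fun x hx => (fderiv_comp_reflect hG 0 hx).differentiableAt.sub (hG x hx))
    (fun _ _ => differentiableAt_const _)
    ((ContinuousOn.comp_reflect hd hcG 0).sub hcG) continuousOn_const
    (solves_iff.2 ⟨fun x hx => ?_, fun x hx hx0 => ?_⟩) (solves_iff.2 ⟨by simp, by simp⟩) hx
  · exact sub_eq_zero.1 key
  · rw [fderiv_fun_sub (fderiv_comp_reflect hG 0 hx).differentiableAt (hG x hx), sub_apply,
      fderiv_comp_reflect_velocity hu.1.2.2.1 hG 0 hx, h0 x hx, h0 _ (reflect_mem_slab.2 hx)]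
    simp
  · have : reflect (Fin.castSucc (0 : Fin 2)) x = x :=
      ext_three (by simp [reflect_apply, hx0]) (by simp [reflect_apply]) (by simp [reflect_apply])
    rw [this, sub_self]

/-- Evenness of `G` and oddness of `g` in `x₁` give `G(x + l₁e₁) = G(R₁(x + l₁e₁)) = g(R₁x) - g(R₁(x
+ l₁e₁)) = -g(x) + g(x + l₁e₁) = G(x)`. -/
theorem Solves.isPeriodic_periodDiff (hd : 0 < d) (hδ : 0 < δ) (hs : 1 < s)
    (hn : ∀ n : ℤ, s ≠ n) (hu : u ∈ setU d l₁ l₂ δ s) (hf : IsPeriodic d l₁ l₂ f)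
    (hf' : IsSymmScalar d 1 f)
    (hg : ∀ x ∈ slab d, DifferentiableAt ℝ g x) (hc : ContinuousOn g (closure (slab d)))
    (h : Solves d u f g) : IsPeriodic d l₁ l₂ (periodDiff l₁ g) := by
  refine isPeriodic_of_shift hd (fun x hx => ?_) (fun x hx => ?_)
  · have hx' : shift l₁ 0 x ∈ closure (slab d) := (shift_mem_closure hd).2 hx
    rw [← h.periodDiff_reflect_zero hd hδ hs hn hu hf hg hc hx']
    have h1 := h.isSymmScalar hd hδ hs hn hu hf' hg hc 0 _ hx'
    have h2 := h.isSymmScalar hd hδ hs hn hu hf' hg hc 0 _ hx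
    have e : shift l₁ 0 (reflect 0 (shift l₁ 0 x)) = reflect 0 x :=
      ext_three (by simp [reflect_apply]) (by simp [reflect_apply]) (by simp [reflect_apply])
    rw [periodDiff, e, periodDiff]
    simp only [Fin.castSucc_zero, Fin.val_zero, zero_add, pow_one, neg_one_mul] at h1 h2
    rw [h1, h2]
    ring
  · have e : shift l₁ 0 (shift 0 l₂ x) = shift 0 l₂ (shift l₁ 0 x) := by
      rw [shift_shift, shift_shift]; simp
    rw [periodDiff, periodDiff, e, h.shift_snd hd hδ hs hn hu hf hg hc hx,
      h.shift_snd hd hδ hs hn hu hf hg hc ((shift_mem_closure hd).2 hx)]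

theorem Solves.isSymmScalar_periodDiff (hd : 0 < d) (hδ : 0 < δ) (hs : 1 < s)
    (hn : ∀ n : ℤ, s ≠ n) (hu : u ∈ setU d l₁ l₂ δ s) (hf : IsPeriodic d l₁ l₂ f)
    (hf' : IsSymmScalar d 1 f)
    (hg : ∀ x ∈ slab d, DifferentiableAt ℝ g x) (hc : ContinuousOn g (closure (slab d)))
    (h : Solves d u f g) : IsSymmScalar d 1 (periodDiff l₁ g) := by
  intro j x hx
  rw [one_pow, one_mul]
  fin_cases j
  · exact h.periodDiff_reflect_zero hd hδ hs hn hu hf hg hc hx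
  · have h1 := h.isSymmScalar hd hδ hs hn hu hf' hg hc 1 _
      ((shift_mem_closure (a := l₁) (b := 0) hd).2 hx)
    have h2 := h.isSymmScalar hd hδ hs hn hu hf' hg hc 1 _ hx
    have e : shift l₁ 0 (reflect (Fin.castSucc 1) x) = reflect (Fin.castSucc (1 : Fin 2))
        (shift l₁ 0 x) :=
      ext_three (by simp [reflect_apply]) (by simp [reflect_apply]) (by simp [reflect_apply])
    change periodDiff l₁ g (reflect (Fin.castSucc 1) x) = _
    rw [periodDiff, e, h1, h2, periodDiff]
    simp

theorem HolderBound.periodDiff {α C ρ : ℝ} {n : ℕ} (hl₁ : 0 < l₁)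
    (h : HolderBound α (slabBall d (ρ + l₁)) n C g) :
    HolderBound α (slabBall d ρ) n (C + C) (periodDiff l₁ g) := by
  have h1 : HolderBound α (slabBall d ρ) n C (fun x => g (shift l₁ 0 x)) := by
    refine h.comp_shift l₁ 0 fun x hx => mem_slabBall.2 ⟨shift_mem_slab.2 hx.1, ?_⟩
    have e : shift l₁ 0 x = x + EuclideanSpace.single 0 l₁ := by simp [shift]
    rw [e]
    refine (norm_add_le _ _).trans_lt ?_
    rw [PiLp.norm_single, Real.norm_of_nonneg hl₁.le]
    linarith [(mem_slabBall.1 hx).2]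
  exact h1.sub (isOpen_slabBall d ρ) (h.mono le_rfl (slabBall_mono d (by linarith)))

/-- Global bounds for the solution over a period cell and for its period difference. -/
theorem exists_periodDiff_holderBound (hd : 0 < d) (hl₁ : 0 < l₁) (hl₂ : 0 < l₂) (hδ : 0 < δ)
    (hs : 1 < s) (hn : ∀ n : ℤ, s ≠ n) (M : ℝ≥0) :
    ∃ C : ℝ, 0 ≤ C ∧ ∀ u ∈ setU d l₁ l₂ δ s, holderNorm s (slab d) u ≤ M →
      ∀ f ∈ spaceY d l₁ l₂ 1 s, ∀ g, MemHolderLoc s (slab d) g → Solves d u f g →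
      HolderBound (Int.fract s) (slabBall d (l₁ + l₂ + d + 1)) ⌊s⌋₊
        (C * (holderNorm s (slab d) f).toReal) g ∧
      HolderBound (Int.fract s) (slab d) ⌊s⌋₊ (C * (holderNorm s (slab d) f).toReal)
        (periodDiff l₁ g) := by
  -- The ball that contains a period cell, enlarged by `l₁` to accommodate the shift in `G`. The
  -- factor 4 below is 2 for the difference and 2 for the passage from the cell to the slab.
  obtain ⟨R, C, hC, H⟩ := exists_solves_holderBound d l₁ l₂ hd hδ hs hn M
    (ρ := l₁ + l₂ + d + 1 + l₁) (by positivity)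
  refine ⟨4 * C, by positivity, fun u hu huM f hf g hg h => ?_⟩
  set c := (holderNorm s (slab d) f).toReal
  have hc : 0 ≤ c := ENNReal.toReal_nonneg
  have hCc : 0 ≤ C * c := by positivity
  have h1 := H u hu huM f g hf.1.loc hg h c hc
    (hf.1.holderBound.mono le_rfl (slabBall_subset_slab d R))
  have hgd : ∀ x ∈ slab d, DifferentiableAt ℝ g x := fun x hx =>
    hg.differentiableAt (one_le_floor hs) hx
  refine ⟨h1.mono (by linarith) (slabBall_mono d (by linarith)), ?_⟩
  refine ((h1.periodDiff hl₁).slab_of_isPeriodic (fract_pos_of_ne hn) hl₁ hl₂ (by positivity)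
    (h.isPeriodic_periodDiff hd hδ hs hn hu hf.2.1 hf.2.2 hgd hg.continuousOn)).mono
    (by linarith) subset_rfl

theorem Solves.periodDiff_mem_spaceY (hd : 0 < d) (hl₁ : 0 < l₁) (hl₂ : 0 < l₂) (hδ : 0 < δ)
    (hs : 1 < s) (hn : ∀ n : ℤ, s ≠ n) (hu : u ∈ setU d l₁ l₂ δ s)
    (hf : f ∈ spaceY d l₁ l₂ 1 s) (hg : MemHolderLoc s (slab d) g) (h : Solves d u f g) :
    periodDiff l₁ g ∈ spaceY d l₁ l₂ 1 s := by
  obtain ⟨M, hM⟩ := exists_norm_bound hu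
  obtain ⟨C, -, H⟩ := exists_periodDiff_holderBound hd hl₁ hl₂ hδ hs hn M
  have hgd : ∀ x ∈ slab d, DifferentiableAt ℝ g x := fun x hx =>
    hg.differentiableAt (one_le_floor hs) hx
  exact ⟨(H u hu hM f hf g hg h).2.memHolder (fract_pos_of_ne hn) (convex_slab d) (isOpen_slab d)
    (continuousOn_periodDiff hd hg.continuousOn l₁),
    h.isPeriodic_periodDiff hd hδ hs hn hu hf.2.1 hf.2.2 hgd hg.continuousOn,
    h.isSymmScalar_periodDiff hd hδ hs hn hu hf.2.1 hf.2.2 hgd hg.continuousOn⟩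

end Symmetry

/-! ### The cross product of gradients -/

section Cross

/-- The cross product of two linear forms, identified with vectors. -/
def crossForm : (E3 →L[ℝ] ℝ) →L[ℝ] (E3 →L[ℝ] ℝ) →L[ℝ] E3 :=
  let L : (E3 →L[ℝ] ℝ) →ₗ[ℝ] Fin 3 → ℝ := LinearMap.pi fun i =>
    (ContinuousLinearMap.apply ℝ ℝ (EuclideanSpace.single i (1 : ℝ) : E3)).toLinearMap
  ((crossProduct.compl₁₂ L L).compr₂
    (WithLp.linearEquiv 2 ℝ (Fin 3 → ℝ)).symm.toLinearMap).toContinuousBilinearMap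

variable (a b c : E3 →L[ℝ] ℝ)

theorem crossForm_eq : crossForm a b = WithLp.toLp 2 (crossProduct
    (fun i => a (EuclideanSpace.single i 1)) (fun i => b (EuclideanSpace.single i 1))) := rfl

theorem crossForm_apply_zero : crossForm a b 0 =
    a (EuclideanSpace.single 1 1) * b (EuclideanSpace.single 2 1) -
      a (EuclideanSpace.single 2 1) * b (EuclideanSpace.single 1 1) := by
  simp [crossForm_eq, cross_apply]

theorem crossForm_apply_one : crossForm a b 1 =
    a (EuclideanSpace.single 2 1) * b (EuclideanSpace.single 0 1) -
      a (EuclideanSpace.single 0 1) * b (EuclideanSpace.single 2 1) := by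
  simp [crossForm_eq, cross_apply]

theorem crossForm_apply_two : crossForm a b 2 =
    a (EuclideanSpace.single 0 1) * b (EuclideanSpace.single 1 1) -
      a (EuclideanSpace.single 1 1) * b (EuclideanSpace.single 0 1) := by
  simp [crossForm_eq, cross_apply]

theorem clm_apply_eq_sum (v : E3) : a v = v 0 * a (EuclideanSpace.single 0 1) +
    v 1 * a (EuclideanSpace.single 1 1) + v 2 * a (EuclideanSpace.single 2 1) := by
  have : v = v 0 • EuclideanSpace.single 0 1 + v 1 • EuclideanSpace.single 1 1 +
      v 2 • EuclideanSpace.single 2 1 := ext_three (by simp) (by simp) (by simp)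
  conv_lhs => rw [this]
  simp

theorem apply_crossForm_rotate : c (crossForm a b) = a (crossForm b c) := by
  simp only [clm_apply_eq_sum _ (crossForm _ _), crossForm_apply_zero, crossForm_apply_one,
    crossForm_apply_two]
  ring

/-- Used with `a = DG` and `b = Dg`: a shift by `l₁` adds `DG` to `Dg`, which the cross product does
not see. -/
theorem crossForm_self_add : crossForm a (b + a) = crossForm a b :=
  ext_three (by simp [crossForm_apply_zero]; ring) (by simp [crossForm_apply_one]; ring)
    (by simp [crossForm_apply_two]; ring)

/-- A reflection is orthogonal with determinant -1, so the cross product is a pseudovector. -/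
theorem crossForm_comp_reflect (j : Fin 2) :
    crossForm (a.comp (reflectCLM j.castSucc)) (b.comp (reflectCLM j.castSucc)) =
      -reflect j.castSucc (crossForm a b) := by
  have key : ∀ i k : Fin 3, reflectCLM k (EuclideanSpace.single i 1) =
      (if i = k then (-1 : ℝ) else 1) • EuclideanSpace.single i (1 : ℝ) := by
    intro i k
    ext m
    rw [reflectCLM_apply, reflect_apply]
    by_cases h : m = k <;> by_cases h' : i = k <;> simp [h, h', PiLp.single_apply]
  fin_cases j
  · refine ext_three ?_ ?_ ?_ <;>
    simp [crossForm_apply_zero, crossForm_apply_one, crossForm_apply_two, key, reflect_apply] <;>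
    ring
  · refine ext_three ?_ ?_ ?_ <;>
    simp [crossForm_apply_zero, crossForm_apply_one, crossForm_apply_two, key, reflect_apply] <;>
    ring

theorem gradCross_eq (d : ℝ) (φ ψ : E3 → ℝ) (x : E3) : gradCross d φ ψ x =
    crossForm (fderivWithin ℝ φ (closure (slab d)) x) (fderivWithin ℝ ψ (closure (slab d)) x) := by
  have key : ∀ T : E3 →L[ℝ] ℝ, ((InnerProductSpace.toDual ℝ E3).symm T).ofLp =
      fun i => T (EuclideanSpace.single i 1) := by
    intro T
    ext i
    rw [← InnerProductSpace.toDual_symm_apply, real_inner_comm, EuclideanSpace.inner_single_left]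
    simp
  rw [gradCross, crossForm_eq, gradientWithin, gradientWithin, key, key]

end Cross

/-! ### Cross products of gradients are divergence free -/

section DivFree

open Convolution

theorem integral_add_three {f g h : E3 → ℝ} (hf : Integrable f) (hg : Integrable g)
    (hh : Integrable h) : ∫ x, (f x + g x + h x) = (∫ x, f x) + (∫ x, g x) + ∫ x, h x := by
  rw [← integral_add hf hg]
  exact integral_add (hf.add hg) hh

/-- Integration by parts against a divergence-free field of compact support. -/
theorem integral_fderiv_apply_eq_zero {g : E3 → ℝ} {P : E3 → E3} (hg : ContDiff ℝ 1 g)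
    (hP : ContDiff ℝ 1 P) (hPc : HasCompactSupport P)
    (hdiv : ∀ x, fderiv ℝ P x (EuclideanSpace.single 0 1) 0 +
      fderiv ℝ P x (EuclideanSpace.single 1 1) 1 +
      fderiv ℝ P x (EuclideanSpace.single 2 1) 2 = 0) :
    ∫ x, fderiv ℝ g x (P x) = 0 := by
  have hPi : ∀ i : Fin 3, ContDiff ℝ 1 (fun x => P x i) := fun i => by fun_prop
  have hPic : ∀ i : Fin 3, HasCompactSupport (fun x => P x i) := fun i =>
    hPc.comp_left (g := fun v : E3 => v i) rfl
  have hd : ∀ (i : Fin 3) x v, fderiv ℝ (fun x => P x i) x v = fderiv ℝ P x v i := fun i x v => by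
    have h := (coordProj i).hasFDerivAt.comp x ((hP.differentiable one_ne_zero) x).hasFDerivAt
    exact congrArg (fun L => L v) h.fderiv
  have hcg : ∀ v, Continuous fun x => fderiv ℝ g x v := fun v =>
    (hg.continuous_fderiv one_ne_zero).clm_apply continuous_const
  have hcP : ∀ (i : Fin 3) v, Continuous fun x => fderiv ℝ P x v i := fun i v =>
    (coordProj i).continuous.comp ((hP.continuous_fderiv one_ne_zero).clm_apply continuous_const)
  have hsP : ∀ (i : Fin 3) v, HasCompactSupport fun x => fderiv ℝ P x v i := fun i v =>
    (hPc.fderiv ℝ).comp_left (g := fun L : E3 →L[ℝ] E3 => L v i) rfl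
  have h1 : ∀ (i : Fin 3) v, Integrable fun x => P x i * fderiv ℝ g x v := fun i v =>
    ((hPi i).continuous.mul (hcg v)).integrable_of_hasCompactSupport (hPic i).mul_right
  have h2 : ∀ (i : Fin 3) v, Integrable fun x => fderiv ℝ P x v i * g x := fun i v =>
    ((hcP i v).mul hg.continuous).integrable_of_hasCompactSupport (hsP i v).mul_right
  have key : ∀ (i : Fin 3) v, ∫ x, P x i * fderiv ℝ g x v = -∫ x, fderiv ℝ P x v i * g x := by
    intro i v
    simp_rw [← hd i]
    refine integral_mul_fderiv_eq_neg_fderiv_mul_of_integrable ?_ (h1 i v)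
      (((hPi i).continuous.mul hg.continuous).integrable_of_hasCompactSupport (hPic i).mul_right)
      (fun x _ => (hPi i).differentiable one_ne_zero x)
      (fun x _ => hg.differentiable one_ne_zero x)
    simp_rw [hd i]
    exact h2 i v
  simp_rw [fun x => clm_apply_eq_sum (fderiv ℝ g x) (P x)]
  rw [integral_add_three (h1 _ _) (h1 _ _) (h1 _ _), key, key, key, ← neg_add, ← neg_add,
    ← integral_add_three (h2 _ _) (h2 _ _) (h2 _ _), neg_eq_zero]
  simp_rw [← add_mul, hdiv]
  simp

/-- After a cyclic rotation of the triple product this is the integral of `∇g` against `∇ψ × ∇η`, a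
`C¹` field of compact support whose divergence vanishes by the symmetry of second derivatives. -/
theorem integral_triple_eq_zero_of_contDiff_two {g η ψ : E3 → ℝ} (hg : ContDiff ℝ 1 g)
    (hη : ContDiff ℝ 2 η) (hψ : ContDiff ℝ 2 ψ) (hψc : HasCompactSupport ψ) :
    ∫ x, fderiv ℝ η x (crossForm (fderiv ℝ g x) (fderiv ℝ ψ x)) = 0 := by
  refine (integral_congr_ae (Filter.Eventually.of_forall
    fun x => apply_crossForm_rotate _ _ _)).trans ?_
  have hη' : ContDiff ℝ 1 (fderiv ℝ η) := hη.fderiv_right (by norm_num)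
  have hψ' : ContDiff ℝ 1 (fderiv ℝ ψ) := hψ.fderiv_right (by norm_num)
  have hP : ∀ x, HasFDerivAt (fun x => crossForm (fderiv ℝ ψ x) (fderiv ℝ η x)) _ x := fun x =>
    crossForm.hasFDerivAt_of_bilinear (hψ'.differentiable one_ne_zero x).hasFDerivAt
      (hη'.differentiable one_ne_zero x).hasFDerivAt
  refine integral_fderiv_apply_eq_zero hg (crossForm.isBoundedBilinearMap.contDiff.comp₂ hψ' hη')
    ?_ fun x => ?_
  · exact HasCompactSupport.intro (hψc.fderiv ℝ) fun x hx => by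
      simp [image_eq_zero_of_notMem_tsupport hx]
  · have s1 := (hη.contDiffAt (x := x)).isSymmSndFDerivAt (by simp)
    have s2 := (hψ.contDiffAt (x := x)).isSymmSndFDerivAt (by simp)
    have e : ∀ v, fderiv ℝ (fun x => crossForm (fderiv ℝ ψ x) (fderiv ℝ η x)) x v =
        crossForm (fderiv ℝ ψ x) (fderiv ℝ (fderiv ℝ η) x v) +
          crossForm (fderiv ℝ (fderiv ℝ ψ) x v) (fderiv ℝ η x) := fun v => by
      rw [(hP x).fderiv]; rfl
    simp only [e, PiLp.add_apply, crossForm_apply_zero, crossForm_apply_one, crossForm_apply_two]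
    rw [s1 (EuclideanSpace.single 1 1) (EuclideanSpace.single 0 1),
      s1 (EuclideanSpace.single 2 1) (EuclideanSpace.single 0 1),
      s1 (EuclideanSpace.single 2 1) (EuclideanSpace.single 1 1),
      s2 (EuclideanSpace.single 1 1) (EuclideanSpace.single 0 1),
      s2 (EuclideanSpace.single 2 1) (EuclideanSpace.single 0 1),
      s2 (EuclideanSpace.single 2 1) (EuclideanSpace.single 1 1)]
    ring

/-- A continuously differentiable function of compact support is approximated by smooth functions,
together with its derivative. -/
theorem exists_contDiff_fderiv_sub_le {G : E3 → ℝ} (hG : ContDiff ℝ 1 G)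
    (hGc : HasCompactSupport G) {ε : ℝ} (hε : 0 < ε) :
    ∃ η : E3 → ℝ, ContDiff ℝ 2 η ∧ ∀ x, ‖fderiv ℝ η x - fderiv ℝ G x‖ ≤ ε := by
  have hG' := hG.continuous_fderiv one_ne_zero
  obtain ⟨r, hr, H⟩ := Metric.uniformContinuous_iff.1
    ((hGc.fderiv ℝ).uniformContinuous_of_continuous hG') ε hε
  let φ : ContDiffBump (0 : E3) := ⟨r / 2, r, by positivity, by linarith⟩
  have hφ : LocallyIntegrable (φ.normed volume) := φ.continuous_normed.locallyIntegrable
  refine ⟨φ.normed volume ⋆[ContinuousLinearMap.lsmul ℝ ℝ, volume] G,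
    φ.hasCompactSupport_normed.contDiff_convolution_left _ φ.contDiff_normed
      hG.continuous.locallyIntegrable, fun x => ?_⟩
  refine ContinuousLinearMap.opNorm_le_bound _ hε.le fun v => ?_
  rw [(hGc.hasFDerivAt_convolution_right _ hφ hG x).fderiv, sub_apply,
    convolution_precompR_apply _ hφ (hGc.fderiv ℝ) hG', ← dist_eq_norm]
  refine φ.dist_normed_convolution_le (hG'.clm_apply continuous_const).aestronglyMeasurable
    fun y hy => ?_
  rw [dist_eq_norm, ← sub_apply]
  refine (ContinuousLinearMap.le_opNorm _ _).trans ?_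
  gcongr
  rw [← dist_eq_norm]
  exact (H hy).le

/-- The integral depends only on `∇G` and is continuous in it for the uniform norm, so a
mollification of `G` reduces this to the `C²` case. Only one derivative of `G` and `g` is available
when `s < 2`. -/
theorem integral_triple_eq_zero {G g ψ : E3 → ℝ} (hG : ContDiff ℝ 1 G) (hGc : HasCompactSupport G)
    (hg : ContDiff ℝ 1 g) (hψ : ContDiff ℝ 2 ψ) (hψc : HasCompactSupport ψ) :
    ∫ x, fderiv ℝ G x (crossForm (fderiv ℝ g x) (fderiv ℝ ψ x)) = 0 := by
  set W : E3 → E3 := fun x => crossForm (fderiv ℝ g x) (fderiv ℝ ψ x)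
  have hW : Continuous W := (crossForm.continuous.comp
    (hg.continuous_fderiv one_ne_zero)).clm_apply (hψ.continuous_fderiv two_ne_zero)
  have hWc : HasCompactSupport W :=
    HasCompactSupport.intro (hψc.fderiv ℝ) fun x hx => by
      simp [W, image_eq_zero_of_notMem_tsupport hx]
  have hi : ∀ η : E3 → ℝ, ContDiff ℝ 1 η → Integrable fun x => fderiv ℝ η x (W x) := fun η hη =>
    ((hη.continuous_fderiv one_ne_zero).clm_apply hW).integrable_of_hasCompactSupport
      (HasCompactSupport.intro hWc fun x hx => by simp [image_eq_zero_of_notMem_tsupport hx])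
  have hWi : Integrable fun x => ‖W x‖ := (hW.integrable_of_hasCompactSupport hWc).norm
  have key : ∀ ε > 0, ‖∫ x, fderiv ℝ G x (W x)‖ ≤ ε * ∫ x, ‖W x‖ := by
    intro ε hε
    obtain ⟨η, hη, h⟩ := exists_contDiff_fderiv_sub_le hG hGc hε
    have h0 := integral_triple_eq_zero_of_contDiff_two hg hη hψ hψc
    rw [← sub_zero (∫ x, fderiv ℝ G x (W x)), ← h0,
      ← integral_sub (hi G hG) (hi η (hη.of_le (by norm_num))), ← integral_const_mul]
    refine norm_integral_le_of_norm_le (hWi.const_mul ε) (Filter.Eventually.of_forall fun x => ?_)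
    rw [← sub_apply]
    refine (ContinuousLinearMap.le_opNorm _ _).trans ?_
    gcongr
    rw [norm_sub_rev]
    exact h x
  have hlim : Filter.Tendsto (fun ε : ℝ => ε * ∫ x, ‖W x‖) (nhdsWithin 0 (Ioi 0)) (nhds 0) := by
    have : ContinuousAt (fun ε : ℝ => ε * ∫ x, ‖W x‖) 0 := by fun_prop
    simpa using this.tendsto.mono_left nhdsWithin_le_nhds
  exact norm_le_zero_iff.1 (ge_of_tendsto hlim (Filter.eventually_of_mem self_mem_nhdsWithin key))

/-- A continuously differentiable function on an open set agrees near a compact subset with one of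
compact support in the whole space. -/
theorem exists_contDiff_eventuallyEq {U K : Set E3} (hU : IsOpen U) (hK : IsCompact K)
    (hKU : K ⊆ U) {g : E3 → ℝ} (hg : ContDiffOn ℝ 1 g U) :
    ∃ g' : E3 → ℝ, ContDiff ℝ 1 g' ∧ HasCompactSupport g' ∧ ∀ x ∈ K, g' =ᶠ[nhds x] g := by
  obtain ⟨V, hV, hKV, hVU⟩ := exists_compact_between hK hU hKU
  obtain ⟨χ, h1, h0, -⟩ := exists_contMDiffMap_one_nhds_of_subset_interior (n := 1)
    (modelWithCornersSelf ℝ E3) hK.isClosed hKV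
  have hχ : ContDiff ℝ 1 χ := χ.contMDiff.contDiff
  have hsupp : tsupport χ ⊆ V :=
    closure_minimal (fun x hx => by_contra fun h => hx (h0 x h)) hV.isClosed
  have hz : ∀ x ∉ V, (fun x => χ x * g x) =ᶠ[nhds x] fun _ => 0 := fun x hx => by
    filter_upwards [hV.isClosed.isOpen_compl.mem_nhds hx] with y hy
    rw [h0 y hy, zero_mul]
  refine ⟨fun x => χ x * g x, contDiff_iff_contDiffAt.2 fun x => ?_,
    HasCompactSupport.intro hV fun x hx => by simp [h0 x hx], fun x hx => ?_⟩
  · by_cases hx : x ∈ V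
    · exact hχ.contDiffAt.mul (hg.contDiffAt (hU.mem_nhds (hVU hx)))
    · exact contDiffAt_const.congr_of_eventuallyEq (hz x hx)
  · filter_upwards [Filter.Eventually.filter_mono (nhds_le_nhdsSet hx) h1] with y hy
    rw [hy, one_mul]

/-- Only values near the support of the test function matter, so both functions may be replaced by
compactly supported `C¹` functions on the whole space. -/
theorem isDivFree_gradCross {d : ℝ} {φ ψ : E3 → ℝ} (hφ : ContDiffOn ℝ 1 φ (slab d))
    (hψ : ContDiffOn ℝ 1 ψ (slab d)) : IsDivFree d (gradCross d φ ψ) := by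
  intro η hη hηc hηs
  obtain ⟨φ', h1, h2, h3⟩ := exists_contDiff_eventuallyEq (isOpen_slab d) hηc hηs hφ
  obtain ⟨ψ', h4, h5, h6⟩ := exists_contDiff_eventuallyEq (isOpen_slab d) hηc hηs hψ
  have h0 := integral_triple_eq_zero h1 h2 h4 (contDiff_infty.1 hη 2) hηc
  have e : ∀ x, inner ℝ (gradCross d φ ψ x) (gradient η x) =
      fderiv ℝ φ' x (crossForm (fderiv ℝ ψ' x) (fderiv ℝ η x)) := by
    intro x
    rw [inner_gradient_eq]
    by_cases hx : x ∈ tsupport η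
    · have hn : closure (slab d) ∈ nhds x :=
        Filter.mem_of_superset ((isOpen_slab d).mem_nhds (hηs hx)) subset_closure
      rw [gradCross_eq, apply_crossForm_rotate, fderivWithin_of_mem_nhds hn,
        fderivWithin_of_mem_nhds hn, (h3 x hx).fderiv_eq, (h6 x hx).fderiv_eq]
    · rw [image_eq_zero_of_notMem_tsupport fun h => hx (tsupport_fderiv_subset ℝ h)]
      simp
  simp_rw [e]
  rw [setIntegral_eq_integral_of_forall_compl_eq_zero, h0]
  intro x hx
  rw [image_eq_zero_of_notMem_tsupport (f := fderiv ℝ η)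
    fun h => hx (hηs (tsupport_fderiv_subset ℝ h))]
  simp

end DivFree

/-! ### The cross product for solutions of the transport problem -/

section GradCross

variable {d l₁ l₂ δ s : ℝ} {u : E3 → E3} {f g : E3 → ℝ}

theorem closure_slab_mem_nhds {x : E3} (hx : x ∈ slab d) : closure (slab d) ∈ nhds x :=
  Filter.mem_of_superset ((isOpen_slab d).mem_nhds hx) subset_closure

theorem uniqueDiffOn_closure_slab (hd : 0 < d) : UniqueDiffOn ℝ (closure (slab d)) := by
  refine uniqueDiffOn_convex (convex_slab d).closure ⟨EuclideanSpace.single 2 (-(d / 2)), ?_⟩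
  refine interior_mono subset_closure ?_
  rw [(isOpen_slab d).interior_eq]
  constructor <;> simp <;> linarith

theorem MemHolderLoc.holderBoundLoc_fderiv (hg : MemHolderLoc s (slab d) g) (hs : 1 < s) :
    HolderBoundLoc (Int.fract s) d (⌊s⌋₊ - 1) (fderiv ℝ g) := fun ρ => by
  obtain ⟨N, hN, h⟩ := hg.holderBoundLoc ρ
  rw [← Nat.sub_add_cancel (one_le_floor hs)] at h
  exact ⟨N, hN, h.fderiv (isOpen_slabBall d ρ)⟩

/-- The derivative of a function with local Hölder regularity extends continuously to the closure
of the slab. -/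
theorem MemHolderLoc.continuousOn_fderivWithin (hg : MemHolderLoc s (slab d) g) (hd : 0 < d)
    (hs : 1 < s) (hn : ∀ n : ℤ, s ≠ n) :
    ContinuousOn (fderivWithin ℝ g (closure (slab d))) (closure (slab d)) := by
  have hα := fract_pos_of_ne hn
  have hα1 := Int.fract_lt_one s
  have h1 : ∀ x ∈ closure (slab d), ∃ T, Filter.Tendsto (fderiv ℝ g) (nhdsWithin x (slab d)) (nhds T) :=
    fun x hx => (hg.holderBoundLoc_fderiv hs).exists_tendsto hα hα1 hx
  refine (continuousOn_extendFrom subset_rfl h1).congr fun x hx => ?_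
  refine HasFDerivWithinAt.fderivWithin ?_ (uniqueDiffOn_closure_slab hd x hx)
  exact hasFDerivWithinAt_closure_of_tendsto_fderiv
    (fun y hy => (hg.differentiableAt (one_le_floor hs) hy).differentiableWithinAt)
    (convex_slab d) (isOpen_slab d)
    (fun y hy => (hg.continuousOn y hy).mono subset_closure) (tendsto_extendFrom (h1 x hx))

theorem gradCross_eq_of_mem {φ ψ : E3 → ℝ} {x : E3} (hx : x ∈ slab d) :
    gradCross d φ ψ x = crossForm (fderiv ℝ φ x) (fderiv ℝ ψ x) := by
  rw [gradCross_eq, fderivWithin_of_mem_nhds (closure_slab_mem_nhds hx),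
    fderivWithin_of_mem_nhds (closure_slab_mem_nhds hx)]

theorem continuousOn_gradCross {φ ψ : E3 → ℝ} (hd : 0 < d) (hs : 1 < s) (hn : ∀ n : ℤ, s ≠ n)
    (hφ : MemHolderLoc s (slab d) φ) (hψ : MemHolderLoc s (slab d) ψ) :
    ContinuousOn (gradCross d φ ψ) (closure (slab d)) := by
  refine ContinuousOn.congr ?_ fun x _ => gradCross_eq d φ ψ x
  exact (crossForm.continuous.comp_continuousOn (hφ.continuousOn_fderivWithin hd hs hn)).clm_apply
    (hψ.continuousOn_fderivWithin hd hs hn)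

theorem MemHolderLoc.contDiffOn_one (hg : MemHolderLoc s (slab d) g) (hs : 1 < s) :
    ContDiffOn ℝ 1 g (slab d) := fun x hx =>
  (((hg.memHolder_slabBall (‖x‖ + 1)).contDiffOn.contDiffAt
    ((isOpen_slabBall _ _).mem_nhds (mem_slabBall_norm_add_one hx))).of_le
    (by exact_mod_cast one_le_floor hs)).contDiffWithinAt

theorem isPeriodic_gradCross (hd : 0 < d) (hs : 1 < s) (hn : ∀ n : ℤ, s ≠ n)
    (hg : MemHolderLoc s (slab d) g) (hg₂ : ∀ x ∈ closure (slab d), g (shift 0 l₂ x) = g x)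
    (hG : MemHolderLoc s (slab d) (periodDiff l₁ g))
    (hGp : IsPeriodic d l₁ l₂ (periodDiff l₁ g)) :
    IsPeriodic d l₁ l₂ (gradCross d (periodDiff l₁ g) g) := by
  have hc := continuousOn_gradCross hd hs hn hG hg
  have hgd : ∀ x ∈ slab d, DifferentiableAt ℝ g x := fun x hx =>
    hg.differentiableAt (one_le_floor hs) hx
  have hGd : ∀ x ∈ slab d, DifferentiableAt ℝ (periodDiff l₁ g) x := fun x hx =>
    hG.differentiableAt (one_le_floor hs) hx
  have key : ∀ (h : E3 → ℝ) (a b : ℝ), (∀ x ∈ slab d, DifferentiableAt ℝ h x) →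
      (∀ x ∈ closure (slab d), h (shift a b x) = h x) → ∀ x ∈ slab d,
      fderiv ℝ h (shift a b x) = fderiv ℝ h x := fun h a b hh hp x hx => by
    rw [← (fderiv_comp_shift hh a b hx).fderiv]
    exact (Filter.eventuallyEq_of_mem (closure_slab_mem_nhds hx) hp).fderiv_eq
  refine isPeriodic_of_shift hd
    ((show EqOn _ _ (slab d) from fun x hx => ?_).of_subset_closure
      (ContinuousOn.comp_shift hd hc l₁ 0) hc subset_closure subset_rfl)
    ((show EqOn _ _ (slab d) from fun x hx => ?_).of_subset_closure
      (ContinuousOn.comp_shift hd hc 0 l₂) hc subset_closure subset_rfl)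
  · have e : fderiv ℝ g (shift l₁ 0 x) = fderiv ℝ g x + fderiv ℝ (periodDiff l₁ g) x := by
      rw [(periodDiff_differentiableAt hgd l₁ hx).fderiv]; abel
    rw [gradCross_eq_of_mem hx, gradCross_eq_of_mem (shift_mem_slab.2 hx),
      key _ l₁ 0 hGd (fun x hx => hGp.shift_fst hx) x hx, e, crossForm_self_add]
  · rw [gradCross_eq_of_mem hx, gradCross_eq_of_mem (shift_mem_slab.2 hx),
      key _ 0 l₂ hGd (fun x hx => hGp.shift_snd hx) x hx, key _ 0 l₂ hgd hg₂ x hx]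

/-- The sign is that of `φ`, which is 1, times that of `ψ`, which is `(-1)^j`, times the -1 of the
pseudovector. The identity is checked in the open slab and extended by continuity. -/
theorem isSymmVector_gradCross {φ ψ : E3 → ℝ} (hd : 0 < d) (hs : 1 < s) (hn : ∀ n : ℤ, s ≠ n)
    (hφ : MemHolderLoc s (slab d) φ) (hψ : MemHolderLoc s (slab d) ψ)
    (hφs : IsSymmScalar d 1 φ) (hψs : IsSymmScalar d (-1) ψ) :
    IsSymmVector d (-1) (gradCross d φ ψ) := by
  intro j
  have hc := continuousOn_gradCross hd hs hn hφ hψ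
  have key : ∀ (h : E3 → ℝ) (σ : ℝ), (∀ x ∈ slab d, DifferentiableAt ℝ h x) →
      (∀ x ∈ closure (slab d), h (reflect j.castSucc x) = σ * h x) → ∀ x ∈ slab d,
      fderiv ℝ h (reflect j.castSucc x) = (σ • fderiv ℝ h x).comp (reflectCLM j.castSucc) := by
    intro h σ hh hp x hx
    rw [← fderiv_const_mul (hh x hx), ← (Filter.eventuallyEq_of_mem (closure_slab_mem_nhds hx)
      hp).fderiv_eq, (fderiv_comp_reflect hh j hx).fderiv]
    ext v
    simp [reflectCLM_apply, reflect_reflect]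
  refine (show EqOn (fun x => gradCross d φ ψ (reflect j.castSucc x)) _ (slab d) from
    fun x hx => ?_).of_subset_closure (ContinuousOn.comp_reflect hd hc j)
    (ContinuousOn.const_smul (g := fun x => reflect j.castSucc (gradCross d φ ψ x))
      ((continuous_reflect _).comp_continuousOn hc) (-1 * (-1 : ℝ) ^ ((j : ℕ) + 1))) subset_closure subset_rfl
  simp only
  rw [gradCross_eq_of_mem hx, gradCross_eq_of_mem (reflect_mem_slab.2 hx),
    key φ _ (fun x hx => hφ.differentiableAt (one_le_floor hs) hx) (hφs j) x hx,
    key ψ _ (fun x hx => hψ.differentiableAt (one_le_floor hs) hx) (hψs j) x hx,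
    crossForm_comp_reflect, ← reflectCLM_apply, ← reflectCLM_apply]
  simp

theorem floor_sub_one_eq (s : ℝ) : ⌊s - 1⌋₊ = ⌊s⌋₊ - 1 := Nat.floor_sub_one s

set_option maxSynthPendingDepth 2 in
/-- Global bounds for the cross product of the gradients. -/
theorem exists_gradCross_holderBound (hd : 0 < d) (hl₁ : 0 < l₁) (hl₂ : 0 < l₂) (hδ : 0 < δ)
    (hs : 1 < s) (hn : ∀ n : ℤ, s ≠ n) (M : ℝ≥0) :
    ∃ C : ℝ, 0 ≤ C ∧ ∀ u ∈ setU d l₁ l₂ δ s, holderNorm s (slab d) u ≤ M →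
      ∀ f ∈ spaceY d l₁ l₂ 1 s, ∀ g, MemHolderLoc s (slab d) g → Solves d u f g →
      HolderBound (Int.fract (s - 1)) (slab d) ⌊s - 1⌋₊ (C * (holderNorm s (slab d) f).toReal ^ 2)
        (gradCross d (periodDiff l₁ g) g) := by
  obtain ⟨C, hC, H⟩ := exists_periodDiff_holderBound hd hl₁ hl₂ hδ hs hn M
  rw [Int.fract_sub_one, floor_sub_one_eq]
  refine ⟨2 * (2 * 4 ^ (⌊s⌋₊ - 1) * ‖crossForm‖ * C * C), by positivity,
    fun u hu huM f hf g hg h => ?_⟩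
  obtain ⟨h1, h2⟩ := H u hu huM f hf g hg h
  set c := (holderNorm s (slab d) f).toReal
  have hc : 0 ≤ c := ENNReal.toReal_nonneg
  have hCc : 0 ≤ C * c := by positivity
  have hα := fract_pos_of_ne hn
  have hα1 := Int.fract_lt_one s
  have hgd : ∀ x ∈ slab d, DifferentiableAt ℝ g x := fun x hx =>
    hg.differentiableAt (one_le_floor hs) hx
  have hG := h.periodDiff_mem_spaceY hd hl₁ hl₂ hδ hs hn hu hf hg
  rw [← Nat.sub_add_cancel (one_le_floor hs)] at h1 h2
  have ho := isOpen_slabBall d (l₁ + l₂ + d + 1)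
  -- No global bound on `∇g` is available, since `g` need not be periodic. The product is therefore
  -- estimated on the cell only, and its periodicity does the rest.
  have h3 := (((h2.mono le_rfl (slabBall_subset_slab d _)).fderiv ho).bilin hα hα1
    (convex_slabBall d _) ho crossForm le_rfl (h1.fderiv ho) hCc hCc).congr ho
    fun x hx => (gradCross_eq_of_mem (slabBall_subset_slab d _ hx)).symm
  refine (h3.slab_of_isPeriodic hα hl₁ hl₂ (by positivity)
    (isPeriodic_gradCross hd hs hn hg (fun x hx => h.shift_snd hd hδ hs hn hu hf.2.1 hgd
      hg.continuousOn hx) hG.1.loc hG.2.1)).mono (le_of_eq ?_) subset_rfl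
  ring

theorem Solves.gradCross_mem_spaceX (hd : 0 < d) (hl₁ : 0 < l₁) (hl₂ : 0 < l₂) (hδ : 0 < δ)
    (hs : 1 < s) (hn : ∀ n : ℤ, s ≠ n) (hu : u ∈ setU d l₁ l₂ δ s)
    (hf : f ∈ spaceY d l₁ l₂ 1 s) (hg : MemHolderLoc s (slab d) g) (h : Solves d u f g) :
    gradCross d (periodDiff l₁ g) g ∈ spaceX d l₁ l₂ (-1) (s - 1) := by
  obtain ⟨M, hM⟩ := exists_norm_bound hu
  obtain ⟨C, -, H⟩ := exists_gradCross_holderBound hd hl₁ hl₂ hδ hs hn M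
  have hgd : ∀ x ∈ slab d, DifferentiableAt ℝ g x := fun x hx =>
    hg.differentiableAt (one_le_floor hs) hx
  have hG := h.periodDiff_mem_spaceY hd hl₁ hl₂ hδ hs hn hu hf hg
  exact ⟨(H u hu hM f hf g hg h).memHolder (by rw [Int.fract_sub_one]; exact fract_pos_of_ne hn)
      (convex_slab d) (isOpen_slab d) (continuousOn_gradCross hd hs hn hG.1.loc hg),
    isPeriodic_gradCross hd hs hn hg (fun x hx => h.shift_snd hd hδ hs hn hu hf.2.1 hgd
      hg.continuousOn hx) hG.1.loc hG.2.1,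
    isSymmVector_gradCross hd hs hn hG.1.loc hg hG.2.2
      (h.isSymmScalar hd hδ hs hn hu hf.2.2 hgd hg.continuousOn),
    isDivFree_gradCross (hG.1.loc.contDiffOn_one hs) (hg.contDiffOn_one hs)⟩

/-- Hölder bounds by multiples of a finite number as bounds for the norm. -/
theorem HolderBound.holderNorm_le_mul {F : Type} [NormedAddCommGroup F] [NormedSpace ℝ F] {t C : ℝ}
    {U : Set E3} {h : E3 → F} {N : ℝ≥0∞} (hC : 0 ≤ C) (hN : N ≠ ⊤)
    (hh : HolderBound (Int.fract t) U ⌊t⌋₊ (C * N.toReal) h) :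
    holderNorm t U h ≤ (2 * C.toNNReal : ℝ≥0) * N := by
  refine hh.holderNorm_le.trans (le_of_eq ?_)
  rw [ENNReal.ofReal_mul hC, ENNReal.ofReal_toReal hN, ENNReal.ofReal, ENNReal.coe_mul,
    ENNReal.coe_ofNat]
  ring

end GradCross

end SteadyTransport

end

/-! ### Assembly of the proposition -/

theorem mainTheorem9 (d l₁ l₂ δ s : ℝ) (hd : 0 < d) (hl₁ : 0 < l₁) (hl₂ : 0 < l₂) (hδ : 0 < δ)
    (hs : 1 < s) (hs_nonint : ∀ n : ℤ, s ≠ n) :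
    -- existence and uniqueness
    (∀ u ∈ setU d l₁ l₂ δ s, ∀ f : E3 → ℝ,
      MemHolderLoc s (slab d) f →
      ∃ g : E3 → ℝ,
        MemHolderLoc s (slab d) g ∧
        Solves d u f g ∧
        ∀ g' : E3 → ℝ,
          MemHolderLoc s (slab d) g' →
          Solves d u f g' →
          Set.EqOn g' g (closure (slab d))) ∧
    -- local bounds
    (∀ (M : ℝ≥0) (r₀ : ℝ), 0 < r₀ → ∃ (C : ℝ≥0) (R : ℝ),
      ∀ u ∈ setU d l₁ l₂ δ s,
        holderNorm s (slab d) u ≤ M →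
      ∀ f g : E3 → ℝ,
        MemHolderLoc s (slab d) f →
        MemHolderLoc s (slab d) g →
        Solves d u f g →
      ∀ r : ℝ, R ≤ r →
        holderNorm s (slabBall d r₀) g ≤
          C * holderNorm s (slabBall d r) f) ∧
    -- periodicity and symmetry
    (∀ u ∈ setU d l₁ l₂ δ s, ∀ f ∈ spaceY d l₁ l₂ 1 s,
      ∀ g : E3 → ℝ,
        MemHolderLoc s (slab d) g →
        Solves d u f g →
        (∀ x ∈ closure (slab d), g (shift 0 l₂ x) = g x) ∧
        IsSymmScalar d (-1) g ∧
        periodDiff l₁ g ∈ spaceY d l₁ l₂ 1 s ∧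
        gradCross d (periodDiff l₁ g) g ∈
          spaceX d l₁ l₂ (-1) (s - 1)) ∧
    -- global bounds in the periodic, symmetric case
    (∀ M : ℝ≥0, ∃ C : ℝ≥0,
      ∀ u ∈ setU d l₁ l₂ δ s,
        holderNorm s (slab d) u ≤ M →
      ∀ f ∈ spaceY d l₁ l₂ 1 s, ∀ g : E3 → ℝ,
        MemHolderLoc s (slab d) g →
        Solves d u f g →
        holderNorm s (slab d)
            (periodDiff l₁ g) ≤
          C * holderNorm s (slab d) f ∧
        holderNorm (s - 1) (slab d)
            (gradCross d (periodDiff l₁ g) g) ≤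
          C * holderNorm s (slab d) f ^ 2) := by
  have hα := fract_pos_of_ne hs_nonint
  have hdiff : ∀ g : E3 → ℝ, MemHolderLoc s (slab d) g → ∀ x ∈ slab d, DifferentiableAt ℝ g x :=
    fun g hg x hx => hg.differentiableAt (one_le_floor hs) hx
  refine ⟨fun u hu f hf => ?_, fun M r₀ hr₀ => ?_, fun u hu f hf g hg h => ⟨fun x hx => ?_, ?_, ?_, ?_⟩,
    fun M => ?_⟩
  · obtain ⟨g, hg, h⟩ := exists_solves hd hδ hs hs_nonint hu hf
    exact ⟨g, hg, h, fun g' hg' h' => Solves.eqOn hd hδ hs hs_nonint hu (hdiff g' hg') (hdiff g hg)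
      hg'.continuousOn hg.continuousOn h' h⟩
  · obtain ⟨R, C, hC, H⟩ := exists_solves_holderBound d l₁ l₂ hd hδ hs hs_nonint M hr₀
    refine ⟨2 * C.toNNReal, R, fun u hu huM f g hf hg h r hr => ?_⟩
    have hfr := hf.memHolder_slabBall r
    exact (H u hu huM f g hf hg h _ ENNReal.toReal_nonneg
      (hfr.holderBound.mono le_rfl (slabBall_mono d hr))).holderNorm_le_mul hC hfr.norm_lt_top.ne
  · exact h.shift_snd hd hδ hs hs_nonint hu hf.2.1 (hdiff g hg) hg.continuousOn hx
  · exact h.isSymmScalar hd hδ hs hs_nonint hu hf.2.2 (hdiff g hg) hg.continuousOn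
  · exact h.periodDiff_mem_spaceY hd hl₁ hl₂ hδ hs hs_nonint hu hf hg
  · exact h.gradCross_mem_spaceX hd hl₁ hl₂ hδ hs hs_nonint hu hf hg
  · obtain ⟨C₁, hC₁, H₁⟩ := exists_periodDiff_holderBound hd hl₁ hl₂ hδ hs hs_nonint M
    obtain ⟨C₂, hC₂, H₂⟩ := exists_gradCross_holderBound hd hl₁ hl₂ hδ hs hs_nonint M
    -- One constant has to serve both estimates, so the two are added.
    refine ⟨2 * C₁.toNNReal + 2 * C₂.toNNReal, fun u hu huM f hf g hg h => ⟨?_, ?_⟩⟩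
    · refine ((H₁ u hu huM f hf g hg h).2.holderNorm_le_mul hC₁ hf.1.norm_lt_top.ne).trans ?_
      gcongr
      exact le_self_add
    · have hb := H₂ u hu huM f hf g hg h
      rw [← ENNReal.toReal_pow] at hb
      refine (hb.holderNorm_le_mul hC₂ (ENNReal.pow_ne_top hf.1.norm_lt_top.ne)).trans ?_
      gcongr
      exact le_add_self
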